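/- Let $m,n\ge 1$. Call a density matrix $\rho\in \mathrm D(\mathbb C^m\otimes\mathbb C^n)$ (positive semidefinite, trace one) locally diagonalizable if $\rho=(U\otimes V)\Lambda(U\otimes V)^\dagger$ with $U\in\mathrm U(m)$, $V\in\mathrm U(n)$ and $\Lambda=\sum_{i,j}\lambda_{ij}|ij\rangle\langle ij|$; every $\lambda=(\lambda_{ij})$ that occurs in this way is called an eigenvalue table of $\rho$. Let $\mathcal D_{LU}$ be the set of these states, of dimension $(m^2-1)+(n^2-1)+(m-1)(n-1)$, and let $\mathrm{vol}_{HS}$ be the Riemannian (Hausdorff) volume of this dimension with respect to the Hilbert–Schmidt metric $\langle X,Y\rangle=\operatorname{Tr}X^\dagger Y$. Let $\Delta=\{\lambda:\lambda_{ij}\ge 0,\ \sum_{i,j}\lambda_{ij}=1\}$, let $[d\Lambda]$ be Lebesgue measure (the $(mn-1)$-dimensional Euclidean volume) on $\Delta$, and let $$J(\lambda)=\Bigl[\prod_{1\le i<i'\le m}\sum_{j=1}^n(\lambda_{ij}-\lambda_{i'j})^2\Bigr]\Bigl[\prod_{1\le j<j'\le n}\sum_{i=1}^m(\lambda_{ij}-\lambda_{ij'})^2\Bigr].$$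 Then $0<\mathrm{vol}_{HS}(\mathcal D_{LU})<\infty$, $0<\int_\Delta J\,[d\Lambda]<\infty$, and the joint probability density of the eigenvalues of locally diagonalizable states is proportional to $J(\lambda)\,[d\Lambda]$: if $\rho$ is distributed in $\mathcal D_{LU}$ according to normalized Hilbert–Schmidt volume and $\lambda$ is then chosen uniformly among the finitely many eigenvalue tables of $\rho$, then $\lambda$ has law $J(\lambda)\,[d\Lambda]/\int_\Delta J\,[d\Lambda]$. More precisely, put $$C_{m,n}=2^{\binom m2+\binom n2}\,\frac{\mathrm{vol}(\mathrm U(m))}{\mathrm{vol}(T_{(m)})}\,\frac{\mathrm{vol}(\mathrm U(n))}{\mathrm{vol}(T_{(n)})},$$ where $T_{(k)}\subset\mathrm U(k)$ is the torus of diagonal matrices and the volumes of $\mathrm U(k)$ and $T_{(k)}$ are taken with respect to the invariant volume elements $\prod_i d(\operatorname{Im}G_{ii})\prod_{i<j}d(\operatorname{Re}G_{ij})\,d(\operatorname{Im}G_{ij})$ and $\prod_i d(\operatorname{Im}G_{ii})$, $dG=U^\dagger dU$. Then $0<C_{m,n}<\infty$. On $\mathcal D_{LU}$ the volume element is $C_{m,n}J(\lambda)\,[d\Lambda]\,d\mu_{\mathrm{Haar}}(U)\,d\mu_{\mathrm{Haar}}(V)$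 with normalized Haar measures; since almost every $\rho\in\mathcal D_{LU}$ has exactly $m!\,n!$ eigenvalue tables, this means that $\mathrm{vol}_{HS}$ on $\mathcal D_{LU}$ is $\frac{C_{m,n}}{m!\,n!}$ times the image of $d\mu_{\mathrm{Haar}}(U)\,d\mu_{\mathrm{Haar}}(V)\,J(\lambda)[d\Lambda]$ under $(U,V,\lambda)\mapsto(U\otimes V)\Lambda(U\otimes V)^\dagger$, and that $$\int_{\mathcal D_{LU}}\#\{\lambda\in A:\lambda\text{ an eigenvalue table of }\rho\}\,d\mathrm{vol}_{HS}(\rho)=C_{m,n}\int_A J(\lambda)\,[d\Lambda]$$ for every Borel set $A\subset\mathbb R^{m\times n}$ (with $[d\Lambda]$ supported on $\Delta$). In terms of Hilbert–Schmidt Riemannian volumes, $C_{m,n}=\frac{\mathrm{vol}_{HS}(\mathrm U(m))}{\mathrm{vol}_{HS}(T_{(m)})}\frac{\mathrm{vol}_{HS}(\mathrm U(n))}{\mathrm{vol}_{HS}(T_{(n)})}$. -/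

import Mathlib

open MeasureTheory
open scoped ENNReal Kronecker ComplexConjugate ComplexOrder

namespace LocDiag

noncomputable section

/-! ### The Hilbert–Schmidt metric and volume

The Hilbert–Schmidt metric `‖X‖² = Tr (X† X)` on complex matrices is the Euclidean metric of the
matrix entries. The Riemannian volume which it induces on a `d`-dimensional submanifold is the
`d`-dimensional Hausdorff measure `μHE[d]`, normalised to agree with Lebesgue measure on
`d`-dimensional Euclidean space. -/

instance instMeasurableSpaceMat (ι κ : Type*) [Fintype ι] [Fintype κ] :
    MeasurableSpace (Matrix ι κ ℂ) := borel _

instance instBorelSpaceMat (ι κ : Type*) [Fintype ι] [Fintype κ] :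
    BorelSpace (Matrix ι κ ℂ) := ⟨rfl⟩

/-- The matrix with given entries. The Euclidean norm of the entries is the Hilbert–Schmidt norm
of the matrix. -/
def ofEntries {ι : Type*} (x : EuclideanSpace ℂ (ι × ι)) : Matrix ι ι ℂ :=
  Matrix.of fun i j => x (i, j)

lemma sum_entries_eq_trace {ι : Type*} [Fintype ι] (x : EuclideanSpace ℂ (ι × ι)) :
    ((‖x‖ ^ 2 : ℝ) : ℂ) = ((ofEntries x).conjTranspose * ofEntries x).trace := by
  rw [EuclideanSpace.norm_sq_eq, Fintype.sum_prod_type_right]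
  simp [Matrix.trace, Matrix.mul_apply, ofEntries, ← Complex.normSq_eq_conj_mul_self,
    Complex.normSq_eq_norm_sq]

lemma continuous_ofEntries {ι : Type*} [Fintype ι] :
    Continuous (ofEntries : EuclideanSpace ℂ (ι × ι) → Matrix ι ι ℂ) := by
  refine continuous_matrix fun i j => ?_
  simp only [ofEntries, Matrix.of_apply]
  fun_prop

/-- The `d`-dimensional Hilbert–Schmidt volume on complex matrices. -/
def hsVol (ι : Type*) [Fintype ι] (d : ℕ) : Measure (Matrix ι ι ℂ) :=
  Measure.map ofEntries (μHE[d] : Measure (EuclideanSpace ℂ (ι × ι)))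

/-! ### The unitary group, its maximal torus, and Haar measure -/

/-- The unitary group `U(k)`. -/
abbrev U (k : ℕ) : Type := Matrix.unitaryGroup (Fin k) ℂ

instance instMeasurableSpaceU (k : ℕ) : MeasurableSpace (U k) := borel _

instance instBorelSpaceU (k : ℕ) : BorelSpace (U k) := ⟨rfl⟩

instance instCompactSpaceU (k : ℕ) : CompactSpace (U k) := by
  have hc : IsClosed ((Matrix.unitaryGroup (Fin k) ℂ : Submonoid _) :
      Set (Matrix (Fin k) (Fin k) ℂ)) := isClosed_unitary
  have hb : IsCompact (Set.univ.pi fun _ : Fin k => Set.univ.pi fun _ : Fin k =>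
      Metric.closedBall (0 : ℂ) 1) :=
    isCompact_univ_pi fun _ => isCompact_univ_pi fun _ => isCompact_closedBall _ _
  refine isCompact_iff_compactSpace.mp (hb.of_isClosed_subset hc ?_)
  intro M hM i _ j _
  simpa using entry_norm_bound_of_unitary hM i j

/-- The normalised Haar measure on `U(k)`. -/
def haarU (k : ℕ) : Measure (U k) := Measure.haarMeasure ⊤

/-- `U(k)` as a set of matrices. -/
def unitarySet (k : ℕ) : Set (Matrix (Fin k) (Fin k) ℂ) :=
  {M | M ∈ Matrix.unitaryGroup (Fin k) ℂ}

/-- The standard maximal torus of `U(k)`: the diagonal unitary matrices. -/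
def torusSet (k : ℕ) : Set (Matrix (Fin k) (Fin k) ℂ) :=
  {M | M ∈ Matrix.unitaryGroup (Fin k) ℂ ∧ M.IsDiag}

/-- The element of the Lie algebra `u(k)` (a skew-Hermitian matrix `G`) with diagonal entries
`G i i = √-1 * x i` and entries `G i j = z i j` for `i < j`; the other entries of `z` are not
used. These are the coordinates of the volume element
`[dG] = ∏ᵢ d(Im Gᵢᵢ) ∏_{i<j} d(Re Gᵢⱼ) d(Im Gᵢⱼ)`. -/
def skewOfCoords {k : ℕ} (x : Fin k → ℝ) (z : Fin k → Fin k → ℂ) : Matrix (Fin k) (Fin k) ℂ :=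
  Matrix.of fun i j =>
    if i = j then Complex.I * (x i : ℂ) else if i < j then z i j else -conj (z j i)

/-- A coordinate cube in `u(k)` of volume one with respect to `[dG]`. -/
def unitCellU (k : ℕ) : Set (Matrix (Fin k) (Fin k) ℂ) :=
  {G | ∃ (x : Fin k → ℝ) (z : Fin k → Fin k → ℂ), (∀ i, x i ∈ Set.Icc (0 : ℝ) 1) ∧
    (∀ i j, (z i j).re ∈ Set.Icc (0 : ℝ) 1 ∧ (z i j).im ∈ Set.Icc (0 : ℝ) 1) ∧
    G = skewOfCoords x z}

/-- A coordinate cube in the Lie algebra of the torus, of volume one with respect to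
`∏ᵢ d(Im Gᵢᵢ)`. -/
def unitCellT (k : ℕ) : Set (Matrix (Fin k) (Fin k) ℂ) :=
  {G | ∃ x : Fin k → ℝ, (∀ i, x i ∈ Set.Icc (0 : ℝ) 1) ∧ G = skewOfCoords x 0}

/-- The volume of `U(k)` with respect to the invariant volume element `[dG]`, `dG = U† dU`.
Both `[dG]` and the Hilbert–Schmidt volume element are left invariant, so the former is the latter
divided by the Hilbert–Schmidt volume of a `[dG]`-unit cube of the Lie algebra. -/
def volU (k : ℕ) : ℝ≥0∞ := hsVol (Fin k) (k ^ 2) (unitarySet k) / hsVol (Fin k) (k ^ 2) (unitCellU k)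

/-- The volume of the maximal torus with respect to the invariant volume element
`∏ᵢ d(Im Gᵢᵢ)`, `dG = U† dU`. -/
def volT (k : ℕ) : ℝ≥0∞ := hsVol (Fin k) k (torusSet k) / hsVol (Fin k) k (unitCellT k)

/-- The constant
`C_{m,n} = 2^{binom(m,2)+binom(n,2)} (vol U(m) / vol T_(m)) (vol U(n) / vol T_(n))`. -/
def C (m n : ℕ) : ℝ≥0∞ :=
  2 ^ (m.choose 2 + n.choose 2) * (volU m / volT m) * (volU n / volT n)

/-! ### Locally diagonalizable states -/

/-- Matrices acting on `ℂ^m ⊗ ℂ^n`. -/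
abbrev BiMat (m n : ℕ) : Type := Matrix (Fin m × Fin n) (Fin m × Fin n) ℂ

/-- Tables `λ = (λ_{ij})` of real numbers, with the Euclidean metric. -/
abbrev Table (m n : ℕ) : Type := EuclideanSpace ℝ (Fin m × Fin n)

/-- `(u ⊗ v) Λ (u ⊗ v)†` with `Λ = ∑ λ_{ij} |ij⟩⟨ij|`. -/
def localConj {m n : ℕ} (u : U m) (v : U n) (lam : Table m n) : BiMat m n :=
  (u.1 ⊗ₖ v.1) * Matrix.diagonal (fun p => (lam p : ℂ)) * (u.1 ⊗ₖ v.1).conjTranspose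

/-- The set `D(ℂ^m ⊗ ℂ^n)` of bipartite states (density matrices). -/
def states (m n : ℕ) : Set (BiMat m n) := {ρ | ρ.PosSemidef ∧ ρ.trace = 1}

/-- The tables of eigenvalues of `ρ` which arise from local diagonalizations of `ρ`. -/
def eigTables {m n : ℕ} (ρ : BiMat m n) : Set (Table m n) :=
  {lam | ∃ (u : U m) (v : U n), ρ = localConj u v lam}

/-- `ρ = (u ⊗ v) Λ (u ⊗ v)†` for some unitary `u`, `v` and some diagonal `Λ`. -/
def IsLocallyDiagonalizable {m n : ℕ} (ρ : BiMat m n) : Prop := (eigTables ρ).Nonempty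

/-- The set of locally diagonalizable states in `D(ℂ^m ⊗ ℂ^n)`. -/
def DLU (m n : ℕ) : Set (BiMat m n) := {ρ | ρ ∈ states m n ∧ IsLocallyDiagonalizable ρ}

/-- The dimension of the set of locally diagonalizable states. -/
def dimLU (m n : ℕ) : ℕ := (m ^ 2 - 1) + (n ^ 2 - 1) + (m - 1) * (n - 1)

/-- The Hilbert–Schmidt volume measure on the set of locally diagonalizable states. -/
def volLU (m n : ℕ) : Measure (BiMat m n) := (hsVol (Fin m × Fin n) (dimLU m n)).restrict (DLU m n)

/-! ### The joint distribution of the eigenvalues -/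

/-- The probability simplex of tables with non-negative entries of sum one. -/
def simplex (m n : ℕ) : Set (Table m n) := {lam | (∀ p, 0 ≤ lam p) ∧ ∑ p, lam p = 1}

/-- Lebesgue measure (Euclidean volume of dimension `mn - 1`) on the simplex. -/
def simplexVol (m n : ℕ) : Measure (Table m n) :=
  (μHE[m * n - 1] : Measure (Table m n)).restrict (simplex m n)

/-- `[∏_{i<i'} ∑ⱼ (λ_{ij} - λ_{i'j})²] [∏_{j<j'} ∑ᵢ (λ_{ij} - λ_{ij'})²]`. -/
def J {m n : ℕ} (lam : Table m n) : ℝ :=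
  (∏ i : Fin m, ∏ i' ∈ Finset.Ioi i, ∑ j : Fin n, (lam (i, j) - lam (i', j)) ^ 2) *
  (∏ j : Fin n, ∏ j' ∈ Finset.Ioi j, ∑ i : Fin m, (lam (i, j) - lam (i, j')) ^ 2)

/-- The measure `J(λ) [dλ]` on the simplex. -/
def densityMeasure (m n : ℕ) : Measure (Table m n) :=
  (simplexVol m n).withDensity fun lam => ENNReal.ofReal (J lam)

/-- The joint distribution of the eigenvalues of a locally diagonalizable state: the probability
that the eigenvalue table lies in `A`, if `ρ` is distributed in the set of locally diagonalizable
states according to the normalised Hilbert–Schmidt volume, and the eigenvalue table is then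
chosen uniformly from the finitely many tables of `ρ`. -/
def eigenvalueProb (m n : ℕ) (A : Set (Table m n)) : ℝ≥0∞ :=
  (∫⁻ ρ, ((eigTables ρ ∩ A).ncard : ℝ≥0∞) / ((eigTables ρ).ncard : ℝ≥0∞) ∂(volLU m n)) /
    volLU m n Set.univ

end

end LocDiag

/-! Infinitesimally the theorem is a commutator computation. At the identity and a table λ, the
derivative of `(u, v, λ) ↦ localConj u v λ` is `(X, Y, H) ↦ [X ⊗ 1 + 1 ⊗ Y, Λ] + H`, where X and Y
are skew-Hermitian with zero diagonal and H is a diagonal table of sum zero. The three contributions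
occupy disjoint matrix positions: the X-part joins different rows in the same column, the Y-part
different columns in the same row, and H is diagonal. In orthonormal coordinates the pulled-back
metric is therefore diagonal, with the squared row distances, the squared column distances and 1 as
weights (`norm_sq_locDeriv`). Each pair i < i' carries two real coordinates, so the product of the
square roots of the weights is exactly `J` (`prod_sqrt_locWeights`).

The passage to measures uses a pointwise area formula. Near a point with injective derivative, the
volume of an image agrees with volume factor times volume up to any prescribed K > 1
(`exists_image_volume_near`). Such comparisons pass from small pieces to whole sets
(`Near.of_local`), and a comparison valid for every K > 1 is an equality (`Near.eq_of_forall`).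

Globally, a table with distinct entries is determined by its state up to row and column
permutations, and the unitaries are then determined up to diagonal tori
(`exists_relabel_of_localConj_eq`). A linear functional with distinct coefficients singles out a
fundamental domain for the permutations, and `sel` picks the table lying there. Tables outside the
generic set are null, and so are their states, even where `J` vanishes (`hsVol_tube_univ_eq_zero`).
Invariance under local unitaries shows that `volLU` is the image of Haar × Haar × the law of `sel`
(`volLU_eq_map`).

It remains to find the law of `sel`. The volume of a thin tube around the torus directions is
computed twice: by Haar measure (`volLU_tube_cell`) and by the area formula (`exists_tube_near`). A
cell of U(k) has volume close to (volume of a ball) × vol T (`exists_cellU_near`), so the balls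
cancel and the constant vol U / vol T remains for each factor (`exists_selMeasure_near`,
`selMeasure_eq`). Unfolding the fundamental domain into its m! n! relabellings
(`densityMeasure_eq_sum`) gives the counting formula, the law of the eigenvalues and the volume
element. -/

namespace LocDiag

open scoped NNReal Topology
open Set Module

/-! ### Comparison of volumes up to a factor -/

/-- `a` and `b` agree up to the factor `K`. -/
def Near (K : ℝ≥0) (a b : ℝ≥0∞) : Prop := a ≤ K * b ∧ b ≤ K * a

namespace Near

variable {K L : ℝ≥0} {a b c a' b' : ℝ≥0∞}

lemma symm (h : Near K a b) : Near K b a := ⟨h.2, h.1⟩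

lemma trans (h : Near K a b) (h' : Near L b c) : Near (K * L) a c := by
  constructor
  · calc a ≤ K * b := h.1
      _ ≤ K * (L * c) := by gcongr; exact h'.1
      _ = _ := by push_cast; ring
  · calc c ≤ L * b := h'.2
      _ ≤ L * (K * a) := by gcongr; exact h.2
      _ = _ := by push_cast; ring

lemma mul (h : Near K a b) (h' : Near L a' b') : Near (K * L) (a * a') (b * b') := by
  constructor
  · calc a * a' ≤ (K * b) * (L * b') := by gcongr; exacts [h.1, h'.1]
      _ = _ := by push_cast; ring
  · calc b * b' ≤ (K * a) * (L * a') := by gcongr; exacts [h.2, h'.2]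
      _ = _ := by push_cast; ring

lemma mul_left (h : Near K a b) (c : ℝ≥0∞) : Near K (c * a) (c * b) := by
  constructor
  · calc c * a ≤ c * (K * b) := by gcongr; exact h.1
      _ = _ := by ring
  · calc c * b ≤ c * (K * a) := by gcongr; exact h.2
      _ = _ := by ring

lemma mul_right (h : Near K a b) (c : ℝ≥0∞) : Near K (a * c) (b * c) := by
  simpa only [mul_comm] using h.mul_left c

lemma mono (h : Near K a b) (hK : K ≤ L) : Near L a b :=
  ⟨h.1.trans (by gcongr), h.2.trans (by gcongr)⟩

lemma tsum {ι : Type*} {f g : ι → ℝ≥0∞} (h : ∀ i, Near K (f i) (g i)) :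
    Near K (∑' i, f i) (∑' i, g i) := by
  constructor
  · rw [← ENNReal.tsum_mul_left]
    exact ENNReal.tsum_le_tsum fun i => (h i).1
  · rw [← ENNReal.tsum_mul_left]
    exact ENNReal.tsum_le_tsum fun i => (h i).2

/-- If `b < r < a` with `b ≠ 0`, the factor `r / b` contradicts the hypothesis. For `b = 0` a single
finite factor already forces `a = 0`. -/
lemma le_of_forall (h : ∀ K : ℝ≥0, 1 < K → a ≤ K * b) : a ≤ b := by
  refine ENNReal.le_of_forall_nnreal_lt fun r hr => ?_
  refine le_of_not_gt fun hb => ?_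
  by_cases hb0 : b = 0
  · have := h 2 (by norm_num)
    simp only [hb0, mul_zero, nonpos_iff_eq_zero] at this
    simp [this] at hr
  lift b to ℝ≥0 using hb.ne_top
  have hb0' : 0 < b := pos_iff_ne_zero.mpr (by simpa using hb0)
  have hbr : b < r := by exact_mod_cast hb
  have h1 : 1 < r / b := (one_lt_div hb0').mpr hbr
  have := h _ h1
  rw [← ENNReal.coe_mul, div_mul_cancel₀ _ hb0'.ne'] at this
  exact absurd hr (not_lt.mpr this)

lemma eq_of_forall (h : ∀ K : ℝ≥0, 1 < K → Near K a b) : a = b :=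
  le_antisymm (le_of_forall fun K hK => (h K hK).1) (le_of_forall fun K hK => (h K hK).2)

end Near

/-- Continuity of the power at 1. It distributes the tolerance K over the d dimensions of a
Lipschitz estimate, or over d successive comparisons. -/
lemma exists_one_lt_pow_le {K : ℝ≥0} (hK : 1 < K) (d : ℕ) : ∃ L : ℝ≥0, 1 < L ∧ L ^ d ≤ K := by
  have hc : Filter.Tendsto (fun x : ℝ≥0 => x ^ d) (𝓝[>] 1) (𝓝 1) := by
    have : ContinuousAt (fun x : ℝ≥0 => x ^ d) 1 := by fun_prop
    simpa using this.tendsto.mono_left nhdsWithin_le_nhds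
  have h1 := hc.eventually (Iic_mem_nhds hK)
  obtain ⟨L, hL, hL'⟩ := (h1.and self_mem_nhdsWithin).exists
  exact ⟨L, hL', hL⟩

/-! ### The area formula at a point -/

section Area

/-- On `S` the map `f` factors through `g` by a K-Lipschitz map, and such a map increases
d-dimensional Hausdorff measure by at most `K ^ d`. Since `g` is arbitrary, a map can be compared
directly with its derivative. -/
lemma euclideanHausdorffMeasure_image_le {α X Y : Type*} [EMetricSpace X] [MeasurableSpace X]
    [BorelSpace X] [EMetricSpace Y] [MeasurableSpace Y] [BorelSpace Y] {f : α → X} {g : α → Y}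
    {K : ℝ≥0} {S : Set α} (d : ℕ)
    (h : ∀ a ∈ S, ∀ b ∈ S, edist (f a) (f b) ≤ K * edist (g a) (g b)) :
    μHE[d] (f '' S) ≤ (K ^ d : ℝ≥0) * μHE[d] (g '' S) := by
  classical
  rcases S.eq_empty_or_nonempty with rfl | ⟨s₀, hs₀⟩
  · simp
  have : Nonempty α := ⟨s₀⟩
  -- `g` need not be injective, so `r (g a)` may differ from `a`; the estimate at distance zero
  -- still gives `f (r (g a)) = f a`.
  let r : Y → α := Function.invFunOn g S
  have hr : ∀ a ∈ S, r (g a) ∈ S ∧ g (r (g a)) = g a := fun a ha =>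
    ⟨Function.invFunOn_mem ⟨a, ha, rfl⟩, Function.invFunOn_eq ⟨a, ha, rfl⟩⟩
  have hfr : ∀ a ∈ S, f (r (g a)) = f a := fun a ha => by
    have := h _ (hr a ha).1 _ ha
    rw [(hr a ha).2, edist_self, mul_zero, nonpos_iff_eq_zero, edist_eq_zero] at this
    exact this
  have himg : f '' S = (f ∘ r) '' (g '' S) := by
    rw [← image_comp]
    exact image_congr fun a ha => (hfr a ha).symm
  have hl : LipschitzOnWith K (f ∘ r) (g '' S) := by
    rintro _ ⟨a, ha, rfl⟩ _ ⟨b, hb, rfl⟩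
    simp only [Function.comp, hfr a ha, hfr b hb]
    exact h a ha b hb
  rw [himg, Measure.euclideanHausdorffMeasure_def, Measure.euclideanHausdorffMeasure_def,
    Measure.smul_apply, Measure.smul_apply]
  have := hl.hausdorffMeasure_image_le (d := d) (by positivity)
  rw [ENNReal.smul_def, ENNReal.smul_def, smul_eq_mul, smul_eq_mul]
  calc _ ≤ _ * ((K : ℝ≥0∞) ^ (d : ℝ) * μH[d] (g '' S)) := by gcongr
    _ = _ := by
      rw [ENNReal.rpow_natCast]; push_cast; ring

variable {V Y : Type*} [NormedAddCommGroup V] [InnerProductSpace ℝ V] [FiniteDimensional ℝ V]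
  [MeasurableSpace V] [BorelSpace V] [NormedAddCommGroup Y] [InnerProductSpace ℝ Y]
  [MeasurableSpace Y] [BorelSpace Y]

lemma linear_image_volume (L : V →ₗ[ℝ] Y) (S : Set V) :
    μHE[finrank ℝ V] (L '' S) = ENNReal.ofReal L.normDet * volume S := by
  have h := L.hausdorffMeasure_image S
  rw [← InnerProductSpace.euclideanHausdorffMeasure_eq_volume (V := V),
    Measure.euclideanHausdorffMeasure_def, Measure.euclideanHausdorffMeasure_def,
    Measure.smul_apply, Measure.smul_apply, h]
  rw [ENNReal.smul_def, ENNReal.smul_def, smul_eq_mul, smul_eq_mul]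
  ring

/-- Strict differentiability gives a local Lipschitz bound without injectivity of the derivative.
This serves at the tables where `J` vanishes. -/
lemma exists_image_volume_le {f : V → Y} {f' : V →L[ℝ] Y} {a : V} (hf : HasStrictFDerivAt f f' a) :
    ∃ N ∈ 𝓝 a, ∃ K : ℝ≥0, ∀ S ⊆ N, μHE[finrank ℝ V] (f '' S) ≤ K * volume S := by
  obtain ⟨K, N, hN, hK⟩ := hf.exists_lipschitzOnWith
  refine ⟨N, hN, K ^ finrank ℝ V, fun S hS => ?_⟩
  have := euclideanHausdorffMeasure_image_le (f := f) (g := id) (K := K) (S := S) (finrank ℝ V)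
    fun a ha b hb => hK (hS ha) (hS hb)
  rwa [image_id, InnerProductSpace.euclideanHausdorffMeasure_eq_volume] at this

/-- An injective linear map is bounded below, so near `a` the error of linearization is a small
fraction of `‖f' (x - y)‖`. Distances under `f` and `f'` then agree up to a factor M in both
directions, and volumes up to `M ^ d`. The estimate holds for all subsets, measurable or not. -/
lemma exists_image_volume_near {f : V → Y} {f' : V →L[ℝ] Y} {a : V}
    (hf : HasStrictFDerivAt f f' a) (hinj : Function.Injective f') {K : ℝ≥0} (hK : 1 < K) :
    ∃ N ∈ 𝓝 a, InjOn f N ∧ ∀ S ⊆ N, Near K (μHE[finrank ℝ V] (f '' S))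
      (ENNReal.ofReal f'.toLinearMap.normDet * volume S) := by
  obtain ⟨M, hM, hMK⟩ := exists_one_lt_pow_le hK (finrank ℝ V)
  have hM0 : (0 : ℝ) < M := lt_trans one_pos (by exact_mod_cast hM)
  have hM1 : (1 : ℝ) < M := by exact_mod_cast hM
  obtain ⟨A, hA0, hA⟩ : ∃ A : ℝ≥0, 0 < A ∧ AntilipschitzWith A f' := by
    have := f'.toLinearMap.exists_antilipschitzWith (LinearMap.ker_eq_bot.mpr hinj)
    simpa using this
  have hA0' : (0 : ℝ) < A := by exact_mod_cast hA0
  have hAv : ∀ v, ‖v‖ ≤ A * ‖f' v‖ := fun v => by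
    simpa using hA.le_mul_dist v 0
  -- This makes the error at most `(1 - 1/M) ‖f' (x - y)‖`. The triangle inequality then gives the
  -- lower factor `1/M` and the upper factor `2 - 1/M`, which is at most M because `(M - 1)² ≥ 0`.
  set ε : ℝ := (1 - 1 / M) / A with hε
  have h1M : 1 / (M : ℝ) < 1 := by rw [div_lt_one hM0]; exact hM1
  have hε0 : 0 < ε := div_pos (by linarith) hA0'
  obtain ⟨N, hN, hNf⟩ : ∃ N ∈ 𝓝 a, ∀ x ∈ N, ∀ y ∈ N,
      ‖f x - f y - f' (x - y)‖ ≤ ε * ‖x - y‖ := by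
    have := hf.isLittleO.def hε0
    rw [nhds_prod_eq] at this
    obtain ⟨N, hN, h⟩ := Filter.mem_prod_self_iff.mp this
    exact ⟨N, hN, fun x hx y hy => h (mk_mem_prod hx hy)⟩
  have hb : ∀ x ∈ N, ∀ y ∈ N,
      ‖f x - f y - f' (x - y)‖ ≤ (1 - 1 / M) * ‖f' (x - y)‖ := fun x hx y hy => by
    calc _ ≤ ε * ‖x - y‖ := hNf x hx y hy
      _ ≤ ε * (A * ‖f' (x - y)‖) := by gcongr; exact hAv _
      _ = _ := by rw [hε]; field_simp
  have hup : ∀ x ∈ N, ∀ y ∈ N, ‖f x - f y‖ ≤ M * ‖f' (x - y)‖ := fun x hx y hy => by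
    have h1 := hb x hx y hy
    have h2 : ‖f x - f y‖ ≤ ‖f x - f y - f' (x - y)‖ + ‖f' (x - y)‖ := by
      simpa using norm_add_le (f x - f y - f' (x - y)) (f' (x - y))
    have h3 : (1 - 1 / (M : ℝ)) + 1 ≤ M := by
      have : (1 : ℝ) / M * M = 1 := by field_simp
      nlinarith [sq_nonneg ((M : ℝ) - 1)]
    have h4 := mul_le_mul_of_nonneg_right h3 (norm_nonneg (f' (x - y)))
    linarith
  have hlow : ∀ x ∈ N, ∀ y ∈ N, ‖f' (x - y)‖ ≤ M * ‖f x - f y‖ := fun x hx y hy => by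
    have h1 := hb x hx y hy
    have h2 : ‖f' (x - y)‖ ≤ ‖f x - f y‖ + ‖f x - f y - f' (x - y)‖ := by
      simpa using norm_sub_le (f x - f y) (f x - f y - f' (x - y))
    have h3 : 1 / (M : ℝ) * ‖f' (x - y)‖ ≤ ‖f x - f y‖ := by linarith
    rwa [one_div, inv_mul_le_iff₀ hM0] at h3
  refine ⟨N, hN, fun x hx y hy hxy => ?_, fun S hS => ?_⟩
  · have := hlow x hx y hy
    rw [hxy, sub_self, norm_zero, mul_zero, norm_le_zero_iff, map_eq_zero_iff _ hinj,
      sub_eq_zero] at this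
    exact this
  · have e1 : ∀ x ∈ S, ∀ y ∈ S, edist (f x) (f y) ≤ M * edist (f' x) (f' y) := fun x hx y hy => by
      have := hup x (hS hx) y (hS hy)
      rw [map_sub, ← dist_eq_norm, ← dist_eq_norm] at this
      rw [edist_nndist, edist_nndist, ← ENNReal.coe_mul, ENNReal.coe_le_coe]
      exact_mod_cast this
    have e2 : ∀ x ∈ S, ∀ y ∈ S, edist (f' x) (f' y) ≤ M * edist (f x) (f y) := fun x hx y hy => by
      have := hlow x (hS hx) y (hS hy)
      rw [map_sub, ← dist_eq_norm, ← dist_eq_norm] at this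
      rw [edist_nndist, edist_nndist, ← ENNReal.coe_mul, ENNReal.coe_le_coe]
      exact_mod_cast this
    have hl : μHE[finrank ℝ V] (f' '' S) = _ := linear_image_volume f'.toLinearMap S
    rw [← hl]
    refine Near.mono ⟨?_, ?_⟩ hMK
    · exact euclideanHausdorffMeasure_image_le _ e1
    · exact euclideanHausdorffMeasure_image_le _ e2

end Area

/-- The volume factor of a linear map whose quadratic form is diagonal. -/
lemma normDet_eq_prod_sqrt {κ Y : Type*} [Fintype κ] [NormedAddCommGroup Y]
    [InnerProductSpace ℝ Y] (L : EuclideanSpace ℝ κ →ₗ[ℝ] Y) (s : κ → ℝ) (hs : ∀ k, 0 ≤ s k)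
    (hL : ∀ v, ‖L v‖ ^ 2 = ∑ k, s k * v k ^ 2) : L.normDet = ∏ k, √(s k) := by
  classical
  let b := EuclideanSpace.basisFun κ ℝ
  -- Polarization makes the Gram matrix of the images of the standard basis diagonal; its
  -- determinant is the square of `normDet`.
  have hin : ∀ v w, inner ℝ (L v) (L w) = ∑ k, s k * (v k * w k) := fun v w => by
    rw [real_inner_eq_norm_add_mul_self_sub_norm_mul_self_sub_norm_mul_self_div_two, ← map_add]
    simp only [← pow_two, hL]
    rw [← Finset.sum_sub_distrib, ← Finset.sum_sub_distrib, Finset.sum_div]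
    refine Finset.sum_congr rfl fun k _ => ?_
    simp only [PiLp.add_apply]
    ring
  have hg := L.normDet_sq_eq_det_gram b
  have hgram : Matrix.gram ℝ (fun i => L (b i)) = Matrix.diagonal s := by
    ext i j
    rw [Matrix.gram_apply, hin]
    by_cases hij : i = j
    · subst hij
      simp [b]
    · simp only [b, EuclideanSpace.basisFun_apply, Matrix.diagonal_apply_ne _ hij]
      refine Finset.sum_eq_zero fun k _ => ?_
      by_cases hk : k = i
      · subst hk; simp [hij]
      · simp [hk]
  rw [hgram, Matrix.det_diagonal] at hg
  have h1 : L.normDet ^ 2 = (∏ k, √(s k)) ^ 2 := by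
    rw [← Finset.prod_pow]
    simp only [Real.sq_sqrt (hs _)]
    simpa using hg
  exact (sq_eq_sq₀ L.normDet_nonneg (Finset.prod_nonneg fun k _ => Real.sqrt_nonneg _)).mp h1

end LocDiag

namespace LocDiag

open scoped NNReal Topology
open Set Module

/-! ### Hilbert–Schmidt volume and the Frobenius norm -/

instance instPolishSpaceMat (ι κ : Type*) [Fintype ι] [Fintype κ] :
    PolishSpace (Matrix ι κ ℂ) := inferInstanceAs (PolishSpace (ι → κ → ℂ))

instance instPolishSpaceU (k : ℕ) : PolishSpace (U k) := by
  have hc : IsClosed ((Matrix.unitaryGroup (Fin k) ℂ : Submonoid _) :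
      Set (Matrix (Fin k) (Fin k) ℂ)) := isClosed_unitary
  exact hc.polishSpace

/-- The vector of entries of a matrix. -/
def toEntries {ι : Type*} (A : Matrix ι ι ℂ) : EuclideanSpace ℂ (ι × ι) :=
  WithLp.toLp 2 fun p => A p.1 p.2

lemma ofEntries_toEntries {ι : Type*} (A : Matrix ι ι ℂ) : ofEntries (toEntries A) = A := rfl

lemma toEntries_ofEntries {ι : Type*} (x : EuclideanSpace ℂ (ι × ι)) :
    toEntries (ofEntries x) = x := rfl

section

variable {ι ι' : Type*} [Fintype ι] [Fintype ι']

lemma continuous_toEntries : Continuous (toEntries : Matrix ι ι ℂ → EuclideanSpace ℂ (ι × ι)) := by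
  refine (PiLp.continuous_toLp 2 _).comp (continuous_pi fun p => ?_)
  exact (continuous_apply p.2).comp (continuous_apply p.1)

/-- Matrices are homeomorphic to the vectors of their entries. -/
def entriesHomeomorph (ι : Type*) [Fintype ι] : EuclideanSpace ℂ (ι × ι) ≃ₜ Matrix ι ι ℂ where
  toFun := ofEntries
  invFun := toEntries
  left_inv := toEntries_ofEntries
  right_inv := ofEntries_toEntries
  continuous_toFun := continuous_ofEntries
  continuous_invFun := continuous_toEntries

lemma hsVol_apply (d : ℕ) (S : Set (Matrix ι ι ℂ)) : hsVol ι d S = μHE[d] (toEntries '' S) := by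
  have := (entriesHomeomorph ι).measurableEmbedding.map_apply
    (μHE[d] : Measure (EuclideanSpace ℂ (ι × ι))) S
  rw [hsVol, show ofEntries = ⇑(entriesHomeomorph ι) from rfl, this]
  congr 1
  exact ((entriesHomeomorph ι).symm.image_eq_preimage_symm S).symm

open scoped Matrix.Norms.Frobenius

lemma norm_sq_eq_sum (A : Matrix ι ι' ℂ) : ‖A‖ ^ 2 = ∑ i, ∑ j, ‖A i j‖ ^ 2 := by
  rw [Matrix.frobenius_norm_def, ← Real.sqrt_eq_rpow, Real.sq_sqrt (by positivity)]
  simp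

lemma norm_toEntries (A : Matrix ι ι ℂ) : ‖toEntries A‖ = ‖A‖ := by
  rw [← sq_eq_sq₀ (norm_nonneg _) (norm_nonneg _), norm_sq_eq_sum, EuclideanSpace.norm_sq_eq,
    Fintype.sum_prod_type]
  rfl

lemma toEntries_sub (A B : Matrix ι ι ℂ) : toEntries (A - B) = toEntries A - toEntries B := rfl

/-- Taking entries is a linear isometry for the Frobenius norm. -/
def entriesIsometry (ι : Type*) [Fintype ι] : Matrix ι ι ℂ →ₗᵢ[ℝ] EuclideanSpace ℂ (ι × ι) where
  toFun := toEntries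
  map_add' _ _ := rfl
  map_smul' _ _ := rfl
  norm_map' := norm_toEntries

lemma edist_toEntries (A B : Matrix ι ι ℂ) :
    edist (toEntries A) (toEntries B) = edist A B := (entriesIsometry ι).isometry A B

lemma hsVol_image_le_of_edist {α : Type*} (d : ℕ) {f : α → Matrix ι ι ℂ} {g : α → Matrix ι' ι' ℂ}
    {S : Set α} {K : ℝ≥0} (h : ∀ a ∈ S, ∀ b ∈ S, edist (f a) (f b) ≤ K * edist (g a) (g b)) :
    hsVol ι d (f '' S) ≤ (K ^ d : ℝ≥0) * hsVol ι' d (g '' S) := by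
  rw [hsVol_apply, hsVol_apply, ← image_comp, ← image_comp]
  refine euclideanHausdorffMeasure_image_le d fun a ha b hb => ?_
  simpa only [Function.comp, edist_toEntries] using h a ha b hb

lemma hsVol_image_of_norm {f : Matrix ι ι ℂ → Matrix ι' ι' ℂ} (d : ℕ) {S : Set (Matrix ι ι ℂ)}
    (h : ∀ A ∈ S, ∀ B ∈ S, ‖f A - f B‖ = ‖A - B‖) : hsVol ι' d (f '' S) = hsVol ι d S := by
  have h' : ∀ A ∈ S, ∀ B ∈ S, edist (f A) (f B) = edist A B := fun A hA B hB => by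
    rw [edist_dist, edist_dist, dist_eq_norm, dist_eq_norm, h A hA B hB]
  refine le_antisymm ?_ ?_
  · simpa using hsVol_image_le_of_edist (g := id) (K := 1) d fun A hA B hB => by
      simpa using (h' A hA B hB).le
  · simpa using hsVol_image_le_of_edist (f := id) (g := f) (K := 1) d fun A hA B hB => by
      simpa using (h' A hA B hB).ge

variable {κ : Type*} [Fintype κ]

lemma hsVol_image_isometry {f : EuclideanSpace ℝ κ → Matrix ι ι ℂ} {d : ℕ}
    (hd : d = Fintype.card κ)
    (hf : ∀ x y, ‖f x - f y‖ = ‖x - y‖) (S : Set (EuclideanSpace ℝ κ)) :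
    hsVol ι d (f '' S) = volume S := by
  have hi : Isometry (toEntries ∘ f) := Isometry.of_dist_eq fun x y => by
    rw [dist_eq_norm, dist_eq_norm, Function.comp, Function.comp, ← toEntries_sub, norm_toEntries,
      hf]
  rw [hsVol_apply, ← image_comp, hi.euclideanHausdorffMeasure_image, hd,
    ← finrank_euclideanSpace (𝕜 := ℝ), InnerProductSpace.euclideanHausdorffMeasure_eq_volume]

lemma exists_hsVol_image_le {f : EuclideanSpace ℝ κ → Matrix ι ι ℂ}
    {f' : EuclideanSpace ℝ κ →L[ℝ] Matrix ι ι ℂ} {a : EuclideanSpace ℝ κ}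
    (hf : HasStrictFDerivAt f f' a) {d : ℕ} (hd : d = Fintype.card κ) :
    ∃ N ∈ 𝓝 a, ∃ K : ℝ≥0, ∀ S ⊆ N, hsVol ι d (f '' S) ≤ K * volume S := by
  obtain ⟨N, hN, K, h⟩ := exists_image_volume_le
    ((entriesIsometry ι).toContinuousLinearMap.hasStrictFDerivAt.comp a hf)
  refine ⟨N, hN, K, fun S hS => ?_⟩
  have := h S hS
  rw [finrank_euclideanSpace, ← hd] at this
  rw [hsVol_apply, ← image_comp]
  exact this

/-- Positive weights of a diagonal quadratic form give both the injectivity of the derivative and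
its volume factor, so the pointwise area formula applies. -/
lemma exists_hsVol_image_near {f : EuclideanSpace ℝ κ → Matrix ι ι ℂ}
    {f' : EuclideanSpace ℝ κ →L[ℝ] Matrix ι ι ℂ} {a : EuclideanSpace ℝ κ}
    (hf : HasStrictFDerivAt f f' a) {d : ℕ} (hd : d = Fintype.card κ) {s : κ → ℝ}
    (hs : ∀ k, 0 < s k) (hq : ∀ v, ‖f' v‖ ^ 2 = ∑ k, s k * v k ^ 2) {K : ℝ≥0} (hK : 1 < K) :
    ∃ N ∈ 𝓝 a, InjOn f N ∧ ∀ S ⊆ N,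
      Near K (hsVol ι d (f '' S)) (ENNReal.ofReal (∏ k, √(s k)) * volume S) := by
  set g' := (entriesIsometry ι).toContinuousLinearMap.comp f' with hg'
  have hgn : ∀ v, ‖g' v‖ = ‖f' v‖ := fun v => norm_toEntries _
  have hdet : g'.toLinearMap.normDet = ∏ k, √(s k) :=
    normDet_eq_prod_sqrt _ s (fun k => (hs k).le) fun v => by
      rw [ContinuousLinearMap.coe_coe, hgn, hq]
  have hinj : Function.Injective g' := by
    rw [injective_iff_map_eq_zero]
    intro v hv
    have h0 : ∑ k, s k * v k ^ 2 = 0 := by rw [← hq, ← hgn, hv]; simp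
    rw [Finset.sum_eq_zero_iff_of_nonneg fun k _ => mul_nonneg (hs k).le (sq_nonneg _)] at h0
    ext k
    have := h0 k (Finset.mem_univ _)
    simpa [(hs k).ne'] using this
  obtain ⟨N, hN, hi, h⟩ := exists_image_volume_near
    ((entriesIsometry ι).toContinuousLinearMap.hasStrictFDerivAt.comp a hf) hinj hK
  refine ⟨N, hN, fun x hx y hy hxy => hi hx hy (by simp [hxy]), fun S hS => ?_⟩
  have := h S hS
  rw [hdet, finrank_euclideanSpace, ← hd] at this
  rw [hsVol_apply, ← image_comp]
  exact this

lemma norm_sq_eq_trace (A : Matrix ι ι ℂ) : ((‖A‖ ^ 2 : ℝ) : ℂ) = (A.conjTranspose * A).trace := by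
  rw [← norm_toEntries, sum_entries_eq_trace, ofEntries_toEntries]

variable [DecidableEq ι]

lemma norm_unitary_mul {u : Matrix ι ι ℂ} (hu : u ∈ Matrix.unitaryGroup ι ℂ) (A : Matrix ι ι ℂ) :
    ‖u * A‖ = ‖A‖ := by
  rw [← sq_eq_sq₀ (norm_nonneg _) (norm_nonneg _), ← Complex.ofReal_inj, norm_sq_eq_trace,
    norm_sq_eq_trace, Matrix.conjTranspose_mul, Matrix.mul_assoc, ← Matrix.mul_assoc u.conjTranspose,
    ← Matrix.star_eq_conjTranspose u, Matrix.mem_unitaryGroup_iff'.mp hu, Matrix.one_mul]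

lemma norm_mul_unitary {u : Matrix ι ι ℂ} (hu : u ∈ Matrix.unitaryGroup ι ℂ) (A : Matrix ι ι ℂ) :
    ‖A * u‖ = ‖A‖ := by
  rw [← Matrix.frobenius_norm_conjTranspose, Matrix.conjTranspose_mul, norm_unitary_mul,
    Matrix.frobenius_norm_conjTranspose]
  exact Unitary.star_mem hu

end

lemma hsVol_unitary_mul {ι : Type*} [Fintype ι] [DecidableEq ι] {u v : Matrix ι ι ℂ}
    (hu : u ∈ Matrix.unitaryGroup ι ℂ) (hv : v ∈ Matrix.unitaryGroup ι ℂ) (d : ℕ)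
    (S : Set (Matrix ι ι ℂ)) : hsVol ι d ((fun A => u * A * v) '' S) = hsVol ι d S :=
  hsVol_image_of_norm d fun A _ B _ => by
    rw [← sub_mul, ← mul_sub, norm_mul_unitary hv, norm_unitary_mul hu]

end LocDiag

namespace LocDiag

open scoped NNReal Topology
open Set Module

/-! ### Coordinates on the Lie algebra of the unitary group -/

section SumCoordinates

variable {α β : Type*}

/-- The first block of coordinates. -/
def fstBlock (α β : Type*) : EuclideanSpace ℝ (α ⊕ β) →L[ℝ] EuclideanSpace ℝ α where
  toFun v := WithLp.toLp 2 fun a => v (Sum.inl a)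
  map_add' _ _ := rfl
  map_smul' _ _ := rfl
  cont := by fun_prop

/-- The second block of coordinates. -/
def sndBlock (α β : Type*) : EuclideanSpace ℝ (α ⊕ β) →L[ℝ] EuclideanSpace ℝ β where
  toFun v := WithLp.toLp 2 fun b => v (Sum.inr b)
  map_add' _ _ := rfl
  map_smul' _ _ := rfl
  cont := by fun_prop

/-- The vector with given blocks of coordinates. -/
def joinBlocks (x : EuclideanSpace ℝ α) (y : EuclideanSpace ℝ β) : EuclideanSpace ℝ (α ⊕ β) :=
  WithLp.toLp 2 (Sum.elim x y)

@[simp] lemma fstBlock_apply (v : EuclideanSpace ℝ (α ⊕ β)) (a : α) :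
    fstBlock α β v a = v (Sum.inl a) := rfl

@[simp] lemma sndBlock_apply (v : EuclideanSpace ℝ (α ⊕ β)) (b : β) :
    sndBlock α β v b = v (Sum.inr b) := rfl

@[simp] lemma fstBlock_joinBlocks (x : EuclideanSpace ℝ α) (y : EuclideanSpace ℝ β) :
    fstBlock α β (joinBlocks x y) = x := rfl

@[simp] lemma sndBlock_joinBlocks (x : EuclideanSpace ℝ α) (y : EuclideanSpace ℝ β) :
    sndBlock α β (joinBlocks x y) = y := rfl

lemma joinBlocks_blocks (v : EuclideanSpace ℝ (α ⊕ β)) :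
    joinBlocks (fstBlock α β v) (sndBlock α β v) = v := by
  ext i
  cases i <;> rfl

variable [Fintype α] [Fintype β]

lemma volume_blocks (A : Set (EuclideanSpace ℝ α)) (B : Set (EuclideanSpace ℝ β)) :
    volume {v : EuclideanSpace ℝ (α ⊕ β) | fstBlock α β v ∈ A ∧ sndBlock α β v ∈ B} =
      volume A * volume B := by
  have h1 := EuclideanSpace.volume_preserving_symm_measurableEquiv_toLp (α ⊕ β)
  have h2 := volume_measurePreserving_sumPiEquivProdPi (fun _ : α ⊕ β => ℝ)
  have h3 := ((EuclideanSpace.volume_preserving_symm_measurableEquiv_toLp α).symm).prod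
    ((EuclideanSpace.volume_preserving_symm_measurableEquiv_toLp β).symm)
  let e := ((MeasurableEquiv.toLp 2 (α ⊕ β → ℝ)).symm.trans
    (MeasurableEquiv.sumPiEquivProdPi fun _ : α ⊕ β => ℝ)).trans
    ((MeasurableEquiv.toLp 2 (α → ℝ)).prodCongr (MeasurableEquiv.toLp 2 (β → ℝ)))
  have h4 : MeasurePreserving e volume (volume.prod volume) := (h3.comp h2).comp h1
  rw [← Measure.prod_prod, ← h4.measure_preimage_equiv]
  rfl

lemma norm_sq_blocks (v : EuclideanSpace ℝ (α ⊕ β)) :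
    ‖v‖ ^ 2 = ‖fstBlock α β v‖ ^ 2 + ‖sndBlock α β v‖ ^ 2 := by
  simp [EuclideanSpace.norm_sq_eq]

end SumCoordinates

/-- Positions of the off-diagonal entries of a `k × k` matrix. -/
abbrev Off (k : ℕ) : Type := {p : Fin k × Fin k // p.1 ≠ p.2}

lemma card_off (k : ℕ) : Fintype.card (Off k) + k = k ^ 2 := by
  have h := Fintype.card_subtype_compl (fun p : Fin k × Fin k => p.1 = p.2)
  have h2 : Fintype.card {p : Fin k × Fin k // p.1 = p.2} = k := by
    rw [Fintype.card_congr (β := Fin k)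
      ⟨fun p => p.1.1, fun i => ⟨(i, i), rfl⟩, fun p => by
        rcases p with ⟨⟨a, b⟩, h⟩; simp at h; subst h; rfl, fun i => rfl⟩]
    simp
  rw [h2] at h
  have h3 : Fintype.card (Off k) = k * k - k := by
    rw [show Fintype.card (Off k) = _ from h]; simp
  have : k ≤ k * k := Nat.le_mul_self k
  rw [h3, pow_two]
  omega

lemma card_off_eq (k : ℕ) : Fintype.card (Off k) = 2 * k.choose 2 := by
  have h1 := card_off k
  have h2 := Nat.choose_two_right k
  have h3 : 2 ∣ k * (k - 1) := (Nat.even_mul_pred_self k).two_dvd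
  have h4 : k * (k - 1) + k = k ^ 2 := by
    cases k with
    | zero => rfl
    | succ n => simp; ring
  omega

lemma sum_off {k : ℕ} (f : Fin k → Fin k → ℝ) (hf : ∀ i, f i i = 0) :
    ∑ i, ∑ j, f i j = ∑ p : Off k, f p.1.1 p.1.2 := by
  rw [← Fintype.sum_prod_type', ← Fintype.sum_subtype_add_sum_subtype
    (fun p : Fin k × Fin k => p.1 ≠ p.2) fun p => f p.1 p.2, add_eq_left]
  refine Finset.sum_eq_zero fun p _ => ?_
  rw [← not_not.mp p.2, hf]

/-- The coordinate at an off-diagonal position, extended by zero to the diagonal. -/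
noncomputable def offCoord {k : ℕ} (x : EuclideanSpace ℝ (Off k)) (i j : Fin k) : ℝ :=
  if h : i ≠ j then x ⟨(i, j), h⟩ else 0

/-- The skew-Hermitian matrix with zero diagonal and given orthonormal coordinates. -/
noncomputable def offMat (k : ℕ) : EuclideanSpace ℝ (Off k) →ₗ[ℝ] Matrix (Fin k) (Fin k) ℂ where
  toFun x := Matrix.of fun i j =>
    if i < j then ((offCoord x i j : ℂ) + offCoord x j i * Complex.I) / (√2 : ℝ)
    else (-(offCoord x j i : ℂ) + offCoord x i j * Complex.I) / (√2 : ℝ)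
  map_add' x y := by
    ext i j
    have h : ∀ i j, offCoord (x + y) i j = offCoord x i j + offCoord y i j := fun i j => by
      unfold offCoord; split <;> simp
    simp only [Matrix.of_apply, Matrix.add_apply, h]
    split <;> push_cast <;> ring
  map_smul' r x := by
    ext i j
    have h : ∀ i j, offCoord (r • x) i j = r * offCoord x i j := fun i j => by
      unfold offCoord; split <;> simp
    simp only [Matrix.of_apply, Matrix.smul_apply, h, RingHom.id_apply, Complex.real_smul]
    split <;> push_cast <;> ring

lemma offMat_apply {k : ℕ} (x : EuclideanSpace ℝ (Off k)) (i j : Fin k) : offMat k x i j =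
    if i < j then ((offCoord x i j : ℂ) + offCoord x j i * Complex.I) / (√2 : ℝ)
    else (-(offCoord x j i : ℂ) + offCoord x i j * Complex.I) / (√2 : ℝ) := rfl

lemma offCoord_self {k : ℕ} (x : EuclideanSpace ℝ (Off k)) (i : Fin k) : offCoord x i i = 0 := by
  simp [offCoord]

lemma offMat_diag {k : ℕ} (x : EuclideanSpace ℝ (Off k)) (i : Fin k) : offMat k x i i = 0 := by
  simp [offMat_apply, offCoord_self]

lemma norm_sq_offMat {k : ℕ} (x : EuclideanSpace ℝ (Off k)) (i j : Fin k) :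
    ‖offMat k x i j‖ ^ 2 = (offCoord x i j ^ 2 + offCoord x j i ^ 2) / 2 := by
  rw [offMat_apply]
  have h2 : √2 ^ 2 = (2 : ℝ) := Real.sq_sqrt (by norm_num)
  split
  · rw [norm_div, div_pow, Complex.norm_real, Real.norm_of_nonneg (Real.sqrt_nonneg _), h2,
      ← Complex.normSq_eq_norm_sq, Complex.normSq_add_mul_I]
  · rw [norm_div, div_pow, Complex.norm_real, Real.norm_of_nonneg (Real.sqrt_nonneg _), h2,
      ← Complex.normSq_eq_norm_sq, ← Complex.ofReal_neg, Complex.normSq_add_mul_I]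
    ring

/-- The two coordinates of a pair enter both the (i,j) and the (j,i) entry, and the division by √2
in `offMat` gives each entry half of the sum of their squares. Constant weight 1 yields an isometry;
row and column distances as weights yield the Jacobian. -/
lemma sum_mul_norm_sq_offMat {k : ℕ} (x : EuclideanSpace ℝ (Off k)) (w : Fin k → Fin k → ℝ)
    (hw : ∀ i j, w i j = w j i) :
    ∑ i, ∑ j, w i j * ‖offMat k x i j‖ ^ 2 = ∑ p : Off k, w p.1.1 p.1.2 * x p ^ 2 := by
  have h1 : ∑ i, ∑ j, w i j * ‖offMat k x i j‖ ^ 2 = ∑ i, ∑ j, w i j * offCoord x i j ^ 2 := by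
    have h2 : ∑ i, ∑ j, w i j * offCoord x j i ^ 2 = ∑ i, ∑ j, w i j * offCoord x i j ^ 2 := by
      rw [Finset.sum_comm]
      exact Finset.sum_congr rfl fun i _ => Finset.sum_congr rfl fun j _ => by rw [hw]
    have h3 : ∑ i, ∑ j, w i j * ‖offMat k x i j‖ ^ 2 = (∑ i, ∑ j, w i j * offCoord x i j ^ 2 +
        ∑ i, ∑ j, w i j * offCoord x j i ^ 2) / 2 := by
      rw [← Finset.sum_add_distrib, Finset.sum_div]
      refine Finset.sum_congr rfl fun i _ => ?_
      rw [← Finset.sum_add_distrib, Finset.sum_div]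
      refine Finset.sum_congr rfl fun j _ => ?_
      rw [norm_sq_offMat]
      ring
    rw [h3, h2]
    ring
  rw [h1, sum_off _ fun i => by simp [offCoord_self]]
  refine Finset.sum_congr rfl fun p _ => ?_
  simp [offCoord, p.2]

lemma star_offMat {k : ℕ} (x : EuclideanSpace ℝ (Off k)) : star (offMat k x) = -offMat k x := by
  ext i j
  rw [Matrix.star_apply, Matrix.neg_apply, offMat_apply, offMat_apply]
  rcases lt_trichotomy i j with h | rfl | h
  · rw [if_neg h.not_gt, if_pos h]
    simp
    ring
  · simp [offCoord_self]
  · rw [if_pos h, if_neg h.not_gt]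
    simp
    ring

/-- The diagonal skew-Hermitian matrix with given coordinates. -/
noncomputable def diagMat (k : ℕ) : EuclideanSpace ℝ (Fin k) →ₗ[ℝ] Matrix (Fin k) (Fin k) ℂ where
  toFun x := Matrix.diagonal fun i => Complex.I * x i
  map_add' x y := by
    rw [Matrix.diagonal_add]; congr 1; ext i; simp [mul_add]
  map_smul' r x := by
    rw [← Matrix.diagonal_smul]; congr 1; ext i; simp; ring

lemma diagMat_apply {k : ℕ} (x : EuclideanSpace ℝ (Fin k)) :
    diagMat k x = Matrix.diagonal fun i => Complex.I * (x i : ℂ) := rfl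

/-- The skew-Hermitian matrix with given orthonormal coordinates. -/
noncomputable def skewMat (k : ℕ) : EuclideanSpace ℝ (Off k ⊕ Fin k) →ₗ[ℝ] Matrix (Fin k) (Fin k) ℂ :=
  offMat k ∘ₗ (fstBlock (Off k) (Fin k)).toLinearMap +
    diagMat k ∘ₗ (sndBlock (Off k) (Fin k)).toLinearMap

lemma skewMat_apply {k : ℕ} (v : EuclideanSpace ℝ (Off k ⊕ Fin k)) :
    skewMat k v = offMat k (fstBlock _ _ v) + diagMat k (sndBlock _ _ v) := rfl

section

open scoped Matrix.Norms.Frobenius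

lemma norm_offMat {k : ℕ} (x : EuclideanSpace ℝ (Off k)) : ‖offMat k x‖ = ‖x‖ := by
  rw [← sq_eq_sq₀ (norm_nonneg _) (norm_nonneg _), norm_sq_eq_sum, EuclideanSpace.norm_sq_eq]
  simpa using sum_mul_norm_sq_offMat x (fun _ _ => 1) fun _ _ => rfl

lemma norm_diagMat {k : ℕ} (x : EuclideanSpace ℝ (Fin k)) : ‖diagMat k x‖ = ‖x‖ := by
  rw [← sq_eq_sq₀ (norm_nonneg _) (norm_nonneg _), diagMat_apply, Matrix.frobenius_norm_diagonal,
    EuclideanSpace.norm_sq_eq, EuclideanSpace.norm_sq_eq]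
  simp

lemma norm_skewMat {k : ℕ} (v : EuclideanSpace ℝ (Off k ⊕ Fin k)) : ‖skewMat k v‖ = ‖v‖ := by
  rw [← sq_eq_sq₀ (norm_nonneg _) (norm_nonneg _), norm_sq_blocks, ← norm_offMat, ← norm_diagMat,
    norm_sq_eq_sum, norm_sq_eq_sum, norm_sq_eq_sum, ← Finset.sum_add_distrib]
  refine Finset.sum_congr rfl fun i _ => ?_
  rw [← Finset.sum_add_distrib]
  refine Finset.sum_congr rfl fun j _ => ?_
  rw [skewMat_apply, Matrix.add_apply]
  by_cases h : i = j
  · subst h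
    simp [offMat_diag]
  · simp [diagMat_apply, Matrix.diagonal_apply_ne _ h]

end

lemma star_diagMat {k : ℕ} (x : EuclideanSpace ℝ (Fin k)) : star (diagMat k x) = -diagMat k x := by
  rw [diagMat_apply, Matrix.star_eq_conjTranspose, Matrix.diagonal_conjTranspose,
    Matrix.diagonal_neg]
  congr 1
  ext i
  simp

lemma exists_skewMat_eq {k : ℕ} {A : Matrix (Fin k) (Fin k) ℂ} (hA : star A = -A) :
    ∃ v, skewMat k v = A := by
  have hji : ∀ i j, A j i = -conj (A i j) := fun i j => by
    have := congrFun (congrFun hA j) i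
    rw [Matrix.star_apply, Matrix.neg_apply] at this
    rw [← neg_eq_iff_eq_neg, ← this]
    rfl
  -- A position above the diagonal stores the real part of its entry, and the mirrored position
  -- below stores the imaginary part of the same upper entry.
  let x : EuclideanSpace ℝ (Off k) := WithLp.toLp 2 fun p =>
    if p.1.1 < p.1.2 then √2 * (A p.1.1 p.1.2).re else √2 * (A p.1.2 p.1.1).im
  have h2 : ((√2 : ℝ) : ℂ) ≠ 0 := by
    rw [Complex.ofReal_ne_zero]; positivity
  refine ⟨joinBlocks x (WithLp.toLp 2 fun i => (A i i).im), ?_⟩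
  have key : ∀ i j, i < j → offMat k x i j = A i j := fun i j h => by
    rw [offMat_apply, if_pos h, offCoord, dif_pos h.ne, offCoord, dif_pos h.ne']
    simp only [x, h, if_true, h.not_gt, if_false]
    rw [div_eq_iff h2]
    conv_rhs => rw [← Complex.re_add_im (A i j)]
    push_cast
    ring
  ext i j
  rw [skewMat_apply, fstBlock_joinBlocks, sndBlock_joinBlocks, Matrix.add_apply]
  rcases lt_trichotomy i j with h | rfl | h
  · rw [key i j h, diagMat_apply, Matrix.diagonal_apply_ne _ h.ne, add_zero]
  · rw [offMat_diag, diagMat_apply, Matrix.diagonal_apply_eq, zero_add]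
    have := congrArg Complex.re (hji i i)
    simp at this
    apply Complex.ext <;> simp
    linarith
  · rw [diagMat_apply, Matrix.diagonal_apply_ne _ h.ne', add_zero, hji j i, ← key j i h]
    have := congrFun (congrFun (star_offMat x) i) j
    rw [Matrix.star_apply, Matrix.neg_apply] at this
    rw [← neg_eq_iff_eq_neg, ← this]
    rfl

/-! ### Volumes of the unit cubes of the Lie algebras -/

lemma unitCellU_eq (k : ℕ) : unitCellU k = skewMat k '' {v |
    fstBlock _ _ v ∈ {x | ∀ p, x p ∈ Icc 0 √2} ∧ sndBlock _ _ v ∈ {x | ∀ i, x i ∈ Icc 0 1}} := by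
  have h2 : (0 : ℝ) < √2 := by positivity
  have h2' : ((√2 : ℝ) : ℂ) ≠ 0 := by
    rw [Complex.ofReal_ne_zero]; positivity
  have key : ∀ (x : EuclideanSpace ℝ (Off k)) (y : EuclideanSpace ℝ (Fin k))
      (z : Fin k → Fin k → ℂ), (∀ i j (h : i < j), z i j = ((x ⟨(i, j), h.ne⟩ : ℂ) +
        x ⟨(j, i), h.ne'⟩ * Complex.I) / (√2 : ℝ)) →
      skewMat k (joinBlocks x y) = skewOfCoords y z := by
    intro x y z hz
    ext i j
    rw [skewMat_apply, fstBlock_joinBlocks, sndBlock_joinBlocks, Matrix.add_apply, skewOfCoords,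
      Matrix.of_apply]
    rcases lt_trichotomy i j with h | rfl | h
    · rw [if_neg h.ne, if_pos h, hz i j h, diagMat_apply, Matrix.diagonal_apply_ne _ h.ne,
        add_zero, offMat_apply, if_pos h, offCoord, dif_pos h.ne, offCoord, dif_pos h.ne']
    · rw [if_pos rfl, offMat_diag, diagMat_apply, Matrix.diagonal_apply_eq, zero_add]
    · rw [if_neg h.ne', if_neg h.not_gt, hz j i h, diagMat_apply,
        Matrix.diagonal_apply_ne _ h.ne', add_zero, offMat_apply, if_neg h.not_gt, offCoord,
        dif_pos h.ne, offCoord, dif_pos h.ne']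
      simp
      ring
  ext G
  constructor
  · rintro ⟨x, z, hx, hz, rfl⟩
    refine ⟨joinBlocks (WithLp.toLp 2 fun p => if p.1.1 < p.1.2 then √2 * (z p.1.1 p.1.2).re
      else √2 * (z p.1.2 p.1.1).im) (WithLp.toLp 2 x), ⟨fun p => ?_, fun i => hx i⟩, ?_⟩
    · rw [fstBlock_joinBlocks]
      simp only
      split
      · exact ⟨mul_nonneg h2.le (hz _ _).1.1, mul_le_of_le_one_right h2.le (hz _ _).1.2⟩
      · exact ⟨mul_nonneg h2.le (hz _ _).2.1, mul_le_of_le_one_right h2.le (hz _ _).2.2⟩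
    · refine key _ _ _ fun i j h => ?_
      simp only [h, if_true, h.not_gt, if_false]
      rw [eq_div_iff h2']
      conv_lhs => rw [← Complex.re_add_im (z i j)]
      push_cast
      ring
  · rintro ⟨v, ⟨hv, hv'⟩, rfl⟩
    -- Entries of `z` on or below the diagonal are irrelevant to the matrix but must also lie in the
    -- unit square; `offCoord` vanishes on the diagonal, so one formula serves everywhere.
    refine ⟨sndBlock _ _ v, fun i j => ⟨offCoord (fstBlock _ _ v) i j / √2,
      offCoord (fstBlock _ _ v) j i / √2⟩, hv', fun i j => ?_, ?_⟩
    · have : ∀ i j, offCoord (fstBlock _ _ v) i j ∈ Icc 0 √2 := fun i j => by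
        unfold offCoord
        split
        · exact hv _
        · exact ⟨le_rfl, h2.le⟩
      exact ⟨⟨div_nonneg (this _ _).1 h2.le, (div_le_one h2).mpr (this _ _).2⟩,
        ⟨div_nonneg (this _ _).1 h2.le, (div_le_one h2).mpr (this _ _).2⟩⟩
    · conv_lhs => rw [← joinBlocks_blocks v]
      refine key _ _ _ fun i j h => ?_
      rw [Complex.mk_eq_add_mul_I, offCoord, dif_pos h.ne, offCoord, dif_pos h.ne']
      push_cast
      ring

lemma volume_box {κ : Type*} [Fintype κ] (r : ℝ) :
    volume {x : EuclideanSpace ℝ κ | ∀ p, x p ∈ Icc 0 r} = ENNReal.ofReal r ^ Fintype.card κ := by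
  have h := (EuclideanSpace.volume_preserving_symm_measurableEquiv_toLp κ).measure_preimage_equiv
    (Set.pi univ fun _ => Icc 0 r)
  rw [volume_pi_pi] at h
  simp only [Real.volume_Icc, sub_zero, Finset.prod_const, Finset.card_univ] at h
  rw [← h]
  congr 1
  ext x
  simp [Pi.le_def, forall_and]

lemma card_off_sum (k : ℕ) : k ^ 2 = Fintype.card (Off k ⊕ Fin k) := by
  rw [Fintype.card_sum, Fintype.card_fin, card_off]

/-- An off-diagonal entry counts twice in the Hilbert–Schmidt norm, so its real and imaginary unit
intervals have length √2 each. This is the source of the power of two in `C`. -/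
lemma hsVol_unitCellU (k : ℕ) : hsVol (Fin k) (k ^ 2) (unitCellU k) = 2 ^ k.choose 2 := by
  rw [unitCellU_eq, hsVol_image_isometry (card_off_sum k) fun x y => by
    rw [← map_sub, norm_skewMat], volume_blocks, volume_box, volume_box, card_off_eq, pow_mul,
    ← ENNReal.ofReal_pow (by positivity)]
  simp

lemma hsVol_unitCellT (k : ℕ) : hsVol (Fin k) k (unitCellT k) = 1 := by
  have : unitCellT k = diagMat k '' {x | ∀ i, x i ∈ Icc 0 1} := by
    have key : ∀ x : Fin k → ℝ, skewOfCoords x 0 = diagMat k (WithLp.toLp 2 x) := fun x => by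
      ext i j
      rw [diagMat_apply, Matrix.diagonal_apply]
      simp [skewOfCoords]
    ext G
    constructor
    · rintro ⟨x, hx, rfl⟩
      exact ⟨WithLp.toLp 2 x, hx, (key x).symm⟩
    · rintro ⟨x, hx, rfl⟩
      exact ⟨x, hx, (key x).symm⟩
  rw [this, hsVol_image_isometry (by simp) fun x y => by rw [← map_sub, norm_diagMat],
    volume_box]
  simp

end LocDiag

namespace LocDiag

open scoped NNReal Topology
open Set Module

/-! ### Exponential coordinates on the unitary group -/

section

open scoped Matrix.Norms.Frobenius

lemma exp_mem_unitaryGroup {k : ℕ} {A : Matrix (Fin k) (Fin k) ℂ} (hA : star A = -A) :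
    NormedSpace.exp A ∈ Matrix.unitaryGroup (Fin k) ℂ :=
  NormedSpace.exp_mem_unitary_of_mem_skewAdjoint (skewAdjoint.mem_iff.mpr hA)

lemma hasStrictFDerivAt_exp_comp {k : ℕ} {E : Type*} [NormedAddCommGroup E] [NormedSpace ℝ E]
    [FiniteDimensional ℝ E] (L : E →ₗ[ℝ] Matrix (Fin k) (Fin k) ℂ) :
    HasStrictFDerivAt (fun x => NormedSpace.exp (L x)) (LinearMap.toContinuousLinearMap L) 0 := by
  have h0 : HasStrictFDerivAt (NormedSpace.exp : Matrix (Fin k) (Fin k) ℂ → _)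
      (1 : Matrix (Fin k) (Fin k) ℂ →L[ℝ] Matrix (Fin k) (Fin k) ℂ)
      (LinearMap.toContinuousLinearMap L 0) := by
    rw [map_zero]; exact hasStrictFDerivAt_exp_zero (𝕂 := ℝ)
  exact h0.comp 0 (LinearMap.toContinuousLinearMap L).hasStrictFDerivAt

end

/-- The unitary matrix `exp X`, `X` skew-Hermitian with zero diagonal. -/
noncomputable def uexp (k : ℕ) (x : EuclideanSpace ℝ (Off k)) : U k :=
  ⟨NormedSpace.exp (offMat k x), exp_mem_unitaryGroup (star_offMat x)⟩

/-- The diagonal unitary matrix with given angles. -/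
noncomputable def tor (k : ℕ) (x : EuclideanSpace ℝ (Fin k)) : U k :=
  ⟨NormedSpace.exp (diagMat k x), exp_mem_unitaryGroup (star_diagMat x)⟩

/-- Local coordinates on the unitary group near the identity. -/
noncomputable def chartU (k : ℕ) (v : EuclideanSpace ℝ (Off k ⊕ Fin k)) : U k :=
  uexp k (fstBlock _ _ v) * tor k (sndBlock _ _ v)

lemma uexp_zero (k : ℕ) : uexp k 0 = 1 := by
  apply Subtype.ext
  simp [uexp]

lemma tor_zero (k : ℕ) : tor k 0 = 1 := by
  apply Subtype.ext
  simp [tor]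

lemma chartU_zero (k : ℕ) : chartU k 0 = 1 := by
  rw [chartU, map_zero, map_zero, uexp_zero, tor_zero, one_mul]

lemma tor_coe {k : ℕ} (x : EuclideanSpace ℝ (Fin k)) :
    (tor k x).1 = Matrix.diagonal fun i => Complex.exp (Complex.I * x i) := by
  show NormedSpace.exp (diagMat k x) = _
  rw [diagMat_apply, Matrix.exp_diagonal, Pi.exp_def]
  simp [Complex.exp_eq_exp_ℂ]

lemma continuous_uexp (k : ℕ) : Continuous (uexp k) := by
  refine Continuous.subtype_mk ?_ _
  open scoped Matrix.Norms.Frobenius in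
  exact (NormedSpace.exp_continuous (𝔸 := Matrix (Fin k) (Fin k) ℂ)).comp
    (LinearMap.continuous_of_finiteDimensional (offMat k))

/-- The subgroup of diagonal unitary matrices. -/
def diagU (k : ℕ) : Subgroup (U k) where
  carrier := {u | u.1.IsDiag}
  one_mem' := Matrix.isDiag_one
  mul_mem' {a b} ha hb := by
    have ha' : a.1.IsDiag := ha
    have hb' : b.1.IsDiag := hb
    show (a.1 * b.1).IsDiag
    rw [← ha'.diagonal_diag, ← hb'.diagonal_diag, Matrix.diagonal_mul_diagonal]
    exact Matrix.isDiag_diagonal _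
  inv_mem' {a} ha := by
    have ha' : a.1.IsDiag := ha
    show (star a.1).IsDiag
    exact ha'.conjTranspose

lemma mem_diagU {k : ℕ} {u : U k} : u ∈ diagU k ↔ u.1.IsDiag := Iff.rfl

lemma tor_mem_diagU {k : ℕ} (x : EuclideanSpace ℝ (Fin k)) : tor k x ∈ diagU k := by
  rw [mem_diagU, tor_coe]
  exact Matrix.isDiag_diagonal _

/-- The angles of the diagonal entries. -/
noncomputable def angles {k : ℕ} (u : U k) : EuclideanSpace ℝ (Fin k) :=
  WithLp.toLp 2 fun i => (u.1 i i).arg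

lemma tor_angles {k : ℕ} {u : U k} (hu : u ∈ diagU k) : tor k (angles u) = u := by
  apply Subtype.ext
  rw [mem_diagU] at hu
  rw [tor_coe, ← hu.diagonal_diag]
  congr 1
  ext i
  have h1 : ‖u.1 i i‖ = 1 := by
    have := congrFun (congrFun (Matrix.mem_unitaryGroup_iff.mp u.2) i) i
    rw [← hu.diagonal_diag, Matrix.star_eq_conjTranspose, Matrix.diagonal_conjTranspose,
      Matrix.diagonal_mul_diagonal, Matrix.diagonal_apply_eq, Matrix.one_apply_eq] at this
    simp only [Matrix.diag_apply, Pi.star_apply, RCLike.star_def, Complex.mul_conj,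
      Complex.normSq_eq_norm_sq] at this
    have h2 : ‖u.1 i i‖ ^ 2 = 1 := by exact_mod_cast this
    exact (pow_eq_one_iff_of_nonneg (norm_nonneg _) two_ne_zero).mp h2
  have h2 := Complex.norm_mul_exp_arg_mul_I (u.1 i i)
  rw [h1, Complex.ofReal_one, one_mul, mul_comm] at h2
  exact h2

lemma angles_one (k : ℕ) : angles (1 : U k) = 0 := by
  ext i
  simp [angles]

lemma continuousAt_angles (k : ℕ) : ContinuousAt (angles : U k → _) 1 := by
  refine (PiLp.continuous_toLp 2 _).continuousAt.comp (continuousAt_pi.mpr fun i => ?_)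
  have h1 : ContinuousAt (fun u : U k => u.1 i i) 1 := by
    have : Continuous (fun u : U k => u.1 i i) :=
      (continuous_apply i).comp ((continuous_apply i).comp continuous_subtype_val)
    exact this.continuousAt
  refine ContinuousAt.comp (g := Complex.arg) ?_ h1
  apply Complex.continuousAt_arg
  simp

/-- Diagonal unitary matrices near the identity have small angles. -/
lemma eventually_exists_tor {k : ℕ} {N : Set (EuclideanSpace ℝ (Fin k))} (hN : N ∈ 𝓝 0) :
    ∀ᶠ u : U k in 𝓝 1, u ∈ diagU k → ∃ x ∈ N, tor k x = u := by
  have := (continuousAt_angles k).preimage_mem_nhds (by rwa [angles_one])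
  filter_upwards [this] with u hu hd using ⟨_, hu, tor_angles hd⟩

section

open scoped Matrix.Norms.Frobenius

lemma hasStrictFDerivAt_tor (k : ℕ) : HasStrictFDerivAt (fun x => (tor k x).1)
    (LinearMap.toContinuousLinearMap (diagMat k)) 0 :=
  hasStrictFDerivAt_exp_comp _

lemma hasStrictFDerivAt_uexp (k : ℕ) : HasStrictFDerivAt (fun x => (uexp k x).1)
    (LinearMap.toContinuousLinearMap (offMat k)) 0 :=
  hasStrictFDerivAt_exp_comp _

/-- The product rule at the identity gives the isometry `skewMat`. The chart is a product of two
exponentials, not the exponential of a sum, so that the torus factor can be split off on the right.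
-/
lemma hasStrictFDerivAt_chartU (k : ℕ) : HasStrictFDerivAt (fun v => (chartU k v).1)
    (LinearMap.toContinuousLinearMap (skewMat k)) 0 := by
  have h1 : HasStrictFDerivAt (fun v => (uexp k (fstBlock (Off k) (Fin k) v)).1) _ 0 :=
    HasStrictFDerivAt.comp (g := fun x => (uexp k x).1) 0
    (by rw [map_zero]; exact hasStrictFDerivAt_uexp k)
    (fstBlock (Off k) (Fin k)).hasStrictFDerivAt
  have h2 : HasStrictFDerivAt (fun v => (tor k (sndBlock (Off k) (Fin k) v)).1) _ 0 :=
    HasStrictFDerivAt.comp (g := fun x => (tor k x).1) 0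
    (by rw [map_zero]; exact hasStrictFDerivAt_tor k)
    (sndBlock (Off k) (Fin k)).hasStrictFDerivAt
  refine (h1.mul' h2).congr_fderiv ?_
  refine ContinuousLinearMap.ext fun v => ?_
  show (uexp k (fstBlock _ _ 0)).1 * diagMat k (sndBlock _ _ v) +
    offMat k (fstBlock _ _ v) * (tor k (sndBlock _ _ 0)).1 = skewMat k v
  rw [map_zero, map_zero, uexp_zero, tor_zero, OneMemClass.coe_one, one_mul,
    mul_one, skewMat_apply, add_comm]

/-- The exponential coordinates cover a neighbourhood of the identity. -/
lemma image_chartU_mem_nhds {k : ℕ} {N : Set (EuclideanSpace ℝ (Off k ⊕ Fin k))} (hN : N ∈ 𝓝 0) :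
    chartU k '' N ∈ 𝓝 1 := by
  let E := EuclideanSpace ℝ (Off k ⊕ Fin k)
  let S := LinearMap.toContinuousLinearMap (skewMat k)
  -- An extra factor `1 + H` with H Hermitian extends the chart to a map into all matrices. Its
  -- derivative is surjective, since every matrix is skew-Hermitian plus Hermitian, so images of
  -- neighbourhoods are neighbourhoods.
  let H : E →L[ℝ] Matrix (Fin k) (Fin k) ℂ := Complex.I • S
  let F : E × E → Matrix (Fin k) (Fin k) ℂ := fun p => (chartU k p.1).1 * (1 + H p.2)
  have hF : HasStrictFDerivAt F (S.comp (ContinuousLinearMap.fst ℝ E E) +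
      H.comp (ContinuousLinearMap.snd ℝ E E)) (0, 0) := by
    have h1 : HasStrictFDerivAt (fun p : E × E => (chartU k p.1).1) _ (0, 0) :=
      HasStrictFDerivAt.comp (g := fun v => (chartU k v).1) (0, 0) (hasStrictFDerivAt_chartU k)
      (ContinuousLinearMap.fst ℝ E E).hasStrictFDerivAt
    have h2 : HasStrictFDerivAt (fun p : E × E => 1 + H p.2) _ (0, 0) :=
      ((H.comp (ContinuousLinearMap.snd ℝ E E)).hasStrictFDerivAt (x := (0, 0))).const_add
        (1 : Matrix (Fin k) (Fin k) ℂ)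
    refine (h1.mul' h2).congr_fderiv ?_
    refine ContinuousLinearMap.ext fun v => ?_
    show (chartU k 0).1 * H v.2 + S v.1 * (1 + H 0) = S v.1 + H v.2
    rw [chartU_zero, map_zero, add_zero, mul_one, OneMemClass.coe_one, one_mul, add_comm]
  have hsurj : ((S.comp (ContinuousLinearMap.fst ℝ E E) +
      H.comp (ContinuousLinearMap.snd ℝ E E)) : E × E →L[ℝ] _).range = ⊤ := by
    rw [LinearMap.range_eq_top]
    intro M
    obtain ⟨v, hv⟩ := exists_skewMat_eq (A := (1 / 2 : ℂ) • (M - star M)) (by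
      rw [star_smul, star_sub, star_star, ← smul_neg, neg_sub]; simp)
    obtain ⟨w, hw⟩ := exists_skewMat_eq (A := (-Complex.I / 2 : ℂ) • (M + star M)) (by
      rw [star_smul, star_add, star_star, ← neg_smul, add_comm]; simp [neg_div])
    refine ⟨(v, w), ?_⟩
    show skewMat k v + Complex.I • skewMat k w = M
    rw [hv, hw, smul_smul]
    have : Complex.I * (-Complex.I / 2) = 1 / 2 := by
      rw [mul_div_assoc', mul_neg, Complex.I_mul_I, neg_neg]
    rw [this, ← smul_add, sub_add_add_cancel, ← two_smul ℂ, smul_smul]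
    norm_num
  have hmap := hF.map_nhds_eq_of_surj hsurj
  have hF0 : F (0, 0) = 1 := by simp [F, chartU_zero]
  have hmem : F '' (N ×ˢ Metric.ball 0 2) ∈ 𝓝 (1 : Matrix (Fin k) (Fin k) ℂ) := by
    have := Filter.image_mem_map (m := F)
      (prod_mem_nhds hN (Metric.ball_mem_nhds (0 : E) two_pos))
    rw [hmap, hF0] at this
    exact this
  have hpre : (Subtype.val : U k → _) ⁻¹' (F '' (N ×ˢ Metric.ball 0 2)) ∈ 𝓝 1 :=
    continuous_subtype_val.continuousAt.preimage_mem_nhds hmem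
  filter_upwards [hpre] with u hu
  obtain ⟨⟨v, w⟩, ⟨hv, hw⟩, huv⟩ := hu
  refine ⟨v, hv, Subtype.ext ?_⟩
  have hw2 : ‖H w‖ < 2 := by
    have h : ‖H w‖ = ‖w‖ := by
      show ‖Complex.I • skewMat k w‖ = _
      rw [norm_smul, Complex.norm_I, one_mul, norm_skewMat]
    rw [h]
    simpa using hw
  have hstar : star (H w) = H w := by
    show star (Complex.I • skewMat k w) = Complex.I • skewMat k w
    rw [star_smul, skewMat_apply, star_add, star_offMat, star_diagMat]
    simp [add_comm]
  have h1 : 1 + H w = ((chartU k v)⁻¹ * u).1 := by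
    rw [show ((chartU k v)⁻¹ * u).1 = star (chartU k v).1 * u.1 from rfl, ← huv]
    simp only [F]
    rw [← mul_assoc, Matrix.mem_unitaryGroup_iff'.mp (chartU k v).2, one_mul]
  -- At a unitary value the factor `1 + H w` is both unitary and Hermitian, hence an involution.
  -- Then `2 H w = -(H w)²`, and `‖H w‖ < 2` forces `H w = 0`; this explains the ball of radius 2.
  have h2 : (1 + H w) * (1 + H w) = 1 := by
    have h3 : star (1 + H w) * (1 + H w) = 1 := by
      rw [h1]
      exact Matrix.mem_unitaryGroup_iff'.mp ((chartU k v)⁻¹ * u).2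
    rwa [star_add, hstar, star_one] at h3
  have h3 : (2 : ℝ) • H w = -(H w * H w) := by
    rw [two_smul, eq_neg_iff_add_eq_zero]
    have : (1 + H w) * (1 + H w) = 1 + (H w + H w + H w * H w) := by noncomm_ring
    rwa [this, add_eq_left] at h2
  have h4 : 2 * ‖H w‖ ≤ ‖H w‖ * ‖H w‖ := by
    calc 2 * ‖H w‖ = ‖(2 : ℝ) • H w‖ := by rw [norm_smul]; simp
      _ = ‖H w * H w‖ := by rw [h3, norm_neg]
      _ ≤ _ := norm_mul_le _ _
  have h5 : H w = 0 := by
    rw [← norm_le_zero_iff]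
    nlinarith [norm_nonneg (H w)]
  rw [← huv]
  simp [F, h5]

end

end LocDiag

namespace LocDiag

open scoped NNReal Topology
open Set Module

/-! ### Decomposition into small pieces -/

section Partition

variable {X : Type*} [TopologicalSpace X] [SecondCountableTopology X] [MeasurableSpace X]
  [OpensMeasurableSpace X]

/-- Second countability gives a countable subcover of `s` by good neighbourhoods. Making it disjoint
keeps each piece inside one of them. -/
lemma exists_partition_of_local {s : Set X} (hs : MeasurableSet s) {Q : Set X → Prop} (h0 : Q ∅)
    (hQ : ∀ x ∈ s, ∃ N ∈ 𝓝 x, ∀ B ⊆ N ∩ s, MeasurableSet B → Q B) :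
    ∃ P : ℕ → Set X, (∀ i, MeasurableSet (P i)) ∧ Pairwise (Function.onFun Disjoint P) ∧
      ⋃ i, P i = s ∧ ∀ i, Q (P i) := by
  choose! N hN hNQ using hQ
  obtain ⟨t, hts, htc, hst⟩ := TopologicalSpace.countable_cover_nhdsWithin
    (f := fun x => interior (N x)) (s := s)
    fun x hx => mem_nhdsWithin_of_mem_nhds (interior_mem_nhds.mpr (hN x hx))
  rcases t.eq_empty_or_nonempty with rfl | hne
  · have : s = ∅ := by simpa using hst
    subst this
    exact ⟨fun _ => ∅, fun _ => MeasurableSet.empty, fun _ _ _ => disjoint_bot_left, by simp,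
      fun _ => h0⟩
  obtain ⟨c, rfl⟩ := htc.exists_eq_range hne
  have hm : ∀ i, MeasurableSet (interior (N (c i)) ∩ s) := fun i =>
    isOpen_interior.measurableSet.inter hs
  refine ⟨disjointed fun i => interior (N (c i)) ∩ s, fun i => MeasurableSet.disjointed hm i,
    disjoint_disjointed _, ?_, fun i => ?_⟩
  · rw [iUnion_disjointed, ← iUnion_inter, inter_eq_right]
    simpa using hst
  · refine hNQ (c i) (hts ⟨i, rfl⟩) _ ?_ (MeasurableSet.disjointed hm i)
    exact (disjointed_subset _ i).trans (inter_subset_inter_left _ interior_subset)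

lemma Near.of_local {μ ν : Measure X} {s : Set X} (hs : MeasurableSet s) {K : ℝ≥0}
    (h : ∀ x ∈ s, ∃ N ∈ 𝓝 x, ∀ B ⊆ N ∩ s, MeasurableSet B → Near K (μ B) (ν B)) {B : Set X}
    (hB : MeasurableSet B) (hBs : B ⊆ s) : Near K (μ B) (ν B) := by
  obtain ⟨P, hPm, hPd, hPs, hPQ⟩ := exists_partition_of_local hs
    (Q := fun P => ∀ B ⊆ P, MeasurableSet B → Near K (μ B) (ν B))
    (fun B hB _ => by rw [subset_empty_iff.mp hB]; simp [Near])
    (fun x hx => by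
      obtain ⟨N, hN, hNB⟩ := h x hx
      exact ⟨N, hN, fun B hB _ B' hB' hm => hNB B' (hB'.trans hB) hm⟩)
  have hBP : B = ⋃ i, B ∩ P i := by rw [← inter_iUnion, hPs, inter_eq_left.mpr hBs]
  have hd : Pairwise (Function.onFun Disjoint fun i => B ∩ P i) := fun i j hij =>
    (hPd hij).mono inter_subset_right inter_subset_right
  rw [hBP, measure_iUnion hd fun i => hB.inter (hPm i), measure_iUnion hd fun i => hB.inter (hPm i)]
  exact Near.tsum fun i => hPQ i _ inter_subset_right (hB.inter (hPm i))

end Partition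

/-! ### Hilbert–Schmidt volumes on the unitary group -/

/-- The `d`-dimensional Hilbert–Schmidt volume on the unitary group. -/
noncomputable def uVol (k d : ℕ) : Measure (U k) := (hsVol (Fin k) d).comap Subtype.val

lemma measurableEmbedding_coe (k : ℕ) :
    MeasurableEmbedding (Subtype.val : U k → Matrix (Fin k) (Fin k) ℂ) := by
  have hc : IsClosed ((Matrix.unitaryGroup (Fin k) ℂ : Submonoid _) :
      Set (Matrix (Fin k) (Fin k) ℂ)) := isClosed_unitary
  exact @Topology.IsClosedEmbedding.measurableEmbedding (U k) _ _ _ _ _ _ _ _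
    hc.isClosedEmbedding_subtypeVal

lemma uVol_apply {k d : ℕ} (S : Set (U k)) : uVol k d S = hsVol (Fin k) d (Subtype.val '' S) :=
  (measurableEmbedding_coe k).comap_apply _ _

lemma continuous_mul_mul {k : ℕ} (u v : U k) : Continuous fun w : U k => u * w * v :=
  (continuous_const.mul continuous_id).mul continuous_const

lemma uVol_mul {k d : ℕ} (u v : U k) (S : Set (U k)) :
    uVol k d ((fun w => u * w * v) '' S) = uVol k d S := by
  rw [uVol_apply, uVol_apply, ← hsVol_unitary_mul u.2 v.2 d (Subtype.val '' S), ← image_comp,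
    ← image_comp]
  rfl

lemma uVol_preimage {k d : ℕ} (u v : U k) (S : Set (U k)) :
    uVol k d ((fun w => u * w * v) ⁻¹' S) = uVol k d S := by
  rw [← uVol_mul u v]
  congr 1
  refine image_preimage_eq _ fun w => ⟨u⁻¹ * w * v⁻¹, ?_⟩
  group

instance instIsMulLeftInvariantUVol (k d : ℕ) : (uVol k d).IsMulLeftInvariant := by
  refine ⟨fun g => Measure.ext fun S hS => ?_⟩
  rw [Measure.map_apply (measurable_const_mul g) hS]
  simpa using uVol_preimage (d := d) g 1 S

instance instIsMulRightInvariantUVol (k d : ℕ) : (uVol k d).IsMulRightInvariant := by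
  refine ⟨fun g => Measure.ext fun S hS => ?_⟩
  rw [Measure.map_apply (measurable_mul_const g) hS]
  simpa using uVol_preimage (d := d) 1 g S

lemma isClosed_diagU (k : ℕ) : IsClosed (diagU k : Set (U k)) := by
  have : (diagU k : Set (U k)) = ⋂ (i) (j) (_ : i ≠ j), {u : U k | u.1 i j = 0} := by
    ext u
    simp only [SetLike.mem_coe, mem_diagU, mem_iInter, mem_ofPred_eq]
    rfl
  rw [this]
  refine isClosed_iInter fun i => isClosed_iInter fun j => isClosed_iInter fun _ => ?_
  refine isClosed_eq ?_ continuous_const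
  exact (continuous_apply j).comp ((continuous_apply i).comp continuous_subtype_val)

lemma coe_image_univ (k : ℕ) : (Subtype.val : U k → _) '' univ = unitarySet k := by
  simp [unitarySet]

lemma coe_image_diagU (k : ℕ) : (Subtype.val : U k → _) '' diagU k = torusSet k := by
  ext M
  constructor
  · rintro ⟨u, hu, rfl⟩
    exact ⟨u.2, hu⟩
  · rintro ⟨h1, h2⟩
    exact ⟨⟨M, h1⟩, h2, rfl⟩

section

open scoped Matrix.Norms.Frobenius

/-- The derivative of the chart at 0 is isometric, so all weights in the area formula are 1. -/
lemma exists_chartU_near {k : ℕ} {K : ℝ≥0} (hK : 1 < K) :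
    ∃ N ∈ 𝓝 (0 : EuclideanSpace ℝ (Off k ⊕ Fin k)), InjOn (chartU k) N ∧ ∀ S ⊆ N,
      Near K (uVol k (k ^ 2) (chartU k '' S)) (volume S) := by
  obtain ⟨N, hN, hi, h⟩ := exists_hsVol_image_near (hasStrictFDerivAt_chartU k) (card_off_sum k)
    (s := fun _ => 1) (fun _ => one_pos) (fun v => by
      rw [LinearMap.coe_toContinuousLinearMap', norm_skewMat, EuclideanSpace.norm_sq_eq]; simp) hK
  refine ⟨N, hN, fun x hx y hy hxy => hi hx hy (congrArg _ hxy), fun S hS => ?_⟩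
  rw [uVol_apply, ← image_comp]
  simpa using h S hS

lemma exists_tor_near {k : ℕ} {K : ℝ≥0} (hK : 1 < K) :
    ∃ N ∈ 𝓝 (0 : EuclideanSpace ℝ (Fin k)), ∀ S ⊆ N,
      Near K (uVol k k (tor k '' S)) (volume S) := by
  obtain ⟨N, hN, hi, h⟩ := exists_hsVol_image_near (hasStrictFDerivAt_tor k)
    (Fintype.card_fin k).symm (s := fun _ => 1) (fun _ => one_pos) (fun v => by
      rw [LinearMap.coe_toContinuousLinearMap', norm_diagMat, EuclideanSpace.norm_sq_eq]; simp) hK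
  refine ⟨N, hN, fun S hS => ?_⟩
  rw [uVol_apply, ← image_comp]
  simpa using h S hS

end

lemma exists_ball_of_near {κ : Type*} [Fintype κ] {N : Set (EuclideanSpace ℝ κ)} (hN : N ∈ 𝓝 0) :
    ∃ r > 0, Metric.closedBall 0 r ⊆ N ∧ volume (Metric.closedBall (0 : EuclideanSpace ℝ κ) r) ≠ 0 ∧
      volume (Metric.closedBall (0 : EuclideanSpace ℝ κ) r) ≠ ∞ := by
  obtain ⟨r, hr, h⟩ := Metric.nhds_basis_closedBall.mem_iff.mp hN
  exact ⟨r, hr, h, (Metric.measure_closedBall_pos _ _ hr).ne', measure_closedBall_lt_top.ne⟩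

lemma uVol_univ_ne_zero (k : ℕ) : uVol k (k ^ 2) univ ≠ 0 := by
  obtain ⟨N, hN, -, h⟩ := exists_chartU_near (k := k) one_lt_two
  obtain ⟨r, hr, hrN, h0, -⟩ := exists_ball_of_near hN
  intro hu
  have := (h _ hrN).2
  rw [measure_mono_null (subset_univ _) hu, mul_zero, nonpos_iff_eq_zero] at this
  exact h0 this

/-- The chart bounds the volume of a neighbourhood of the identity; invariance moves it to every
point, and compactness concludes. -/
instance instIsFiniteMeasureUVol (k : ℕ) : IsFiniteMeasure (uVol k (k ^ 2)) := by
  refine ⟨isCompact_univ.measure_lt_top_of_nhdsWithin fun u _ => ?_⟩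
  rw [nhdsWithin_univ]
  obtain ⟨N, hN, -, h⟩ := exists_chartU_near (k := k) one_lt_two
  obtain ⟨r, hr, hrN, -, h1⟩ := exists_ball_of_near hN
  have hn := image_chartU_mem_nhds (Metric.closedBall_mem_nhds
    (0 : EuclideanSpace ℝ (Off k ⊕ Fin k)) hr)
  refine ⟨(fun w => u⁻¹ * w * 1) ⁻¹' (chartU k '' Metric.closedBall 0 r), ?_, ?_⟩
  · have hc := continuous_mul_mul u⁻¹ 1
    refine hc.continuousAt.preimage_mem_nhds ?_
    simpa using hn
  · rw [uVol_preimage]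
    exact (h _ hrN).1.trans_lt (ENNReal.mul_lt_top ENNReal.coe_lt_top h1.lt_top)

lemma uVol_diagU_ne_zero (k : ℕ) : uVol k k (diagU k) ≠ 0 := by
  obtain ⟨N, hN, h⟩ := exists_tor_near (k := k) one_lt_two
  obtain ⟨r, hr, hrN, h0, -⟩ := exists_ball_of_near hN
  intro hu
  have := (h _ hrN).2
  rw [measure_mono_null _ hu, mul_zero, nonpos_iff_eq_zero] at this
  · exact h0 this
  · rintro _ ⟨x, -, rfl⟩
    exact tor_mem_diagU x

lemma uVol_diagU_ne_top (k : ℕ) : uVol k k (diagU k) ≠ ∞ := by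
  refine ((isClosed_diagU k).isCompact.measure_lt_top_of_nhdsWithin fun u hu => ?_).ne
  obtain ⟨N, hN, h⟩ := exists_tor_near (k := k) one_lt_two
  obtain ⟨r, hr, hrN, -, h1⟩ := exists_ball_of_near hN
  have hn := eventually_exists_tor (Metric.closedBall_mem_nhds (0 : EuclideanSpace ℝ (Fin k)) hr)
  refine ⟨(fun w => u⁻¹ * w * 1) ⁻¹' (tor k '' Metric.closedBall 0 r), ?_, ?_⟩
  · have hc := continuous_mul_mul u⁻¹ 1
    have h2 : ∀ᶠ w in 𝓝 u, u⁻¹ * w * 1 ∈ diagU k →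
        ∃ x ∈ Metric.closedBall 0 r, tor k x = u⁻¹ * w * 1 :=
      hc.continuousAt.eventually
        (p := fun w => w ∈ diagU k → ∃ x ∈ Metric.closedBall 0 r, tor k x = w) (by simpa using hn)
    filter_upwards [mem_nhdsWithin_of_mem_nhds h2, self_mem_nhdsWithin] with w hw hwd
    exact hw (mul_mem (mul_mem (inv_mem hu) hwd) (one_mem _))
  · rw [uVol_preimage]
    exact (h _ hrN).1.trans_lt (ENNReal.mul_lt_top ENNReal.coe_lt_top h1.lt_top)

lemma uVol_eq_smul_haarU (k : ℕ) : uVol k (k ^ 2) = uVol k (k ^ 2) univ • haarU k :=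
  Measure.haarMeasure_unique _ ⊤

instance instIsProbabilityMeasureHaarU (k : ℕ) : IsProbabilityMeasure (haarU k) :=
  ⟨Measure.haarMeasure_self (K₀ := (⊤ : TopologicalSpace.PositiveCompacts (U k)))⟩

/-- Haar measure is a normalization of the Hilbert–Schmidt volume, which is invariant on both sides.
-/
instance instIsMulRightInvariantHaarU (k : ℕ) : (haarU k).IsMulRightInvariant := by
  have h : haarU k = (uVol k (k ^ 2) univ)⁻¹ • uVol k (k ^ 2) := by
    have h0 := uVol_univ_ne_zero k
    have h1 := measure_ne_top (uVol k (k ^ 2)) univ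
    have h2 := uVol_eq_smul_haarU k
    generalize uVol k (k ^ 2) univ = c at h0 h1 h2
    rw [h2, smul_smul, ENNReal.inv_mul_cancel h0 h1, one_smul]
  rw [h]
  infer_instance

/-! ### Volume of tubes around the torus -/

/-- The products of `exp X`, `X` in a set of off-diagonal matrices, with elements of `T`. -/
def cellU {k : ℕ} (W : Set (EuclideanSpace ℝ (Off k))) (T : Set (U k)) : Set (U k) :=
  (fun p : EuclideanSpace ℝ (Off k) × U k => uexp k p.1 * p.2) '' W ×ˢ T

lemma mem_cellU {k : ℕ} {W : Set (EuclideanSpace ℝ (Off k))} {T : Set (U k)} {u : U k} :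
    u ∈ cellU W T ↔ ∃ x ∈ W, ∃ t ∈ T, uexp k x * t = u := by
  constructor
  · rintro ⟨⟨x, t⟩, ⟨hx, ht⟩, rfl⟩
    exact ⟨x, hx, t, ht, rfl⟩
  · rintro ⟨x, hx, t, ht, rfl⟩
    exact ⟨(x, t), ⟨hx, ht⟩, rfl⟩

lemma continuous_cell_map (k : ℕ) :
    Continuous fun p : EuclideanSpace ℝ (Off k) × U k => uexp k p.1 * p.2 :=
  ((continuous_uexp k).comp continuous_fst).mul continuous_snd

lemma isCompact_cellU {k : ℕ} (r : ℝ) :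
    IsCompact (cellU (Metric.closedBall 0 r) (diagU k : Set (U k))) :=
  ((isCompact_closedBall _ _).prod (isClosed_diagU k).isCompact).image (continuous_cell_map k)

/-- The cells of small balls are neighbourhoods of the identity. -/
lemma cellU_mem_nhds {k : ℕ} {r : ℝ} (hr : 0 < r) :
    cellU (Metric.closedBall 0 r) (diagU k : Set (U k)) ∈ 𝓝 1 := by
  have h : fstBlock (Off k) (Fin k) ⁻¹' Metric.closedBall 0 r ∈ 𝓝 0 :=
    (fstBlock (Off k) (Fin k)).continuous.continuousAt.preimage_mem_nhds
      (by rw [map_zero]; exact Metric.closedBall_mem_nhds _ hr)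
  filter_upwards [image_chartU_mem_nhds h] with u hu
  obtain ⟨v, hv, rfl⟩ := hu
  exact mem_cellU.mpr ⟨_, hv, _, tor_mem_diagU _, rfl⟩

/-- For small balls the map (x, t) ↦ `exp X · t` is injective on ball × torus. Cut the torus into
small pieces: over each piece the cell is a translate of a chart image of ball × S and the piece
itself a translate of `tor '' S`, both with volumes given by the Euclidean ones up to L. Summing
over the pieces yields ball volume times torus volume. -/
lemma exists_cellU_near {k : ℕ} {K : ℝ≥0} (hK : 1 < K) :
    ∃ r₀ > 0, ∀ r ≤ r₀, Near K
      (uVol k (k ^ 2) (cellU (Metric.closedBall 0 r) (diagU k : Set (U k))))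
      (volume (Metric.closedBall (0 : EuclideanSpace ℝ (Off k)) r) * uVol k k (diagU k)) := by
  obtain ⟨L, hL, hLK⟩ := exists_one_lt_pow_le hK 2
  rw [pow_two] at hLK
  obtain ⟨N₁, hN₁, hinj, h₁⟩ := exists_chartU_near (k := k) hL
  obtain ⟨N₂, hN₂, h₂⟩ := exists_tor_near (k := k) hL
  obtain ⟨ε, hε, hεN⟩ := Metric.nhds_basis_ball.mem_iff.mp hN₁
  have hjoin : ∀ (x : EuclideanSpace ℝ (Off k)) (y : EuclideanSpace ℝ (Fin k)),
      ‖x‖ < ε / 2 → ‖y‖ < ε / 2 → joinBlocks x y ∈ N₁ := fun x y hx hy => hεN (by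
    rw [mem_ball_zero_iff, ← abs_of_nonneg (norm_nonneg _), ← abs_of_pos hε, ← sq_lt_sq,
      norm_sq_blocks, fstBlock_joinBlocks, sndBlock_joinBlocks]
    nlinarith [norm_nonneg x, norm_nonneg y])
  set M := N₂ ∩ Metric.ball 0 (ε / 2) with hM
  have hMn : M ∈ 𝓝 0 := Filter.inter_mem hN₂ (Metric.ball_mem_nhds _ (by positivity))
  have hO := eventually_exists_tor hMn
  have hcont : Continuous fun p : EuclideanSpace ℝ (Off k) × EuclideanSpace ℝ (Off k) =>
      (uexp k p.1)⁻¹ * uexp k p.2 :=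
    ((continuous_uexp k).comp continuous_fst).inv.mul ((continuous_uexp k).comp continuous_snd)
  -- For small x and x', a quotient `(uexp x)⁻¹ * uexp x'` that happens to be diagonal has small
  -- angles, hence is seen by the chart.
  have hev := hcont.continuousAt (x := (0, 0)) |>.eventually
    (by simpa [uexp_zero] using hO)
  rw [nhds_prod_eq] at hev
  obtain ⟨V, hV, hVp⟩ := Filter.mem_prod_self_iff.mp hev
  obtain ⟨r₁, hr₁, hr₁V⟩ := Metric.nhds_basis_closedBall.mem_iff.mp hV
  refine ⟨min r₁ (ε / 4), by positivity, fun r hr => ?_⟩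
  set W := Metric.closedBall (0 : EuclideanSpace ℝ (Off k)) r with hW
  have hWV : W ⊆ V := (Metric.closedBall_subset_closedBall (hr.trans (min_le_left _ _))).trans hr₁V
  have hWε : ∀ x ∈ W, ‖x‖ < ε / 2 := fun x hx => by
    have := hr.trans (min_le_right _ _)
    rw [hW, mem_closedBall_zero_iff] at hx
    linarith
  -- Two representations differ by a torus element close to 1, equal to `tor y` with y small.
  -- Injectivity of the chart then identifies the off-diagonal coordinates.
  have hinj' : InjOn (fun p : EuclideanSpace ℝ (Off k) × U k => uexp k p.1 * p.2)
      (W ×ˢ (diagU k : Set (U k))) := by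
    rintro ⟨x, t⟩ ⟨hx, ht⟩ ⟨x', t'⟩ ⟨hx', ht'⟩ hxt
    simp only at hx hx' ht ht' hxt
    have h1 : (uexp k x')⁻¹ * uexp k x = t' * t⁻¹ := by
      rw [inv_mul_eq_iff_eq_mul, ← mul_assoc, ← hxt, mul_inv_cancel_right]
    obtain ⟨y, hy, hyt⟩ := hVp (mk_mem_prod (hWV hx') (hWV hx))
      (show (uexp k x')⁻¹ * uexp k x ∈ diagU k by rw [h1]; exact mul_mem ht' (inv_mem ht))
    have h2 : chartU k (joinBlocks x 0) = chartU k (joinBlocks x' y) := by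
      simp only [chartU, fstBlock_joinBlocks, sndBlock_joinBlocks, tor_zero, hyt]
      group
    have h3 := hinj (hjoin x 0 (hWε x hx) (by simpa using by positivity))
      (hjoin x' y (hWε x' hx') (by simpa using hy.2)) h2
    have h4 : x = x' := by simpa using congrArg (fstBlock _ _) h3
    subst h4
    have h5 : t = t' := by simpa using hxt
    rw [h5]
  obtain ⟨P, hPm, hPd, hPs, hPQ⟩ := exists_partition_of_local (isClosed_diagU k).measurableSet
    (Q := fun P => Near K (uVol k (k ^ 2) (cellU W P)) (volume W * uVol k k P))
    (by simp [Near, cellU]) (fun t₀ ht₀ => by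
      refine ⟨(fun w => w * t₀⁻¹) ⁻¹' {u | u ∈ diagU k → ∃ x ∈ M, tor k x = u}, ?_,
        fun B hB _ => ?_⟩
      · have hc : Continuous fun w : U k => w * t₀⁻¹ := continuous_id.mul continuous_const
        exact hc.continuousAt.preimage_mem_nhds (by rw [mul_inv_cancel]; exact hO)
      · set S := {y | y ∈ M ∧ tor k y * t₀ ∈ B} with hS
        have hB1 : B = (fun w => 1 * w * t₀) '' (tor k '' S) := by
          ext t
          constructor
          · intro ht
            obtain ⟨y, hy, hyt⟩ := (hB ht).1 (mul_mem (hB ht).2 (inv_mem ht₀))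
            have : tor k y * t₀ = t := by rw [hyt]; group
            exact ⟨_, ⟨y, ⟨hy, by rwa [this]⟩, rfl⟩, by simpa using this⟩
          · rintro ⟨_, ⟨y, hy, rfl⟩, rfl⟩
            simpa using hy.2
        have hB2 : cellU W B = (fun w => 1 * w * t₀) '' (chartU k ''
            {v | fstBlock _ _ v ∈ W ∧ sndBlock _ _ v ∈ S}) := by
          ext u
          rw [mem_cellU]
          constructor
          · rintro ⟨x, hx, t, ht, rfl⟩
            rw [hB1] at ht
            obtain ⟨_, ⟨y, hy, rfl⟩, rfl⟩ := ht
            exact ⟨_, ⟨joinBlocks x y, ⟨hx, hy⟩, rfl⟩, by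
              simp only [chartU, fstBlock_joinBlocks, sndBlock_joinBlocks]; group⟩
          · rintro ⟨_, ⟨v, ⟨hv1, hv2⟩, rfl⟩, rfl⟩
            exact ⟨_, hv1, _, hv2.2, by simp only [chartU]; group⟩
        have n1 : Near L (uVol k (k ^ 2) (cellU W B)) (volume W * volume S) := by
          rw [hB2, uVol_mul, ← volume_blocks]
          refine h₁ _ fun v hv => ?_
          rw [← joinBlocks_blocks v]
          exact hjoin _ _ (hWε _ hv.1) (by simpa using hv.2.1.2)
        have n2 : Near L (volume W * uVol k k B) (volume W * volume S) := by
          rw [hB1, uVol_mul]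
          exact (h₂ S fun y hy => hy.1.1).mul_left _
        exact (n1.trans n2.symm).mono hLK)
  have hcell : cellU W (diagU k : Set (U k)) = ⋃ i, cellU W (P i) := by
    rw [← hPs, cellU, prod_iUnion, image_iUnion]
    rfl
  have hsub : ∀ i, W ×ˢ P i ⊆ W ×ˢ (diagU k : Set (U k)) := fun i =>
    prod_mono_right (by rw [← hPs]; exact subset_iUnion P i)
  -- An injective continuous image of a Borel set is Borel; disjointness of the cells comes from the
  -- same injectivity.
  have hcm : ∀ i, MeasurableSet (cellU W (P i)) := fun i =>
    (Metric.isClosed_closedBall.measurableSet.prod (hPm i)).image_of_continuousOn_injOn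
      (continuous_cell_map k).continuousOn (hinj'.mono (hsub i))
  have hcd : Pairwise (Function.onFun Disjoint fun i => cellU W (P i)) := fun i j hij => by
    rw [Function.onFun, Set.disjoint_left]
    rintro _ ⟨p, hp, rfl⟩ ⟨q, hq, hpq⟩
    have := hinj' (hsub j hq) (hsub i hp) hpq
    subst this
    exact Set.disjoint_left.mp (hPd hij) hp.2 hq.2
  rw [hcell, measure_iUnion hcd hcm, ← hPs, measure_iUnion hPd hPm, ← ENNReal.tsum_mul_left]
  exact Near.tsum hPQ

end LocDiag

namespace LocDiag

open scoped NNReal Topology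
open Set Module

/-! ### Local diagonalizations -/

variable {m n : ℕ}

lemma kronecker_mem_unitaryGroup (u : U m) (v : U n) :
    u.1 ⊗ₖ v.1 ∈ Matrix.unitaryGroup (Fin m × Fin n) ℂ :=
  Matrix.kronecker_mem_unitary u.2 v.2

/-- Conjugation by a local unitary. -/
def conjBy (u : U m) (v : U n) (ρ : BiMat m n) : BiMat m n :=
  (u.1 ⊗ₖ v.1) * ρ * (u.1 ⊗ₖ v.1).conjTranspose

lemma conjBy_localConj (u u' : U m) (v v' : U n) (lam : Table m n) :
    conjBy u v (localConj u' v' lam) = localConj (u * u') (v * v') lam := by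
  simp only [conjBy, localConj, Submonoid.coe_mul, Matrix.mul_kronecker_mul,
    Matrix.conjTranspose_mul, Matrix.mul_assoc]

lemma localConj_apply (u : U m) (v : U n) (lam : Table m n) (p q : Fin m × Fin n) :
    localConj u v lam p q = ∑ r, u.1 p.1 r.1 * v.1 p.2 r.2 * lam r *
      conj (u.1 q.1 r.1 * v.1 q.2 r.2) := by
  rw [localConj, Matrix.mul_apply]
  simp only [Matrix.mul_diagonal, Matrix.kroneckerMap_apply, Matrix.conjTranspose_apply]
  rfl

lemma continuous_entry {k : ℕ} (i j : Fin k) : Continuous fun u : U k => u.1 i j :=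
  (continuous_apply j).comp ((continuous_apply i).comp continuous_subtype_val)

lemma continuous_localConj :
    Continuous fun x : U m × U n × Table m n => localConj x.1 x.2.1 x.2.2 := by
  refine continuous_matrix fun p q => ?_
  simp only [localConj_apply]
  have hu : ∀ i j, Continuous fun x : U m × U n × Table m n => x.1.1 i j := fun i j =>
    (continuous_entry i j).comp (Y := U m) continuous_fst
  have hv : ∀ i j, Continuous fun x : U m × U n × Table m n => x.2.1.1 i j := fun i j =>
    (continuous_entry i j).comp (Y := U n)
      ((continuous_fst (X := U n)).comp (continuous_snd (X := U m)))
  have hl : ∀ r, Continuous fun x : U m × U n × Table m n => ((x.2.2 r : ℝ) : ℂ) := fun r =>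
    Complex.continuous_ofReal.comp ((continuous_apply r).comp
      ((PiLp.continuous_ofLp 2 _).comp
        ((continuous_snd (X := U n)).comp (continuous_snd (X := U m)))))
  exact continuous_finsetSum _ fun r _ => ((((hu _ _).mul (hv _ _)).mul (hl _)).mul
    (Complex.continuous_conj.comp ((hu _ _).mul (hv _ _))))

lemma continuous_conjBy (u : U m) (v : U n) : Continuous (conjBy u v) :=
  (continuous_const.matrix_mul continuous_id).matrix_mul continuous_const

lemma localConj_one (lam : Table m n) :
    localConj (1 : U m) (1 : U n) lam = Matrix.diagonal fun p => (lam p : ℂ) := by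
  simp [localConj]

lemma localConj_eq_conjBy (u : U m) (v : U n) (lam : Table m n) :
    localConj u v lam = conjBy u v (Matrix.diagonal fun p => (lam p : ℂ)) := rfl

lemma localConj_mem_states_iff (u : U m) (v : U n) (lam : Table m n) :
    localConj u v lam ∈ states m n ↔ lam ∈ simplex m n := by
  have hA := kronecker_mem_unitaryGroup u v
  have h1 : (localConj u v lam).PosSemidef ↔ ∀ p, 0 ≤ lam p := by
    have h2 : (u.1 ⊗ₖ v.1).conjTranspose * localConj u v lam * (u.1 ⊗ₖ v.1) =
        Matrix.diagonal fun p => (lam p : ℂ) := by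
      rw [localConj, ← Matrix.star_eq_conjTranspose, Matrix.mul_assoc, Matrix.mul_assoc,
        Matrix.mul_assoc, Matrix.mem_unitaryGroup_iff'.mp hA, ← Matrix.mul_assoc, Matrix.mul_one,
        Matrix.mem_unitaryGroup_iff'.mp hA, Matrix.one_mul]
    constructor
    · intro h
      have := h.conjTranspose_mul_mul_same (u.1 ⊗ₖ v.1)
      rw [h2, Matrix.posSemidef_diagonal_iff] at this
      exact fun p => by simpa using this p
    · intro h
      refine Matrix.PosSemidef.mul_mul_conjTranspose_same ?_ _
      exact Matrix.posSemidef_diagonal_iff.mpr fun p => by simpa using h p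
  have h3 : (localConj u v lam).trace = ((∑ p, lam p : ℝ) : ℂ) := by
    rw [localConj, Matrix.trace_mul_comm, ← Matrix.mul_assoc, ← Matrix.star_eq_conjTranspose,
      Matrix.mem_unitaryGroup_iff'.mp hA, Matrix.one_mul, Matrix.trace_diagonal]
    push_cast
    rfl
  show (localConj u v lam).PosSemidef ∧ (localConj u v lam).trace = 1 ↔ _
  rw [h1, h3]
  exact and_congr_right fun _ => by norm_cast

lemma conjBy_mem_DLU {ρ : BiMat m n} (hρ : ρ ∈ DLU m n) (u : U m) (v : U n) :
    conjBy u v ρ ∈ DLU m n := by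
  obtain ⟨hs, lam, u', v', rfl⟩ := hρ
  rw [conjBy_localConj, DLU]
  refine ⟨?_, lam, _, _, rfl⟩
  rw [localConj_mem_states_iff] at hs ⊢
  exact hs

lemma DLU_eq_image : DLU m n =
    (fun x : U m × U n × Table m n => localConj x.1 x.2.1 x.2.2) '' univ ×ˢ univ ×ˢ simplex m n := by
  ext ρ
  constructor
  · rintro ⟨hs, lam, u, v, rfl⟩
    exact ⟨(u, v, lam), ⟨trivial, trivial, (localConj_mem_states_iff u v lam).mp hs⟩, rfl⟩
  · rintro ⟨⟨u, v, lam⟩, ⟨-, -, h⟩, rfl⟩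
    exact ⟨(localConj_mem_states_iff u v lam).mpr h, lam, u, v, rfl⟩

/-! ### Relabelling of tables -/

/-- Pairs of permutations of the rows and of the columns of a table. -/
abbrev Relabelling (m n : ℕ) : Type := Equiv.Perm (Fin m) × Equiv.Perm (Fin n)

/-- The table with permuted rows and columns. -/
noncomputable def relabel (g : Relabelling m n) : Table m n ≃ₗᵢ[ℝ] Table m n :=
  LinearIsometryEquiv.piLpCongrLeft 2 ℝ ℝ (g.1.prodCongr g.2).symm

@[simp] lemma relabel_apply (g : Relabelling m n) (lam : Table m n) (p : Fin m × Fin n) :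
    relabel g lam p = lam (g.1 p.1, g.2 p.2) := rfl

/-- Relabelling is precomposition, hence a right action: the order of the product is reversed. -/
lemma relabel_relabel (g h : Relabelling m n) (lam : Table m n) :
    relabel g (relabel h lam) = relabel (h * g) lam := by
  ext p
  rfl

lemma relabel_one (lam : Table m n) : relabel 1 lam = lam := by
  ext p
  rfl

/-- The permutation matrix of `σ`. -/
noncomputable def permU {k : ℕ} (σ : Equiv.Perm (Fin k)) : U k :=
  ⟨Matrix.of fun i j => if i = σ j then 1 else 0, by
    rw [Matrix.mem_unitaryGroup_iff']
    ext i j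
    rw [Matrix.mul_apply, Matrix.one_apply]
    simp [Matrix.star_apply, apply_ite, eq_comm]⟩

lemma mul_permU_apply {k : ℕ} (u : U k) (σ : Equiv.Perm (Fin k)) (i j : Fin k) :
    (u * permU σ).1 i j = u.1 i (σ j) := by
  show (u.1 * (permU σ).1) i j = _
  rw [Matrix.mul_apply]
  simp [permU]

/-- Permuting the columns of the unitaries compensates a permutation of the table. -/
lemma localConj_relabel (u : U m) (v : U n) (g : Relabelling m n) (lam : Table m n) :
    localConj (u * permU g.1) (v * permU g.2) (relabel g lam) = localConj u v lam := by
  ext p q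
  rw [localConj_apply, localConj_apply]
  simp only [mul_permU_apply, relabel_apply]
  exact Fintype.sum_equiv (g.1.prodCongr g.2) _ _ fun r => rfl

/-! ### Fibres of the eigenvalue parametrization -/

lemma kronecker_diagonal_comm {t : U m} {s : U n} (ht : t ∈ diagU m) (hs : s ∈ diagU n)
    (lam : Table m n) :
    localConj t s lam = Matrix.diagonal fun p => (lam p : ℂ) := by
  have hA := kronecker_mem_unitaryGroup t s
  rw [mem_diagU] at ht hs
  have h : t.1 ⊗ₖ s.1 = Matrix.diagonal fun p => t.1.diag p.1 * s.1.diag p.2 := by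
    conv_lhs => rw [← ht.diagonal_diag, ← hs.diagonal_diag, Matrix.diagonal_kronecker_diagonal]
  rw [localConj]
  have hc : (t.1 ⊗ₖ s.1) * Matrix.diagonal (fun p => (lam p : ℂ)) =
      Matrix.diagonal (fun p => (lam p : ℂ)) * (t.1 ⊗ₖ s.1) := by
    rw [h, Matrix.diagonal_mul_diagonal, Matrix.diagonal_mul_diagonal]
    simp only [mul_comm]
  rw [hc, Matrix.mul_assoc, ← Matrix.star_eq_conjTranspose, Matrix.mem_unitaryGroup_iff.mp hA,
    Matrix.mul_one]

lemma localConj_mul_diagU (u : U m) (v : U n) {t : U m} {s : U n} (ht : t ∈ diagU m)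
    (hs : s ∈ diagU n) (lam : Table m n) :
    localConj (u * t) (v * s) lam = localConj u v lam := by
  rw [← conjBy_localConj, kronecker_diagonal_comm ht hs, localConj_eq_conjBy]

/-- The entries of the table are pairwise distinct. -/
def HasDistinctEntries (lam : Table m n) : Prop := ∀ p q, lam p = lam q → p = q

lemma exists_column_ne_zero {k : ℕ} (a : U k) (j : Fin k) : ∃ i, a.1 i j ≠ 0 := by
  by_contra! h
  have := congrFun (congrFun (Matrix.mem_unitaryGroup_iff'.mp a.2) j) j
  rw [Matrix.mul_apply] at this
  simp [h] at this

/-- Two columns supported at the same single position could not be orthogonal, so `σ` is injective.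
-/
lemma exists_perm_of_support {k : ℕ} (a : U k) (σ : Fin k → Fin k) (h0 : ∀ j, a.1 (σ j) j ≠ 0)
    (h : ∀ i j, a.1 i j ≠ 0 → i = σ j) : Function.Bijective σ := by
  refine Finite.injective_iff_bijective.mp fun j j' hj => ?_
  by_contra hne
  have := congrFun (congrFun (Matrix.mem_unitaryGroup_iff'.mp a.2) j) j'
  rw [Matrix.mul_apply, Matrix.one_apply_ne hne, Finset.sum_eq_single (σ j)] at this
  · rw [Matrix.star_apply] at this
    rcases mul_eq_zero.mp this with h1 | h1
    · exact h0 j (by simpa using h1)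
    · rw [hj] at h1
      exact h0 j' h1
  · intro i _ hi
    rw [Matrix.star_apply]
    by_contra h1
    exact hi (h i j fun h2 => h1 (by rw [h2]; simp))
  · simp

/-- Local diagonalizations with distinct eigenvalues are unique up to relabelling. -/
lemma exists_relabel_of_localConj_eq (hm : 1 ≤ m) (hn : 1 ≤ n) {lam lam' : Table m n}
    (hd : HasDistinctEntries lam) {u u' : U m} {v v' : U n}
    (h : localConj u v lam = localConj u' v' lam') :
    ∃ g : Relabelling m n, lam' = relabel g lam ∧
      (g = 1 → u⁻¹ * u' ∈ diagU m ∧ v⁻¹ * v' ∈ diagU n) := by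
  set a := u⁻¹ * u' with ha
  set b := v⁻¹ * v' with hb
  have h1 : localConj a b lam' = Matrix.diagonal fun p => (lam p : ℂ) := by
    rw [ha, hb, ← conjBy_localConj, ← h, conjBy_localConj, inv_mul_cancel, inv_mul_cancel,
      localConj_one]
  have h2 : (a.1 ⊗ₖ b.1) * Matrix.diagonal (fun p => (lam' p : ℂ)) =
      Matrix.diagonal (fun p => (lam p : ℂ)) * (a.1 ⊗ₖ b.1) := by
    rw [← h1, localConj, Matrix.mul_assoc _ _ (a.1 ⊗ₖ b.1), ← Matrix.star_eq_conjTranspose,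
      Matrix.mem_unitaryGroup_iff'.mp (kronecker_mem_unitaryGroup a b), Matrix.mul_one]
  -- Entrywise form of the intertwining relation `(a ⊗ b) Λ' = Λ (a ⊗ b)`. Because `lam` has
  -- distinct entries, it leaves a single nonzero entry in each column of `a` and of `b`.
  have h3 : ∀ i i' j j', a.1 i i' ≠ 0 → b.1 j j' ≠ 0 → lam' (i', j') = lam (i, j) := by
    intro i i' j j' hai hbj
    have := congrFun (congrFun h2 (i, j)) (i', j')
    rw [Matrix.mul_diagonal, Matrix.diagonal_mul, Matrix.kroneckerMap_apply, mul_comm] at this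
    exact_mod_cast mul_right_cancel₀ (mul_ne_zero hai hbj) this
  choose σ hσ using exists_column_ne_zero a
  choose τ hτ using exists_column_ne_zero b
  have hσ' : ∀ i j, a.1 i j ≠ 0 → i = σ j := fun i j hij => by
    have e1 := h3 i j _ ⟨0, hn⟩ hij (hτ _)
    have e2 := h3 _ j _ ⟨0, hn⟩ (hσ j) (hτ _)
    exact congrArg Prod.fst (hd _ _ (e1.symm.trans e2))
  have hτ' : ∀ i j, b.1 i j ≠ 0 → i = τ j := fun i j hij => by
    have e1 := h3 _ ⟨0, hm⟩ i j (hσ _) hij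
    have e2 := h3 _ ⟨0, hm⟩ _ j (hσ _) (hτ j)
    exact congrArg Prod.snd (hd _ _ (e1.symm.trans e2))
  refine ⟨(Equiv.ofBijective σ (exists_perm_of_support a σ hσ hσ'),
    Equiv.ofBijective τ (exists_perm_of_support b τ hτ hτ')), ?_, fun hg => ⟨?_, ?_⟩⟩
  · ext ⟨i, j⟩
    exact h3 _ _ _ _ (hσ i) (hτ j)
  · have : ∀ j, σ j = j := fun j => congrArg (fun g : Relabelling m n => g.1 j) hg
    intro i j hij
    by_contra h0
    exact hij ((hσ' i j h0).trans (this j))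
  · have : ∀ j, τ j = j := fun j => congrArg (fun g : Relabelling m n => g.2 j) hg
    intro i j hij
    by_contra h0
    exact hij ((hτ' i j h0).trans (this j))

lemma eigTables_localConj (hm : 1 ≤ m) (hn : 1 ≤ n) {lam : Table m n}
    (hd : HasDistinctEntries lam) (u : U m) (v : U n) :
    eigTables (localConj u v lam) = range fun g => relabel g lam := by
  ext lam'
  constructor
  · rintro ⟨u', v', h⟩
    obtain ⟨g, hg, -⟩ := exists_relabel_of_localConj_eq hm hn hd h
    exact ⟨g, hg.symm⟩
  · rintro ⟨g, rfl⟩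
    exact ⟨u * permU g.1, v * permU g.2, (localConj_relabel u v g lam).symm⟩

/-! ### A fundamental domain for the relabellings -/

/-- A linear functional with distinct coefficients. -/
noncomputable def labelFunctional (lam : Table m n) : ℝ := ∑ p, ((finProdFinEquiv p : ℕ) : ℝ) * lam p

lemma continuous_labelFunctional : Continuous (labelFunctional : Table m n → ℝ) := by
  unfold labelFunctional
  fun_prop

/-- Tables with distinct entries which are the unique maximum of `labelFunctional` among their
relabellings. -/
def fundDomain (m n : ℕ) : Set (Table m n) :=
  {lam | HasDistinctEntries lam ∧ ∀ g, g ≠ 1 → labelFunctional (relabel g lam) < labelFunctional lam}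

/-- Tables with distinct entries at which `labelFunctional` separates the relabellings. -/
def genericTables (m n : ℕ) : Set (Table m n) :=
  {lam | HasDistinctEntries lam ∧
    ∀ g h, labelFunctional (relabel g lam) = labelFunctional (relabel h lam) → g = h}

lemma HasDistinctEntries.relabel {lam : Table m n} (h : HasDistinctEntries lam)
    (g : Relabelling m n) : HasDistinctEntries (relabel g lam) := fun p q hpq => by
  have : (g.1 p.1, g.2 p.2) = (g.1 q.1, g.2 q.2) := h _ _ hpq
  rw [Prod.mk.injEq, g.1.injective.eq_iff, g.2.injective.eq_iff] at this
  exact Prod.ext this.1 this.2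

/-- A maximum of the functional over the finite orbit exists, and on generic tables it is attained
by only one relabelling. -/
lemma exists_relabel_mem_fundDomain {lam : Table m n} (h : lam ∈ genericTables m n) :
    ∃ g, relabel g lam ∈ fundDomain m n := by
  obtain ⟨g, hg⟩ := Finite.exists_max fun g : Relabelling m n => labelFunctional (relabel g lam)
  refine ⟨g, h.1.relabel g, fun k hk => ?_⟩
  rw [relabel_relabel]
  refine lt_of_le_of_ne (hg _) fun he => hk ?_
  simpa using h.2 _ _ he

/-- Otherwise each of the two tables would have a strictly larger functional than the other. -/
lemma eq_one_of_relabel_mem_fundDomain {lam : Table m n} (h : lam ∈ fundDomain m n)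
    {g : Relabelling m n} (hg : relabel g lam ∈ fundDomain m n) : g = 1 := by
  by_contra hne
  have h1 := h.2 g hne
  have h2 := hg.2 g⁻¹ (inv_ne_one.mpr hne)
  rw [relabel_relabel, mul_inv_cancel, relabel_one] at h2
  exact lt_asymm h1 h2

lemma isOpen_hasDistinctEntries : IsOpen {lam : Table m n | HasDistinctEntries lam} := by
  have : {lam : Table m n | HasDistinctEntries lam} =
      ⋂ (p) (q) (_ : p ≠ q), {lam : Table m n | lam p ≠ lam q} := by
    ext lam
    simp only [HasDistinctEntries, mem_ofPred_eq, mem_iInter]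
    exact forall₂_congr fun p q => ⟨fun h hpq he => hpq (h he), fun h he => not_not.mp fun hne =>
      h hne he⟩
  rw [this]
  refine isOpen_iInter_of_finite fun p => isOpen_iInter_of_finite fun q =>
    isOpen_iInter_of_finite fun _ => isOpen_ne_fun ?_ ?_ <;> fun_prop

lemma isOpen_fundDomain : IsOpen (fundDomain m n) := by
  have h : IsOpen (⋂ (g : Relabelling m n) (_ : g ≠ 1),
      {lam : Table m n | labelFunctional (LocDiag.relabel g lam) < labelFunctional lam}) :=
    isOpen_iInter_of_finite fun g => isOpen_iInter_of_finite fun _ =>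
      isOpen_lt (continuous_labelFunctional.comp (LocDiag.relabel g).continuous)
        continuous_labelFunctional
  convert isOpen_hasDistinctEntries.inter h using 1
  ext lam
  simp [fundDomain]

lemma relabel_mem_simplex {lam : Table m n} (h : lam ∈ simplex m n) (g : Relabelling m n) :
    relabel g lam ∈ simplex m n :=
  ⟨fun p => h.1 _, by
    rw [← h.2]
    exact Fintype.sum_equiv (g.1.prodCongr g.2) _ _ fun r => rfl⟩

/-- Two local diagonalizations with tables in the fundamental domain. -/
lemma localConj_eq_iff_of_mem_fundDomain (hm : 1 ≤ m) (hn : 1 ≤ n) {lam lam' : Table m n}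
    (hl : lam ∈ fundDomain m n) (hl' : lam' ∈ fundDomain m n) {u u' : U m} {v v' : U n}
    (h : localConj u v lam = localConj u' v' lam') :
    lam' = lam ∧ u⁻¹ * u' ∈ diagU m ∧ v⁻¹ * v' ∈ diagU n := by
  obtain ⟨g, rfl, hg⟩ := exists_relabel_of_localConj_eq hm hn hl.1 h
  have := eq_one_of_relabel_mem_fundDomain hl hl'
  subst this
  exact ⟨relabel_one _, hg rfl⟩

end LocDiag

namespace LocDiag

open scoped NNReal Topology
open Set Module

variable {m n : ℕ}

/-! ### The hyperplane of tables of sum one -/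

/-- Tables of sum one. -/
def hyperplane (m n : ℕ) : Set (Table m n) := {lam | ∑ p, lam p = 1}

lemma isClosed_hyperplane : IsClosed (hyperplane m n) := by
  refine isClosed_eq ?_ continuous_const
  fun_prop

lemma simplex_subset_hyperplane : simplex m n ⊆ hyperplane m n := fun _ h => h.2

lemma isCompact_simplex : IsCompact (simplex m n) := by
  have h1 : IsClosed (simplex m n) := by
    have : simplex m n = (⋂ p, {lam : Table m n | 0 ≤ lam p}) ∩ hyperplane m n := by
      ext lam
      simp [simplex, hyperplane]
    rw [this]
    refine (isClosed_iInter fun p => isClosed_le continuous_const ?_).inter isClosed_hyperplane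
    fun_prop
  refine Metric.isCompact_of_isClosed_isBounded h1 ?_
  refine (Metric.isBounded_closedBall (x := 0) (r := 1)).subset fun lam h => ?_
  rw [mem_closedBall_zero_iff, ← sq_le_one_iff₀ (norm_nonneg _), EuclideanSpace.norm_sq_eq, ← h.2]
  refine Finset.sum_le_sum fun p _ => ?_
  rw [Real.norm_of_nonneg (h.1 p), pow_two]
  refine mul_le_of_le_one_left (h.1 p) ?_
  rw [← h.2]
  exact Finset.single_le_sum (fun q _ => h.1 q) (Finset.mem_univ p)

lemma exists_sumZero_isometry (hm : 1 ≤ m) (hn : 1 ≤ n) :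
    ∃ Q : EuclideanSpace ℝ (Fin (m * n - 1)) →ₗᵢ[ℝ] Table m n,
      ∀ lam : Table m n, ∑ p, lam p = 0 ↔ lam ∈ range Q := by
  let e : Table m n := WithLp.toLp 2 fun _ => 1
  have he : e ≠ 0 := fun h => by
    have := congrArg (fun x : Table m n => x (⟨0, hm⟩, ⟨0, hn⟩)) h
    simp [e] at this
  have hfin : finrank ℝ (Table m n) = (m * n - 1) + 1 := by
    rw [finrank_euclideanSpace, Fintype.card_prod, Fintype.card_fin, Fintype.card_fin]
    have : 0 < m * n := Nat.mul_pos hm hn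
    omega
  have : Fact (finrank ℝ (Table m n) = (m * n - 1) + 1) := ⟨hfin⟩
  have hrank := Submodule.finrank_orthogonal_span_singleton (𝕜 := ℝ) (n := m * n - 1) he
  let b := (stdOrthonormalBasis ℝ (Submodule.span ℝ {e})ᗮ).reindex (finCongr hrank)
  refine ⟨(Submodule.span ℝ {e})ᗮ.subtypeₗᵢ.comp b.repr.symm.toLinearIsometry, fun lam => ?_⟩
  have h1 : ∑ p, lam p = 0 ↔ lam ∈ (Submodule.span ℝ {e})ᗮ := by
    rw [Submodule.mem_orthogonal_singleton_iff_inner_right, PiLp.inner_apply]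
    simp [e]
  rw [h1]
  constructor
  · intro h
    exact ⟨b.repr ⟨lam, h⟩, by simp⟩
  · rintro ⟨x, rfl⟩
    exact (b.repr.symm x).2

/-- Orthonormal coordinates on the tables of sum zero. -/
noncomputable def sumZero (hm : 1 ≤ m) (hn : 1 ≤ n) :
    EuclideanSpace ℝ (Fin (m * n - 1)) →ₗᵢ[ℝ] Table m n :=
  (exists_sumZero_isometry hm hn).choose

lemma mem_range_sumZero (hm : 1 ≤ m) (hn : 1 ≤ n) (lam : Table m n) :
    ∑ p, lam p = 0 ↔ lam ∈ range (sumZero hm hn) :=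
  (exists_sumZero_isometry hm hn).choose_spec lam

lemma add_sumZero_mem (hm : 1 ≤ m) (hn : 1 ≤ n) {lam₀ : Table m n} (h₀ : lam₀ ∈ hyperplane m n)
    (h : EuclideanSpace ℝ (Fin (m * n - 1))) : lam₀ + sumZero hm hn h ∈ hyperplane m n := by
  have h1 := (mem_range_sumZero hm hn (sumZero hm hn h)).mpr ⟨h, rfl⟩
  have h2 : ∑ p, lam₀ p = 1 := h₀
  simp [hyperplane, Finset.sum_add_distrib, h1, h2]

lemma exists_add_sumZero (hm : 1 ≤ m) (hn : 1 ≤ n) {lam₀ lam : Table m n}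
    (h₀ : lam₀ ∈ hyperplane m n) (h : lam ∈ hyperplane m n) :
    ∃ x, lam₀ + sumZero hm hn x = lam := by
  have h1 : ∑ p, lam₀ p = 1 := h₀
  have h2 : ∑ p, lam p = 1 := h
  obtain ⟨x, hx⟩ := (mem_range_sumZero hm hn (lam - lam₀)).mp (by simp [h1, h2])
  exact ⟨x, by rw [hx]; abel⟩

lemma volume_hyperplane (hm : 1 ≤ m) (hn : 1 ≤ n) {lam₀ : Table m n} (h₀ : lam₀ ∈ hyperplane m n)
    {B : Set (Table m n)} (hB : B ⊆ hyperplane m n) :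
    μHE[m * n - 1] B = volume {x | lam₀ + sumZero hm hn x ∈ B} := by
  have hi : Isometry fun x => lam₀ + sumZero hm hn x := Isometry.of_dist_eq fun x y => by
    rw [dist_add_left, (sumZero hm hn).isometry.dist_eq]
  have himg : B = (fun x => lam₀ + sumZero hm hn x) '' {x | lam₀ + sumZero hm hn x ∈ B} := by
    ext lam
    constructor
    · intro h
      obtain ⟨x, rfl⟩ := exists_add_sumZero hm hn h₀ (hB h)
      exact ⟨x, h, rfl⟩
    · rintro ⟨x, hx, rfl⟩
      exact hx
  conv_lhs => rw [himg]
  have := InnerProductSpace.euclideanHausdorffMeasure_eq_volume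
    (V := EuclideanSpace ℝ (Fin (m * n - 1)))
  rw [finrank_euclideanSpace, Fintype.card_fin] at this
  rw [hi.euclideanHausdorffMeasure_image, this]

lemma single_mem_hyperplane (p : Fin m × Fin n) :
    (EuclideanSpace.single p (1 : ℝ) : Table m n) ∈ hyperplane m n := by
  simp [hyperplane]

/-- The form takes the value `c p ≠ 0` at the p-th unit vector, which has sum one. Its zero set in
the hyperplane is therefore a proper affine subspace. -/
lemma volume_hyperplane_inter_eq_zero (hm : 1 ≤ m) (hn : 1 ≤ n) {c : Fin m × Fin n → ℝ}
    (hc : c ≠ 0) : μHE[m * n - 1] (hyperplane m n ∩ {lam | ∑ p, c p * lam p = 0}) = 0 := by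
  obtain ⟨p, hp⟩ := Function.ne_iff.mp hc
  set lam₀ : Table m n := EuclideanSpace.single p 1 with hl
  have h₀ : lam₀ ∈ hyperplane m n := single_mem_hyperplane p
  rw [volume_hyperplane hm hn h₀ inter_subset_left]
  let φ : Table m n →ₗ[ℝ] ℝ :=
    { toFun := fun lam => ∑ p, c p * lam p
      map_add' := fun x y => by
        rw [← Finset.sum_add_distrib]
        refine Finset.sum_congr rfl fun q _ => ?_
        rw [PiLp.add_apply, mul_add]
      map_smul' := fun r x => by
        rw [RingHom.id_apply, smul_eq_mul, Finset.mul_sum]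
        refine Finset.sum_congr rfl fun q _ => ?_
        rw [PiLp.smul_apply, smul_eq_mul]
        ring }
  let f : EuclideanSpace ℝ (Fin (m * n - 1)) →ᵃ[ℝ] ℝ :=
    (φ ∘ₗ (sumZero hm hn).toLinearMap).toAffineMap + AffineMap.const ℝ _ (φ lam₀)
  let A := (AffineSubspace.mk' (0 : ℝ) ⊥).comap f
  have hA : ∀ x, x ∈ A ↔ φ (lam₀ + sumZero hm hn x) = 0 := fun x => by
    have hf : f x = φ (lam₀ + sumZero hm hn x) := by
      rw [map_add, add_comm]
      rfl
    rw [AffineSubspace.mem_comap, hf, AffineSubspace.mem_mk', Submodule.mem_bot, vsub_eq_sub,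
      sub_zero]
  have hne : A ≠ ⊤ := fun h => by
    have h0 : (0 : EuclideanSpace ℝ (Fin (m * n - 1))) ∈ A := by rw [h]; trivial
    rw [hA, map_zero, add_zero] at h0
    have h1 : φ lam₀ = c p := by
      show ∑ q, c q * lam₀ q = c p
      rw [Finset.sum_eq_single p (fun q _ hq => by simp [hl, hq]) (by simp)]
      simp [hl]
    exact hp (h1 ▸ h0)
  refine measure_mono_null (fun x hx => ?_) (Measure.addHaar_affineSubspace volume A hne)
  exact (hA x).mpr hx.2

lemma labelFunctional_relabel (g : Relabelling m n) (lam : Table m n) :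
    labelFunctional (relabel g lam) =
      ∑ p, ((finProdFinEquiv (g.1.symm p.1, g.2.symm p.2) : ℕ) : ℝ) * lam p := by
  unfold labelFunctional
  refine Fintype.sum_equiv (g.1.prodCongr g.2) _ _ fun r => ?_
  show _ = ((finProdFinEquiv (g.1.symm (g.1 r.1), g.2.symm (g.2 r.2)) : ℕ) : ℝ) *
    lam (g.1 r.1, g.2 r.2)
  rw [Equiv.symm_apply_apply, Equiv.symm_apply_apply]
  rfl

/-- Non-generic tables satisfy one of finitely many linear equations: two entries coincide, or two
relabellings give the functional the same value. The second kind is nontrivial because the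
coefficients of `labelFunctional` are distinct. -/
lemma volume_nonGeneric (hm : 1 ≤ m) (hn : 1 ≤ n) :
    μHE[m * n - 1] (hyperplane m n \ genericTables m n) = 0 := by
  classical
  have hsub : hyperplane m n \ genericTables m n ⊆
      (⋃ (p) (q) (_ : p ≠ q), hyperplane m n ∩ {lam | ∑ r, (Pi.single p 1 - Pi.single q 1 :
        Fin m × Fin n → ℝ) r * lam r = 0}) ∪
      ⋃ (g : Relabelling m n) (h : Relabelling m n) (_ : g ≠ h), hyperplane m n ∩ {lam | ∑ r,
        (((finProdFinEquiv (g.1.symm r.1, g.2.symm r.2) : ℕ) : ℝ) -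
          ((finProdFinEquiv (h.1.symm r.1, h.2.symm r.2) : ℕ) : ℝ)) * lam r = 0} := by
    rintro lam ⟨hl, hg⟩
    by_cases hd : HasDistinctEntries lam
    · right
      have : ¬ ∀ g h, labelFunctional (relabel g lam) = labelFunctional (relabel h lam) → g = h :=
        fun h => hg ⟨hd, h⟩
      push Not at this
      obtain ⟨g, h, he, hne⟩ := this
      simp only [mem_iUnion]
      refine ⟨g, h, hne, hl, ?_⟩
      rw [labelFunctional_relabel, labelFunctional_relabel, ← sub_eq_zero,
        ← Finset.sum_sub_distrib] at he
      simpa only [mem_ofPred_eq, sub_mul] using he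
    · left
      unfold HasDistinctEntries at hd
      push Not at hd
      obtain ⟨p, q, he, hne⟩ := hd
      simp only [mem_iUnion]
      refine ⟨p, q, hne, hl, ?_⟩
      simp [sub_mul, Finset.sum_sub_distrib, Pi.single_apply, he]
  refine measure_mono_null hsub (measure_union_null ?_ ?_)
  · refine measure_iUnion_null fun p => measure_iUnion_null fun q => measure_iUnion_null fun hpq =>
      volume_hyperplane_inter_eq_zero hm hn fun h => ?_
    have := congrFun h p
    simp [hpq] at this
  · refine measure_iUnion_null fun g => measure_iUnion_null fun h => measure_iUnion_null fun hgh =>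
      volume_hyperplane_inter_eq_zero hm hn
      (c := fun r => ((finProdFinEquiv (g.1.symm r.1, g.2.symm r.2) : ℕ) : ℝ) -
          ((finProdFinEquiv (h.1.symm r.1, h.2.symm r.2) : ℕ) : ℝ)) fun hc => hgh ?_
    have key : ∀ i j, g.1.symm i = h.1.symm i ∧ g.2.symm j = h.2.symm j := fun i j => by
      have := congrFun hc (i, j)
      simp only [Pi.zero_apply, sub_eq_zero, Nat.cast_inj] at this
      have := finProdFinEquiv.injective (Fin.ext this)
      exact Prod.mk.inj this
    refine Prod.ext ?_ ?_
    · exact Equiv.symm_bijective.injective (Equiv.ext fun i => (key i ⟨0, hn⟩).1)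
    · exact Equiv.symm_bijective.injective (Equiv.ext fun j => (key ⟨0, hm⟩ j).2)

/-! ### Local coordinates on the locally diagonalizable matrices -/

/-- Index set of the local coordinates. -/
abbrev LocIdx (m n : ℕ) : Type := Off m ⊕ (Off n ⊕ Fin (m * n - 1))

/-- The identity is `(m² - m) + (n² - n) + (mn - 1) = (m² - 1) + (n² - 1) + (m - 1)(n - 1)`; writing
m and n as successors makes the truncated subtractions exact. -/
lemma dimLU_eq_card (hm : 1 ≤ m) (hn : 1 ≤ n) : dimLU m n = Fintype.card (LocIdx m n) := by
  rw [Fintype.card_sum, Fintype.card_sum, Fintype.card_fin, dimLU]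
  have h1 := card_off m
  have h2 := card_off n
  obtain ⟨a, rfl⟩ := Nat.exists_eq_add_of_le' hm
  obtain ⟨b, rfl⟩ := Nat.exists_eq_add_of_le' hn
  have h3 : (a + 1) * (b + 1) = a * b + a + b + 1 := by ring
  have h4 : (a + 1) ^ 2 = a ^ 2 + 2 * a + 1 := by ring
  have h5 : (b + 1) ^ 2 = b ^ 2 + 2 * b + 1 := by ring
  rw [h3]
  simp only [Nat.add_sub_cancel]
  omega

/-- The coordinates in the first off-diagonal block. -/
noncomputable def blockX (m n : ℕ) : EuclideanSpace ℝ (LocIdx m n) →L[ℝ] EuclideanSpace ℝ (Off m) :=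
  fstBlock _ _

/-- The coordinates in the second off-diagonal block. -/
noncomputable def blockY (m n : ℕ) : EuclideanSpace ℝ (LocIdx m n) →L[ℝ] EuclideanSpace ℝ (Off n) :=
  (fstBlock _ _).comp (sndBlock _ _)

/-- The coordinates of the table. -/
noncomputable def blockH (m n : ℕ) :
    EuclideanSpace ℝ (LocIdx m n) →L[ℝ] EuclideanSpace ℝ (Fin (m * n - 1)) :=
  (sndBlock _ _).comp (sndBlock _ _)

lemma volume_threeBlocks (A : Set (EuclideanSpace ℝ (Off m))) (B : Set (EuclideanSpace ℝ (Off n)))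
    (D : Set (EuclideanSpace ℝ (Fin (m * n - 1)))) :
    volume {z : EuclideanSpace ℝ (LocIdx m n) | blockX m n z ∈ A ∧ blockY m n z ∈ B ∧
      blockH m n z ∈ D} = volume A * (volume B * volume D) := by
  rw [← volume_blocks, ← volume_blocks]
  rfl

/-- Local coordinates on the locally diagonalizable matrices. -/
noncomputable def locMap (hm : 1 ≤ m) (hn : 1 ≤ n) (lam₀ : Table m n)
    (z : EuclideanSpace ℝ (LocIdx m n)) : BiMat m n :=
  localConj (uexp m (blockX m n z)) (uexp n (blockY m n z)) (lam₀ + sumZero hm hn (blockH m n z))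

/-- `X ↦ X ⊗ 1`. -/
def kronOne (m n : ℕ) : Matrix (Fin m) (Fin m) ℂ →ₗ[ℝ] BiMat m n where
  toFun X := X ⊗ₖ 1
  map_add' _ _ := Matrix.add_kronecker _ _ _
  map_smul' _ _ := Matrix.smul_kronecker _ _ _

/-- `Y ↦ 1 ⊗ Y`. -/
def oneKron (m n : ℕ) : Matrix (Fin n) (Fin n) ℂ →ₗ[ℝ] BiMat m n where
  toFun Y := 1 ⊗ₖ Y
  map_add' _ _ := Matrix.kronecker_add _ _ _
  map_smul' _ _ := Matrix.kronecker_smul _ _ _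

/-- The conjugate transpose as a real linear map. -/
def starLin (ι : Type*) : Matrix ι ι ℂ →ₗ[ℝ] Matrix ι ι ℂ where
  toFun A := A.conjTranspose
  map_add' _ _ := Matrix.conjTranspose_add _ _
  map_smul' r A := by rw [Matrix.conjTranspose_smul]; simp

/-- The diagonal matrix of a table. -/
def tableDiag (m n : ℕ) : Table m n →ₗ[ℝ] BiMat m n where
  toFun lam := Matrix.diagonal fun p => (lam p : ℂ)
  map_add' x y := by rw [Matrix.diagonal_add]; congr 1; ext p; simp
  map_smul' r x := by rw [← Matrix.diagonal_smul]; congr 1; ext p; simp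

/-- The derivative of the local unitary. -/
noncomputable def kronSum (m n : ℕ) : EuclideanSpace ℝ (LocIdx m n) →ₗ[ℝ] BiMat m n :=
  kronOne m n ∘ₗ offMat m ∘ₗ (blockX m n).toLinearMap +
    oneKron m n ∘ₗ offMat n ∘ₗ (blockY m n).toLinearMap

/-- The derivative of the local coordinates. -/
noncomputable def locDeriv (hm : 1 ≤ m) (hn : 1 ≤ n) (lam₀ : Table m n) :
    EuclideanSpace ℝ (LocIdx m n) →ₗ[ℝ] BiMat m n :=
  LinearMap.mulRight ℝ (tableDiag m n lam₀) ∘ₗ kronSum m n +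
    tableDiag m n ∘ₗ (sumZero hm hn).toLinearMap ∘ₗ (blockH m n).toLinearMap +
    LinearMap.mulLeft ℝ (tableDiag m n lam₀) ∘ₗ starLin _ ∘ₗ kronSum m n

section

open scoped Matrix.Norms.Frobenius

lemma hasStrictFDerivAt_locMap (hm : 1 ≤ m) (hn : 1 ≤ n) (lam₀ : Table m n) :
    HasStrictFDerivAt (locMap hm hn lam₀)
      (LinearMap.toContinuousLinearMap (locDeriv hm hn lam₀)) 0 := by
  let E := EuclideanSpace ℝ (LocIdx m n)
  let K1 := LinearMap.toContinuousLinearMap (kronOne m n)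
  let K2 := LinearMap.toContinuousLinearMap (oneKron m n)
  let T := LinearMap.toContinuousLinearMap (tableDiag m n)
  let St := LinearMap.toContinuousLinearMap (starLin (Fin m × Fin n))
  let G := LinearMap.toContinuousLinearMap (kronSum m n)
  have hX : HasStrictFDerivAt (fun z : E => K1 (uexp m (blockX m n z)).1) _ 0 :=
    K1.hasStrictFDerivAt.comp (0 : E) (HasStrictFDerivAt.comp (g := fun x => (uexp m x).1) 0
      (by rw [map_zero]; exact hasStrictFDerivAt_uexp m) (blockX m n).hasStrictFDerivAt)
  have hY : HasStrictFDerivAt (fun z : E => K2 (uexp n (blockY m n z)).1) _ 0 :=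
    K2.hasStrictFDerivAt.comp (0 : E) (HasStrictFDerivAt.comp (g := fun x => (uexp n x).1) 0
      (by rw [map_zero]; exact hasStrictFDerivAt_uexp n) (blockY m n).hasStrictFDerivAt)
  have k1 : K1 1 = 1 := Matrix.one_kronecker_one
  have k2 : K2 1 = 1 := Matrix.one_kronecker_one
  have hV : HasStrictFDerivAt (fun z : E =>
      K1 (uexp m (blockX m n z)).1 * K2 (uexp n (blockY m n z)).1) G 0 := by
    refine (hX.mul' hY).congr_fderiv (ContinuousLinearMap.ext fun z => ?_)
    show K1 (uexp m (blockX m n 0)).1 * K2 (offMat n (blockY m n z)) +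
      K1 (offMat m (blockX m n z)) * K2 (uexp n (blockY m n 0)).1 =
      K1 (offMat m (blockX m n z)) + K2 (offMat n (blockY m n z))
    rw [map_zero, map_zero, uexp_zero, uexp_zero, OneMemClass.coe_one, OneMemClass.coe_one, k1, k2,
      one_mul, mul_one, add_comm]
  have hD : HasStrictFDerivAt (fun z : E => T (lam₀ + sumZero hm hn (blockH m n z)))
      (T.comp ((sumZero hm hn).toContinuousLinearMap.comp (blockH m n))) 0 :=
    T.hasStrictFDerivAt.comp (0 : E)
      (((sumZero hm hn).toContinuousLinearMap.comp (blockH m n)).hasStrictFDerivAt.const_add lam₀)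
  have hS := St.hasStrictFDerivAt.comp (0 : E) hV
  -- Written with real-linear maps, `locMap` is a product of three factors, so only the product rule
  -- is needed.
  have hfun : locMap hm hn lam₀ = fun z : E =>
      (K1 (uexp m (blockX m n z)).1 * K2 (uexp n (blockY m n z)).1) *
      T (lam₀ + sumZero hm hn (blockH m n z)) *
      St (K1 (uexp m (blockX m n z)).1 * K2 (uexp n (blockY m n z)).1) := by
    ext1 z
    have : K1 (uexp m (blockX m n z)).1 * K2 (uexp n (blockY m n z)).1 =
        (uexp m (blockX m n z)).1 ⊗ₖ (uexp n (blockY m n z)).1 := by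
      show ((uexp m (blockX m n z)).1 ⊗ₖ (1 : Matrix (Fin n) (Fin n) ℂ)) *
        ((1 : Matrix (Fin m) (Fin m) ℂ) ⊗ₖ (uexp n (blockY m n z)).1) = _
      rw [← Matrix.mul_kronecker_mul, Matrix.mul_one, Matrix.one_mul]
    rw [this]
    rfl
  rw [hfun]
  refine ((hV.mul' hD).mul' hS).congr_fderiv (ContinuousLinearMap.ext fun z => ?_)
  have hV0 : K1 (uexp m (blockX m n 0)).1 * K2 (uexp n (blockY m n 0)).1 = 1 := by
    rw [map_zero, map_zero, uexp_zero, uexp_zero, OneMemClass.coe_one, OneMemClass.coe_one, k1, k2,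
      one_mul]
  have hD0 : lam₀ + sumZero hm hn (blockH m n 0) = lam₀ := by
    rw [map_zero, map_zero, add_zero]
  have hS1 : St 1 = 1 := Matrix.conjTranspose_one
  show (K1 (uexp m (blockX m n 0)).1 * K2 (uexp n (blockY m n 0)).1 *
      T (lam₀ + sumZero hm hn (blockH m n 0))) * St (G z) +
    ((K1 (uexp m (blockX m n 0)).1 * K2 (uexp n (blockY m n 0)).1) *
      T (sumZero hm hn (blockH m n z)) + G z * T (lam₀ + sumZero hm hn (blockH m n 0))) *
      St (K1 (uexp m (blockX m n 0)).1 * K2 (uexp n (blockY m n 0)).1) =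
    G z * T lam₀ + T (sumZero hm hn (blockH m n z)) + T lam₀ * St (G z)
  rw [hV0, hD0, hS1, one_mul, one_mul, mul_one]
  abel

/-- The generator `X ⊗ 1 + 1 ⊗ Y` is skew-Hermitian, so the two outer terms of the derivative
combine to its commutator with Λ, which multiplies each entry by a difference of eigenvalues. -/
lemma locDeriv_apply (hm : 1 ≤ m) (hn : 1 ≤ n) (lam₀ : Table m n)
    (z : EuclideanSpace ℝ (LocIdx m n)) (p q : Fin m × Fin n) :
    locDeriv hm hn lam₀ z p q =
      ((offMat m (blockX m n z) p.1 q.1 * if p.2 = q.2 then 1 else 0) +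
        ((if p.1 = q.1 then 1 else 0) * offMat n (blockY m n z) p.2 q.2)) * (lam₀ q - lam₀ p) +
      if p = q then (sumZero hm hn (blockH m n z) p : ℂ) else 0 := by
  have hx := fun i j => congrFun (congrFun (star_offMat (blockX m n z)) i) j
  have hy := fun i j => congrFun (congrFun (star_offMat (blockY m n z)) i) j
  simp only [Matrix.star_apply, Matrix.neg_apply] at hx hy
  show (kronSum m n z * tableDiag m n lam₀ + tableDiag m n (sumZero hm hn (blockH m n z)) +
    tableDiag m n lam₀ * (kronSum m n z).conjTranspose) p q = _
  have hk : ∀ p q, kronSum m n z p q = (offMat m (blockX m n z) p.1 q.1 * if p.2 = q.2 then 1 else 0) +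
        ((if p.1 = q.1 then 1 else 0) * offMat n (blockY m n z) p.2 q.2) := fun p q => by
    show (offMat m (blockX m n z) ⊗ₖ (1 : Matrix (Fin n) (Fin n) ℂ) +
      (1 : Matrix (Fin m) (Fin m) ℂ) ⊗ₖ offMat n (blockY m n z) : BiMat m n) p q = _
    rw [Matrix.add_apply, Matrix.kroneckerMap_apply, Matrix.kroneckerMap_apply, Matrix.one_apply,
      Matrix.one_apply]
  have hks : (kronSum m n z).conjTranspose p q = -kronSum m n z p q := by
    rw [Matrix.conjTranspose_apply, hk, hk, star_add, star_mul', star_mul', hx, hy]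
    simp only [apply_ite star, star_one, star_zero, eq_comm (a := q.2), eq_comm (a := q.1)]
    ring
  rw [Matrix.add_apply, Matrix.add_apply]
  simp only [tableDiag, LinearMap.coe_mk, AddHom.coe_mk, Matrix.mul_diagonal, Matrix.diagonal_mul,
    hks, hk, Matrix.diagonal_apply]
  ring

/-! ### The quadratic form of the derivative -/

/-- Squared distance of two rows. -/
def rowDist (lam : Table m n) (i i' : Fin m) : ℝ := ∑ j, (lam (i, j) - lam (i', j)) ^ 2

/-- Squared distance of two columns. -/
def colDist (lam : Table m n) (j j' : Fin n) : ℝ := ∑ i, (lam (i, j) - lam (i, j')) ^ 2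

/-- The squared singular values of the derivative of the local coordinates. -/
def locWeights (lam : Table m n) : LocIdx m n → ℝ :=
  Sum.elim (fun p => rowDist lam p.1.1 p.1.2) (Sum.elim (fun p => colDist lam p.1.1 p.1.2) 1)

/-- The contributions of X, Y and H occupy disjoint matrix positions, so no cross terms appear.
Summing the X-part over the common column index produces the row distance, and symmetrically for Y.
-/
lemma norm_sq_locDeriv (hm : 1 ≤ m) (hn : 1 ≤ n) (lam₀ : Table m n)
    (z : EuclideanSpace ℝ (LocIdx m n)) :
    ‖locDeriv hm hn lam₀ z‖ ^ 2 = ∑ k, locWeights lam₀ k * z k ^ 2 := by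
  have hent : ∀ p q : Fin m × Fin n, ‖locDeriv hm hn lam₀ z p q‖ ^ 2 =
      (if p.2 = q.2 then ‖offMat m (blockX m n z) p.1 q.1‖ ^ 2 * (lam₀ p - lam₀ q) ^ 2 else 0) +
      (if p.1 = q.1 then ‖offMat n (blockY m n z) p.2 q.2‖ ^ 2 * (lam₀ p - lam₀ q) ^ 2 else 0) +
      if p = q then sumZero hm hn (blockH m n z) p ^ 2 else 0 := by
    rintro ⟨i, j⟩ ⟨i', j'⟩
    have hsub : ‖((lam₀ (i', j') : ℂ) - lam₀ (i, j))‖ ^ 2 = (lam₀ (i, j) - lam₀ (i', j')) ^ 2 := by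
      rw [← Complex.ofReal_sub, Complex.norm_real, Real.norm_eq_abs, sq_abs]
      ring
    rw [locDeriv_apply]
    by_cases h1 : i = i'
    · by_cases h2 : j = j'
      · subst h1 h2
        simp [offMat_diag]
      · subst h1
        simp [h2, offMat_diag, mul_pow, hsub]
    · by_cases h2 : j = j'
      · subst h2
        simp [h1, mul_pow, hsub]
      · simp [h1, h2]
  rw [norm_sq_eq_sum]
  simp only [hent, Finset.sum_add_distrib]
  rw [Fintype.sum_sum_type, Fintype.sum_sum_type, ← add_assoc]
  congr 1
  · congr 1
    · have := sum_mul_norm_sq_offMat (blockX m n z) (rowDist lam₀) fun i j => by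
        unfold rowDist; exact Finset.sum_congr rfl fun _ _ => by ring
      refine Eq.trans ?_ this
      rw [Fintype.sum_prod_type]
      refine Finset.sum_congr rfl fun i _ => ?_
      simp only [Fintype.sum_prod_type]
      rw [Finset.sum_comm]
      refine Finset.sum_congr rfl fun i' _ => ?_
      simp only [Finset.sum_ite_eq, Finset.mem_univ, if_true]
      rw [← Finset.mul_sum, mul_comm]
      rfl
    · have := sum_mul_norm_sq_offMat (blockY m n z) (colDist lam₀) fun i j => by
        unfold colDist; exact Finset.sum_congr rfl fun _ _ => by ring
      refine Eq.trans ?_ this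
      rw [Fintype.sum_prod_type, Finset.sum_comm]
      refine Finset.sum_congr rfl fun j _ => ?_
      simp only [Fintype.sum_prod_type_right]
      rw [Finset.sum_comm]
      refine Finset.sum_congr rfl fun j' _ => ?_
      simp only [Finset.sum_ite_eq, Finset.mem_univ, if_true]
      rw [← Finset.mul_sum, mul_comm]
      rfl
  · simp only [Finset.sum_ite_eq, Finset.mem_univ, if_true]
    have h1 : ∑ p, sumZero hm hn (blockH m n z) p ^ 2 = ‖sumZero hm hn (blockH m n z)‖ ^ 2 := by
      rw [EuclideanSpace.norm_sq_eq]
      simp only [Real.norm_eq_abs, sq_abs]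
    rw [h1, LinearIsometry.norm_map, EuclideanSpace.norm_sq_eq]
    refine Finset.sum_congr rfl fun k _ => ?_
    simp only [locWeights, Sum.elim_inr, Pi.one_apply, one_mul, Real.norm_eq_abs, sq_abs]
    rfl

end

end LocDiag

namespace LocDiag

open scoped NNReal Topology
open Set Module

variable {m n : ℕ}

/-! ### The Jacobian -/

/-- Each unordered pair occurs twice among the off-diagonal positions, so the square roots
disappear. This reflects the two real coordinates of a complex entry. -/
lemma prod_off_sqrt {k : ℕ} (S : Fin k → Fin k → ℝ) (hS : ∀ i j, S i j = S j i)
    (h0 : ∀ i j, 0 ≤ S i j) :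
    ∏ p : Off k, √(S p.1.1 p.1.2) = ∏ i, ∏ j ∈ Finset.Ioi i, S i j := by
  have h1 := Finset.prod_prod_Ioi_mul_eq_prod_prod_off_diag fun i j => √(S i j)
  have h2 : ∀ i j, √(S j i) * √(S i j) = S i j := fun i j => by
    rw [hS j i, Real.mul_self_sqrt (h0 i j)]
  simp only [h2] at h1
  rw [h1, Finset.prod_sigma', ← Finset.prod_coe_sort (Finset.univ.sigma _)]
  let e : Off k ≃ ↥(Finset.univ.sigma fun i : Fin k => ({i}ᶜ : Finset (Fin k))) :=
    ⟨fun p => ⟨⟨p.1.1, p.1.2⟩, by simpa using Ne.symm p.2⟩,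
      fun q => ⟨(q.1.1, q.1.2), fun h =>
        Finset.mem_compl.mp (Finset.mem_sigma.mp q.2).2 (Finset.mem_singleton.mpr h.symm)⟩, fun _ => rfl, fun _ => rfl⟩
  refine Fintype.prod_equiv e _ _ fun p => ?_
  rw [hS]
  rfl

lemma rowDist_nonneg (lam : Table m n) (i i' : Fin m) : 0 ≤ rowDist lam i i' :=
  Finset.sum_nonneg fun _ _ => sq_nonneg _

lemma colDist_nonneg (lam : Table m n) (j j' : Fin n) : 0 ≤ colDist lam j j' :=
  Finset.sum_nonneg fun _ _ => sq_nonneg _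

lemma rowDist_comm (lam : Table m n) (i i' : Fin m) : rowDist lam i i' = rowDist lam i' i :=
  Finset.sum_congr rfl fun _ _ => by ring

lemma colDist_comm (lam : Table m n) (j j' : Fin n) : colDist lam j j' = colDist lam j' j :=
  Finset.sum_congr rfl fun _ _ => by ring

lemma prod_sqrt_locWeights (lam : Table m n) : ∏ k, √(locWeights lam k) = J lam := by
  rw [Fintype.prod_sum_type, Fintype.prod_sum_type]
  simp only [locWeights, Sum.elim_inl, Sum.elim_inr, Pi.one_apply, Real.sqrt_one,
    Finset.prod_const_one, mul_one]
  rw [prod_off_sqrt _ (rowDist_comm lam) (rowDist_nonneg lam),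
    prod_off_sqrt _ (colDist_comm lam) (colDist_nonneg lam)]
  rfl

lemma locWeights_pos (hm : 1 ≤ m) (hn : 1 ≤ n) {lam : Table m n} (h : HasDistinctEntries lam)
    (k : LocIdx m n) : 0 < locWeights lam k := by
  rcases k with p | p | _
  · refine Finset.sum_pos (fun j _ => ?_) ⟨(⟨0, hn⟩ : Fin n), Finset.mem_univ _⟩
    exact sq_pos_iff.mpr (sub_ne_zero.mpr fun he => p.2 (Prod.mk.inj (h _ _ he)).1)
  · refine Finset.sum_pos (fun j _ => ?_) ⟨(⟨0, hm⟩ : Fin m), Finset.mem_univ _⟩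
    exact sq_pos_iff.mpr (sub_ne_zero.mpr fun he => p.2 (Prod.mk.inj (h _ _ he)).2)
  · exact one_pos

lemma J_pos (hm : 1 ≤ m) (hn : 1 ≤ n) {lam : Table m n} (h : HasDistinctEntries lam) :
    0 < J lam := by
  rw [← prod_sqrt_locWeights]
  exact Finset.prod_pos fun k _ => Real.sqrt_pos.mpr (locWeights_pos hm hn h k)

lemma continuous_J : Continuous (J : Table m n → ℝ) := by
  unfold J
  fun_prop

lemma J_relabel (g : Relabelling m n) (lam : Table m n) : J (relabel g lam) = J lam := by
  rw [← prod_sqrt_locWeights, ← prod_sqrt_locWeights]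
  let e : LocIdx m n ≃ LocIdx m n := Equiv.sumCongr
    ((g.1.prodCongr g.1).subtypeEquiv fun p => by simp)
    (Equiv.sumCongr ((g.2.prodCongr g.2).subtypeEquiv fun p => by simp) (Equiv.refl _))
  refine Fintype.prod_equiv e _ _ fun k => ?_
  congr 1
  rcases k with p | p | _
  · exact Fintype.sum_equiv g.2 _ _ fun j => rfl
  · exact Fintype.sum_equiv g.1 _ _ fun j => rfl
  · rfl

/-! ### Volume of families of locally diagonalizable matrices -/

/-- The matrices with diagonalizing unitaries and eigenvalue tables in given sets. -/
def tube (A : Set (U m)) (A' : Set (U n)) (B : Set (Table m n)) : Set (BiMat m n) :=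
  (fun x : U m × U n × Table m n => localConj x.1 x.2.1 x.2.2) '' A ×ˢ A' ×ˢ B

lemma mem_tube {A : Set (U m)} {A' : Set (U n)} {B : Set (Table m n)} {ρ : BiMat m n} :
    ρ ∈ tube A A' B ↔ ∃ u ∈ A, ∃ v ∈ A', ∃ lam ∈ B, localConj u v lam = ρ := by
  constructor
  · rintro ⟨⟨u, v, lam⟩, ⟨hu, hv, hl⟩, rfl⟩
    exact ⟨u, hu, v, hv, lam, hl, rfl⟩
  · rintro ⟨u, hu, v, hv, lam, hl, rfl⟩
    exact ⟨(u, v, lam), ⟨hu, hv, hl⟩, rfl⟩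

/-- A closed cell around the diagonal torus. -/
def cell (k : ℕ) (r : ℝ) : Set (U k) := cellU (Metric.closedBall 0 r) (diagU k : Set (U k))

lemma uexp_mem_cell {k : ℕ} {r : ℝ} {x : EuclideanSpace ℝ (Off k)}
    (hx : x ∈ Metric.closedBall 0 r) : uexp k x ∈ cell k r :=
  mem_cellU.mpr ⟨x, hx, 1, one_mem _, mul_one _⟩

/-- The torus parts of the cells commute with Λ and drop out, leaving exactly a chart image. -/
lemma tube_cell (hm : 1 ≤ m) (hn : 1 ≤ n) {lam₀ : Table m n} (h₀ : lam₀ ∈ hyperplane m n)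
    {B : Set (Table m n)} (hB : B ⊆ hyperplane m n) (r : ℝ) :
    tube (cell m r) (cell n r) B = locMap hm hn lam₀ '' {z | blockX m n z ∈ Metric.closedBall 0 r ∧
      blockY m n z ∈ Metric.closedBall 0 r ∧
      blockH m n z ∈ {x | lam₀ + sumZero hm hn x ∈ B}} := by
  ext ρ
  rw [mem_tube]
  constructor
  · rintro ⟨u, hu, v, hv, lam, hl, rfl⟩
    obtain ⟨x, hx, t, ht, rfl⟩ := mem_cellU.mp hu
    obtain ⟨y, hy, s, hs, rfl⟩ := mem_cellU.mp hv
    obtain ⟨h, rfl⟩ := exists_add_sumZero hm hn h₀ (hB hl)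
    refine ⟨joinBlocks x (joinBlocks y h), ⟨hx, hy, hl⟩, ?_⟩
    rw [localConj_mul_diagU _ _ ht hs]
    rfl
  · rintro ⟨z, ⟨hx, hy, hl⟩, rfl⟩
    exact ⟨_, uexp_mem_cell hx, _, uexp_mem_cell hy, _, hl, rfl⟩

lemma exists_blocks_subset (hm : 1 ≤ m) (hn : 1 ≤ n) {N : Set (EuclideanSpace ℝ (LocIdx m n))}
    (hN : N ∈ 𝓝 0) (lam₀ : Table m n) :
    ∃ r₀ > 0, ∃ N' ∈ 𝓝 lam₀, ∀ r ≤ r₀, ∀ B ⊆ N', {z | blockX m n z ∈ Metric.closedBall 0 r ∧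
      blockY m n z ∈ Metric.closedBall 0 r ∧ blockH m n z ∈ {x | lam₀ + sumZero hm hn x ∈ B}} ⊆ N := by
  obtain ⟨ε, hε, h⟩ := Metric.mem_nhds_iff.mp hN
  -- Three orthogonal blocks of norm at most ε/2 give `‖z‖² ≤ 3ε²/4 < ε²`.
  refine ⟨ε / 2, by positivity, Metric.closedBall lam₀ (ε / 2),
    Metric.closedBall_mem_nhds _ (by positivity), ?_⟩
  rintro r hr B hB z ⟨hx, hy, hl⟩
  refine h ?_
  have hh : ‖blockH m n z‖ ≤ ε / 2 := by
    have := hB hl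
    rwa [mem_closedBall_iff_norm, add_sub_cancel_left, LinearIsometry.norm_map] at this
  rw [mem_closedBall_zero_iff] at hx hy
  have h1 := norm_sq_blocks z
  have h2 := norm_sq_blocks (sndBlock (Off m) (Off n ⊕ Fin (m * n - 1)) z)
  have hx2 : ‖blockX m n z‖ ^ 2 ≤ (ε / 2) ^ 2 := by gcongr; exact hx.trans hr
  have hy2 : ‖blockY m n z‖ ^ 2 ≤ (ε / 2) ^ 2 := by gcongr; exact hy.trans hr
  have hh2 : ‖blockH m n z‖ ^ 2 ≤ (ε / 2) ^ 2 := by gcongr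
  have h3 : ‖z‖ ^ 2 = ‖blockX m n z‖ ^ 2 + (‖blockY m n z‖ ^ 2 + ‖blockH m n z‖ ^ 2) := by
    rw [h1, h2]
    rfl
  rw [mem_ball_zero_iff, ← sq_lt_sq₀ (norm_nonneg _) hε.le, h3]
  nlinarith

lemma volume_tube_blocks (hm : 1 ≤ m) (hn : 1 ≤ n) {lam₀ : Table m n} (h₀ : lam₀ ∈ hyperplane m n)
    {B : Set (Table m n)} (hB : B ⊆ hyperplane m n) (r : ℝ) :
    volume {z | blockX m n z ∈ Metric.closedBall 0 r ∧ blockY m n z ∈ Metric.closedBall 0 r ∧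
      blockH m n z ∈ {x | lam₀ + sumZero hm hn x ∈ B}} =
    volume (Metric.closedBall (0 : EuclideanSpace ℝ (Off m)) r) *
      (volume (Metric.closedBall (0 : EuclideanSpace ℝ (Off n)) r) * μHE[m * n - 1] B) := by
  rw [volume_threeBlocks, volume_hyperplane hm hn h₀ hB]

/-- The area formula for `locMap`, whose volume factor is `J`. It is uniform in `B` and in small
`r`, so the radius can still be shrunk to meet `exists_cellU_near`. -/
lemma exists_tube_near (hm : 1 ≤ m) (hn : 1 ≤ n) {lam₀ : Table m n} (h₀ : lam₀ ∈ hyperplane m n)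
    (hd : HasDistinctEntries lam₀) {K : ℝ≥0} (hK : 1 < K) :
    ∃ r₀ > 0, ∃ N ∈ 𝓝 lam₀, ∀ r ≤ r₀, ∀ B ⊆ N ∩ hyperplane m n,
      Near K (hsVol _ (dimLU m n) (tube (cell m r) (cell n r) B))
        (ENNReal.ofReal (J lam₀) * (volume (Metric.closedBall (0 : EuclideanSpace ℝ (Off m)) r) *
      (volume (Metric.closedBall (0 : EuclideanSpace ℝ (Off n)) r) * μHE[m * n - 1] B))) := by
  obtain ⟨N, hN, -, h⟩ := exists_hsVol_image_near (hasStrictFDerivAt_locMap hm hn lam₀)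
    (dimLU_eq_card hm hn) (locWeights_pos hm hn hd) (norm_sq_locDeriv hm hn lam₀) hK
  obtain ⟨r₀, hr₀, N', hN', h'⟩ := exists_blocks_subset hm hn hN lam₀
  refine ⟨r₀, hr₀, N', hN', fun r hr B hB => ?_⟩
  rw [tube_cell hm hn h₀ (hB.trans inter_subset_right), ← prod_sqrt_locWeights,
    ← volume_tube_blocks hm hn h₀ (hB.trans inter_subset_right)]
  exact h _ (h' r hr B (hB.trans inter_subset_left))

/-! ### Volume bounds near arbitrary tables -/

lemma hsVol_conjBy (u : U m) (v : U n) (d : ℕ) (S : Set (BiMat m n)) :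
    hsVol _ d (conjBy u v '' S) = hsVol _ d S :=
  hsVol_unitary_mul (kronecker_mem_unitaryGroup u v)
    (Unitary.star_mem (kronecker_mem_unitaryGroup u v)) d S

lemma exists_finite_translates {k : ℕ} {r : ℝ} (hr : 0 < r) :
    ∃ F : Finset (U k), ∀ u : U k, ∃ w ∈ F, ∃ c ∈ cell k r, w * c = u := by
  obtain ⟨F, -, hF⟩ := isCompact_univ.elim_nhds_subcover (fun w : U k => (w⁻¹ * ·) ⁻¹' cell k r)
    fun w _ => (continuous_const_mul w⁻¹).continuousAt.preimage_mem_nhds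
      (by rw [inv_mul_cancel]; exact cellU_mem_nhds hr)
  refine ⟨F, fun u => ?_⟩
  obtain ⟨w, hw, hu⟩ := mem_iUnion₂.mp (hF (mem_univ u))
  exact ⟨w, hw, _, hu, mul_inv_cancel_left _ _⟩

/-- Finitely many translates of the cells cover both unitary groups, and the corresponding tubes are
conjugate, hence of equal volume. Coinciding eigenvalues are allowed, because only the Lipschitz
bound enters. -/
lemma exists_tube_univ_le (hm : 1 ≤ m) (hn : 1 ≤ n) {lam₀ : Table m n}
    (h₀ : lam₀ ∈ hyperplane m n) :
    ∃ N ∈ 𝓝 lam₀, ∃ K : ℝ≥0∞, K ≠ ∞ ∧ ∀ B ⊆ N ∩ hyperplane m n,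
      hsVol _ (dimLU m n) (tube univ univ B) ≤ K * μHE[m * n - 1] B := by
  obtain ⟨N, hN, K, h⟩ := exists_hsVol_image_le (hasStrictFDerivAt_locMap hm hn lam₀)
    (dimLU_eq_card hm hn)
  obtain ⟨r, hr, N', hN', h'⟩ := exists_blocks_subset hm hn hN lam₀
  obtain ⟨F, hF⟩ := exists_finite_translates (k := m) hr
  obtain ⟨F', hF'⟩ := exists_finite_translates (k := n) hr
  refine ⟨N', hN', (F.card * F'.card) * (K *
    (volume (Metric.closedBall (0 : EuclideanSpace ℝ (Off m)) r) *
      volume (Metric.closedBall (0 : EuclideanSpace ℝ (Off n)) r))), ?_, fun B hB => ?_⟩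
  · have h1 := (measure_closedBall_lt_top (μ := volume) (x := (0 : EuclideanSpace ℝ (Off m)))
      (r := r)).ne
    have h2 := (measure_closedBall_lt_top (μ := volume) (x := (0 : EuclideanSpace ℝ (Off n)))
      (r := r)).ne
    finiteness
  · have hcell : hsVol _ (dimLU m n) (tube (cell m r) (cell n r) B) ≤ K *
        (volume (Metric.closedBall (0 : EuclideanSpace ℝ (Off m)) r) *
        (volume (Metric.closedBall (0 : EuclideanSpace ℝ (Off n)) r) * μHE[m * n - 1] B)) := by
      rw [tube_cell hm hn h₀ (hB.trans inter_subset_right),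
        ← volume_tube_blocks hm hn h₀ (hB.trans inter_subset_right)]
      exact h _ (h' r le_rfl B (hB.trans inter_subset_left))
    have hcov : tube univ univ B ⊆ ⋃ w ∈ F, ⋃ w' ∈ F',
        conjBy w w' '' tube (cell m r) (cell n r) B := by
      intro ρ hρ
      obtain ⟨u, -, v, -, lam, hl, rfl⟩ := mem_tube.mp hρ
      obtain ⟨w, hw, c, hc, rfl⟩ := hF u
      obtain ⟨w', hw', c', hc', rfl⟩ := hF' v
      rw [← conjBy_localConj]
      exact mem_biUnion hw (mem_biUnion hw' ⟨_, mem_tube.mpr ⟨c, hc, c', hc', lam, hl, rfl⟩, rfl⟩)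
    calc hsVol _ (dimLU m n) (tube univ univ B)
        ≤ _ := measure_mono hcov
      _ ≤ ∑ w ∈ F, ∑ w' ∈ F', hsVol _ (dimLU m n) (conjBy w w' '' tube (cell m r) (cell n r) B) :=
        (measure_biUnion_finset_le _ _).trans (Finset.sum_le_sum fun w _ =>
          measure_biUnion_finset_le _ _)
      _ ≤ _ := by
        simp only [hsVol_conjBy, Finset.sum_const, nsmul_eq_mul]
        refine (mul_le_mul_right (mul_le_mul_right hcell _) _).trans (le_of_eq ?_)
        ring

end LocDiag

namespace LocDiag

open scoped NNReal Topology
open Set Module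

variable {m n : ℕ}

/-! ### Lebesgue measure on the simplex -/

lemma measurableSet_simplex : MeasurableSet (simplex m n) :=
  isCompact_simplex.isClosed.measurableSet

lemma exists_mem_simplex (hm : 1 ≤ m) (hn : 1 ≤ n) :
    ∃ lam₀ : Table m n, ∃ ε > 0, lam₀ ∈ hyperplane m n ∧ ∀ p, lam₀ p = ε := by
  have h : (0 : ℝ) < (m : ℝ) * n := by
    have h1 : (0 : ℝ) < m := by exact_mod_cast hm
    have h2 : (0 : ℝ) < n := by exact_mod_cast hn
    positivity
  refine ⟨WithLp.toLp 2 fun _ => ((m : ℝ) * n)⁻¹, ((m : ℝ) * n)⁻¹, by positivity, ?_, fun _ => rfl⟩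
  show ∑ _, ((m : ℝ) * n)⁻¹ = 1
  rw [Finset.sum_const, Finset.card_univ, Fintype.card_prod, Fintype.card_fin, Fintype.card_fin,
    nsmul_eq_mul, Nat.cast_mul, mul_inv_cancel₀ h.ne']

lemma volume_simplex_lt_top (hm : 1 ≤ m) (hn : 1 ≤ n) :
    (μHE[m * n - 1] : Measure (Table m n)) (simplex m n) < ∞ := by
  obtain ⟨lam₀, -, -, h₀, -⟩ := exists_mem_simplex hm hn
  rw [volume_hyperplane hm hn h₀ simplex_subset_hyperplane]
  obtain ⟨R, hR⟩ := (isCompact_simplex (m := m) (n := n)).isBounded.subset_closedBall lam₀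
  refine lt_of_le_of_lt (measure_mono fun x hx => ?_)
    (measure_closedBall_lt_top (x := (0 : EuclideanSpace ℝ (Fin (m * n - 1)))) (r := R))
  have := hR hx
  rwa [mem_closedBall_iff_norm, add_sub_cancel_left, LinearIsometry.norm_map,
    ← mem_closedBall_zero_iff] at this

/-- Within the hyperplane, the ball about the barycentre with radius its common entry lies in the
simplex. -/
lemma volume_simplex_ne_zero (hm : 1 ≤ m) (hn : 1 ≤ n) :
    (μHE[m * n - 1] : Measure (Table m n)) (simplex m n) ≠ 0 := by
  obtain ⟨lam₀, ε, hε, h₀, he⟩ := exists_mem_simplex hm hn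
  rw [volume_hyperplane hm hn h₀ simplex_subset_hyperplane]
  refine ((Metric.measure_closedBall_pos volume (0 : EuclideanSpace ℝ (Fin (m * n - 1)))
    hε).trans_le (measure_mono fun x hx => ?_)).ne'
  refine ⟨fun p => ?_, add_sumZero_mem hm hn h₀ x⟩
  have h1 : ‖sumZero hm hn x p‖ ≤ ‖sumZero hm hn x‖ := PiLp.norm_apply_le _ _
  rw [LinearIsometry.norm_map] at h1
  have h2 := neg_abs_le (sumZero hm hn x p)
  rw [mem_closedBall_zero_iff] at hx
  rw [Real.norm_eq_abs] at h1
  rw [PiLp.add_apply, he]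
  linarith

lemma isFiniteMeasure_simplexVol (hm : 1 ≤ m) (hn : 1 ≤ n) : IsFiniteMeasure (simplexVol m n) :=
  ⟨by rw [simplexVol, Measure.restrict_apply_univ]; exact volume_simplex_lt_top hm hn⟩

lemma ae_mem_simplex : ∀ᵐ lam ∂simplexVol m n, lam ∈ simplex m n :=
  ae_restrict_mem measurableSet_simplex

lemma ae_mem_genericTables (hm : 1 ≤ m) (hn : 1 ≤ n) :
    ∀ᵐ lam ∂simplexVol m n, lam ∈ genericTables m n := by
  rw [simplexVol, ae_restrict_iff' measurableSet_simplex, ae_iff]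
  refine measure_mono_null (fun lam h => ?_) (volume_nonGeneric hm hn)
  simp only [mem_ofPred_eq, Classical.not_imp] at h
  exact ⟨simplex_subset_hyperplane h.1, h.2⟩

lemma densityMeasure_absolutelyContinuous : densityMeasure m n ≪ simplexVol m n :=
  withDensity_absolutelyContinuous _ _

lemma measurable_ofReal_J : Measurable fun lam : Table m n => ENNReal.ofReal (J lam) :=
  continuous_J.measurable.ennreal_ofReal

lemma densityMeasure_univ_ne_zero (hm : 1 ≤ m) (hn : 1 ≤ n) : densityMeasure m n univ ≠ 0 := by
  intro h
  rw [densityMeasure, withDensity_apply _ MeasurableSet.univ, Measure.restrict_univ,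
    lintegral_eq_zero_iff measurable_ofReal_J] at h
  have hf : ∀ᵐ _ ∂simplexVol m n, False := by
    filter_upwards [h, ae_mem_genericTables hm hn] with lam h1 h2
    exact (ENNReal.ofReal_pos.mpr (J_pos hm hn h2.1)).ne' h1
  have h0 : simplexVol m n univ = 0 := by simpa [ae_iff] using hf
  rw [simplexVol, Measure.restrict_apply_univ] at h0
  exact volume_simplex_ne_zero hm hn h0

lemma isFiniteMeasure_densityMeasure (hm : 1 ≤ m) (hn : 1 ≤ n) :
    IsFiniteMeasure (densityMeasure m n) := by
  obtain ⟨M, hM⟩ := isCompact_simplex.exists_bound_of_continuousOn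
    (continuous_J (m := m) (n := n)).continuousOn
  have := isFiniteMeasure_simplexVol hm hn
  refine isFiniteMeasure_withDensity (ne_of_lt ?_)
  calc ∫⁻ lam, ENNReal.ofReal (J lam) ∂simplexVol m n
      ≤ ∫⁻ _, ENNReal.ofReal M ∂simplexVol m n := lintegral_mono_ae (by
        filter_upwards [ae_mem_simplex] with lam hl
        exact ENNReal.ofReal_le_ofReal ((le_abs_self _).trans (hM lam hl)))
    _ < ∞ := by
      rw [lintegral_const]
      finiteness

lemma densityMeasure_apply {B : Set (Table m n)} (hB : MeasurableSet B) (hs : B ⊆ simplex m n) :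
    densityMeasure m n B = ∫⁻ lam in B, ENNReal.ofReal (J lam) ∂μHE[m * n - 1] := by
  rw [densityMeasure, withDensity_apply _ hB, simplexVol, Measure.restrict_restrict hB,
    inter_eq_self_of_subset_left hs]

/-- Where entries are distinct `J` is positive, so by continuity its ratio to `J lam₀` is close to 1
nearby. -/
lemma exists_densityMeasure_near (hm : 1 ≤ m) (hn : 1 ≤ n) {lam₀ : Table m n}
    (hd : HasDistinctEntries lam₀) {K : ℝ≥0} (hK : 1 < K) :
    ∃ N ∈ 𝓝 lam₀, ∀ B ⊆ N ∩ simplex m n, MeasurableSet B →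
      Near K (densityMeasure m n B) (ENNReal.ofReal (J lam₀) * μHE[m * n - 1] B) := by
  have hJ := J_pos hm hn hd
  have hK' : (1 : ℝ) < K := by exact_mod_cast hK
  have h1 : ∀ᶠ lam in 𝓝 lam₀, J lam < K * J lam₀ :=
    continuous_J.continuousAt.eventually_lt_const (by nlinarith)
  have h2 : ∀ᶠ lam in 𝓝 lam₀, J lam₀ < K * J lam :=
    (continuous_const.mul continuous_J).continuousAt.eventually_const_lt
      (by show J lam₀ < K * J lam₀; nlinarith)
  refine ⟨_, h1.and h2, fun B hB hBm => ?_⟩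
  rw [densityMeasure_apply hBm (hB.trans inter_subset_right)]
  have hc : ∀ r : ℝ, ENNReal.ofReal (K * r) = K * ENNReal.ofReal r := fun r => by
    rw [ENNReal.ofReal_mul (by positivity), ENNReal.ofReal_coe_nnreal]
  constructor
  · calc ∫⁻ lam in B, ENNReal.ofReal (J lam) ∂μHE[m * n - 1]
        ≤ ∫⁻ _ in B, ENNReal.ofReal (K * J lam₀) ∂μHE[m * n - 1] :=
          setLIntegral_mono' hBm fun lam hl => ENNReal.ofReal_le_ofReal (hB hl).1.1.le
      _ = _ := by rw [setLIntegral_const, hc, mul_assoc]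
  · calc ENNReal.ofReal (J lam₀) * μHE[m * n - 1] B
        = ∫⁻ _ in B, ENNReal.ofReal (J lam₀) ∂μHE[m * n - 1] := by rw [setLIntegral_const]
      _ ≤ ∫⁻ lam in B, K * ENNReal.ofReal (J lam) ∂μHE[m * n - 1] :=
          setLIntegral_mono' hBm fun lam hl => by
            rw [← hc]
            exact ENNReal.ofReal_le_ofReal (hB hl).1.2.le
      _ = _ := lintegral_const_mul _ measurable_ofReal_J

/-- Relabellings are isometries that preserve both the simplex and `J`. -/
lemma measurePreserving_relabel (g : Relabelling m n) :
    MeasurePreserving (relabel g) (densityMeasure m n) (densityMeasure m n) := by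
  have h : MeasurePreserving (relabel g) (μHE[m * n - 1] : Measure (Table m n)) μHE[m * n - 1] :=
    (relabel g).toIsometryEquiv.measurePreserving_euclideanHausdorffMeasure _
  refine ⟨h.measurable, Measure.ext fun B hB => ?_⟩
  rw [Measure.map_apply h.measurable hB, densityMeasure, withDensity_apply _ hB,
    withDensity_apply _ (h.measurable hB), simplexVol, Measure.restrict_restrict hB,
    Measure.restrict_restrict (h.measurable hB), ← lintegral_indicator (hB.inter measurableSet_simplex),
    ← lintegral_indicator ((h.measurable hB).inter measurableSet_simplex),
    ← h.lintegral_comp (measurable_ofReal_J.indicator (hB.inter measurableSet_simplex))]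
  refine lintegral_congr fun lam => ?_
  have hs : relabel g lam ∈ simplex m n ↔ lam ∈ simplex m n :=
    ⟨fun hl => by
      have := relabel_mem_simplex hl g⁻¹
      rwa [relabel_relabel, mul_inv_cancel, relabel_one] at this, fun hl => relabel_mem_simplex hl g⟩
  by_cases hl : relabel g lam ∈ B ∩ simplex m n
  · rw [indicator_of_mem hl, indicator_of_mem (show lam ∈ relabel g ⁻¹' B ∩ simplex m n from
      ⟨hl.1, hs.mp hl.2⟩), J_relabel]
  · rw [indicator_of_notMem hl, indicator_of_notMem fun h => hl ⟨h.1, hs.mpr h.2⟩]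

/-! ### The fundamental domain in the simplex -/

/-- The part of the fundamental domain in the simplex. -/
def fundSimplex (m n : ℕ) : Set (Table m n) := fundDomain m n ∩ simplex m n

lemma isLocallyClosed_fundSimplex : IsLocallyClosed (fundSimplex m n) :=
  isOpen_fundDomain.isLocallyClosed.inter isCompact_simplex.isClosed.isLocallyClosed

lemma measurableSet_fundSimplex : MeasurableSet (fundSimplex m n) :=
  isOpen_fundDomain.measurableSet.inter measurableSet_simplex

/-- The measure `J(λ) dλ` is the sum of the relabellings of its restriction to the fundamental
domain. -/
lemma densityMeasure_eq_sum (hm : 1 ≤ m) (hn : 1 ≤ n) :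
    densityMeasure m n = ∑ g : Relabelling m n,
      ((densityMeasure m n).restrict (fundSimplex m n)).map (relabel g) := by
  classical
  refine Measure.ext fun A hA => ?_
  have hmeas := fun g : Relabelling m n => (relabel g).continuous.measurable
  have hS : ∀ g : Relabelling m n, MeasurableSet (relabel g ⁻¹' fundSimplex m n) :=
    fun g => hmeas g measurableSet_fundSimplex
  have hcov : A =ᵐ[densityMeasure m n] ⋃ g : Relabelling m n, A ∩ relabel g ⁻¹' fundSimplex m n := by
    filter_upwards [densityMeasure_absolutelyContinuous (ae_mem_genericTables hm hn),
      densityMeasure_absolutelyContinuous ae_mem_simplex] with lam h1 h2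
    refine propext ⟨fun h => ?_, fun h => ?_⟩
    · obtain ⟨g, hg⟩ := exists_relabel_mem_fundDomain h1
      exact mem_iUnion.mpr ⟨g, h, hg, relabel_mem_simplex h2 g⟩
    · obtain ⟨g, hg⟩ := mem_iUnion.mp h
      exact hg.1
  have hdisj : Pairwise (Function.onFun Disjoint fun g : Relabelling m n =>
      A ∩ relabel g ⁻¹' fundSimplex m n) := fun g h hgh => disjoint_left.mpr fun lam h1 h2 => hgh (by
    have h3 : relabel (g⁻¹ * h) (relabel g lam) ∈ fundDomain m n := by
      rw [relabel_relabel, mul_inv_cancel_left]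
      exact h2.2.1
    exact (inv_mul_eq_one.mp (eq_one_of_relabel_mem_fundDomain h1.2.1 h3)))
  rw [measure_congr hcov, measure_iUnion hdisj fun g => hA.inter (hS g), tsum_fintype,
    Measure.finsetSum_apply]
  -- The piece of `A` that `relabel g` carries into the fundamental domain is the summand of the
  -- inverse relabelling, whence the reindexing.
  refine Fintype.sum_equiv (Equiv.inv _) _ _ fun g => ?_
  rw [Equiv.inv_apply, Measure.map_apply (hmeas _) hA, Measure.restrict_apply (hmeas _ hA),
    ← (measurePreserving_relabel g).measure_preimage
      ((hmeas _ hA).inter measurableSet_fundSimplex).nullMeasurableSet]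
  congr 1
  ext lam
  simp only [mem_inter_iff, mem_preimage, relabel_relabel, mul_inv_cancel, relabel_one]

end LocDiag

namespace LocDiag

open scoped NNReal Topology
open Set Module

variable {m n : ℕ}

/-! ### The volume measure on the locally diagonalizable states -/

lemma tube_mono {A A₁ : Set (U m)} {A' A₁' : Set (U n)} {B B₁ : Set (Table m n)} (h : A ⊆ A₁)
    (h' : A' ⊆ A₁') (hB : B ⊆ B₁) : tube A A' B ⊆ tube A₁ A₁' B₁ :=
  image_mono (prod_mono h (prod_mono h' hB))

lemma isCompact_tube {A : Set (U m)} {A' : Set (U n)} {B : Set (Table m n)} (h : IsCompact A)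
    (h' : IsCompact A') (hB : IsCompact B) : IsCompact (tube A A' B) :=
  (h.prod (h'.prod hB)).image continuous_localConj

lemma DLU_eq_tube : DLU m n = tube univ univ (simplex m n) := DLU_eq_image

lemma measurableSet_DLU : MeasurableSet (DLU m n) := by
  rw [DLU_eq_tube]
  exact (isCompact_tube isCompact_univ isCompact_univ isCompact_simplex).isClosed.measurableSet

lemma volLU_apply (S : Set (BiMat m n)) :
    volLU m n S = hsVol _ (dimLU m n) (S ∩ DLU m n) :=
  Measure.restrict_apply' measurableSet_DLU

lemma volLU_tube (A : Set (U m)) (A' : Set (U n)) {B : Set (Table m n)} (hB : B ⊆ simplex m n) :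
    volLU m n (tube A A' B) = hsVol _ (dimLU m n) (tube A A' B) := by
  rw [volLU_apply, inter_eq_self_of_subset_left]
  rw [DLU_eq_tube]
  exact tube_mono (subset_univ _) (subset_univ _) hB

/-- A locally closed set of tables is σ-compact, so its tube is a countable union of compact images.
-/
lemma measurableSet_tube_univ {B : Set (Table m n)} (hB : IsLocallyClosed B) :
    MeasurableSet (tube (univ : Set (U m)) (univ : Set (U n)) B) := by
  have := hB.locallyCompactSpace
  obtain ⟨K, hK, rfl⟩ := isSigmaCompact_iff_sigmaCompactSpace.mpr
    (inferInstance : SigmaCompactSpace B)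
  have : tube (univ : Set (U m)) (univ : Set (U n)) (⋃ i, K i) = ⋃ i, tube univ univ (K i) := by
    simp only [tube, prod_iUnion, image_iUnion]
  rw [this]
  exact MeasurableSet.iUnion fun i =>
    (isCompact_tube isCompact_univ isCompact_univ (hK i)).isClosed.measurableSet

/-- The local volume bound makes small pieces null, and countably many neighbourhoods cover `B`. -/
lemma hsVol_tube_univ_eq_zero (hm : 1 ≤ m) (hn : 1 ≤ n) {B : Set (Table m n)}
    (hB : B ⊆ hyperplane m n) (h0 : μHE[m * n - 1] B = 0) :
    hsVol _ (dimLU m n) (tube (univ : Set (U m)) (univ : Set (U n)) B) = 0 := by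
  have key : ∀ lam : Table m n, ∃ N, lam ∈ B → N ∈ 𝓝[B] lam ∧
      hsVol _ (dimLU m n) (tube (univ : Set (U m)) (univ : Set (U n)) (N ∩ B)) = 0 := fun lam => by
    by_cases hl : lam ∈ B
    · obtain ⟨N, hN, K, -, h⟩ := exists_tube_univ_le hm hn (hB hl)
      refine ⟨N, fun _ => ⟨mem_nhdsWithin_of_mem_nhds hN, nonpos_iff_eq_zero.mp ?_⟩⟩
      refine (h _ (inter_subset_inter_right _ hB)).trans (le_of_eq ?_)
      rw [measure_mono_null inter_subset_right h0, mul_zero]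
    · exact ⟨univ, fun h => absurd h hl⟩
  choose N hN using key
  obtain ⟨t, htB, ht, hcov⟩ := TopologicalSpace.countable_cover_nhdsWithin fun lam h => (hN lam h).1
  refine measure_mono_null (t := ⋃ lam ∈ t, tube univ univ (N lam ∩ B)) ?_
    ((measure_biUnion_null_iff ht).mpr fun lam hl => (hN lam (htB hl)).2)
  intro ρ hρ
  obtain ⟨u, hu, v, hv, lam, hl, rfl⟩ := mem_tube.mp hρ
  obtain ⟨lam₁, h₁, h₂⟩ := mem_iUnion₂.mp (hcov hl)
  exact mem_biUnion h₁ (mem_tube.mpr ⟨u, hu, v, hv, lam, ⟨h₂, hl⟩, rfl⟩)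

lemma isFiniteMeasure_volLU (hm : 1 ≤ m) (hn : 1 ≤ n) : IsFiniteMeasure (volLU m n) := by
  refine ⟨?_⟩
  rw [volLU_apply, univ_inter, DLU_eq_tube]
  refine isCompact_simplex.induction_on (p := fun B => hsVol _ (dimLU m n)
    (tube (univ : Set (U m)) (univ : Set (U n)) B) < ∞) ?_ ?_ ?_ ?_
  · simp [tube]
  · exact fun s t hst ht => (measure_mono (tube_mono subset_rfl subset_rfl hst)).trans_lt ht
  · intro s t hs ht
    have : tube (univ : Set (U m)) (univ : Set (U n)) (s ∪ t) =
        tube univ univ s ∪ tube univ univ t := by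
      simp only [tube, prod_union, image_union]
    rw [this]
    exact (measure_union_le _ _).trans_lt (ENNReal.add_lt_top.mpr ⟨hs, ht⟩)
  · intro lam hl
    obtain ⟨N, hN, K, hK, h⟩ := exists_tube_univ_le hm hn (simplex_subset_hyperplane hl)
    refine ⟨N ∩ simplex m n, Filter.inter_mem (mem_nhdsWithin_of_mem_nhds hN) self_mem_nhdsWithin,
      (h _ (inter_subset_inter_right _ simplex_subset_hyperplane)).trans_lt ?_⟩
    have := (measure_mono (inter_subset_right (s := N))).trans_lt (volume_simplex_lt_top hm hn)
    exact ENNReal.mul_lt_top hK.lt_top this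

/-! ### Selecting the eigenvalue table in the fundamental domain -/

/-- The states with an eigenvalue table in the fundamental domain. -/
def regularStates (m n : ℕ) : Set (BiMat m n) := tube univ univ (fundSimplex m n)

lemma measurableSet_regularStates : MeasurableSet (regularStates m n) :=
  measurableSet_tube_univ isLocallyClosed_fundSimplex

/-- A generic table can be moved into the fundamental domain without changing the state; the states
of non-generic tables are null. -/
lemma ae_mem_regularStates (hm : 1 ≤ m) (hn : 1 ≤ n) : ∀ᵐ ρ ∂volLU m n, ρ ∈ regularStates m n := by
  rw [ae_iff, volLU_apply]
  refine measure_mono_null (t := tube univ univ (simplex m n \ genericTables m n)) ?_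
    (hsVol_tube_univ_eq_zero hm hn (sdiff_subset.trans simplex_subset_hyperplane)
      (measure_mono_null (sdiff_subset_sdiff_left simplex_subset_hyperplane) (volume_nonGeneric hm hn)))
  rintro ρ ⟨h1, h2⟩
  rw [DLU_eq_tube] at h2
  obtain ⟨u, hu, v, hv, lam, hl, rfl⟩ := mem_tube.mp h2
  refine mem_tube.mpr ⟨u, hu, v, hv, lam, ⟨hl, fun hg => h1 ?_⟩, rfl⟩
  obtain ⟨g, hg⟩ := exists_relabel_mem_fundDomain hg
  exact mem_tube.mpr ⟨_, mem_univ _, _, mem_univ _, _, ⟨hg, relabel_mem_simplex hl g⟩,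
    localConj_relabel u v g lam⟩

open Classical in
/-- The eigenvalue table in the fundamental domain. -/
noncomputable def sel (ρ : BiMat m n) : Table m n :=
  if h : ∃ lam ∈ fundSimplex m n, ∃ (u : U m) (v : U n), localConj u v lam = ρ then h.choose else 0

lemma sel_localConj (hm : 1 ≤ m) (hn : 1 ≤ n) {lam : Table m n} (h : lam ∈ fundSimplex m n)
    (u : U m) (v : U n) : sel (localConj u v lam) = lam := by
  have hex : ∃ lam' ∈ fundSimplex m n, ∃ (u' : U m) (v' : U n),
    localConj u' v' lam' = localConj u v lam := ⟨lam, h, u, v, rfl⟩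
  rw [sel, dif_pos hex]
  obtain ⟨h1, u', v', h2⟩ := hex.choose_spec
  exact (localConj_eq_iff_of_mem_fundDomain hm hn h.1 h1.1 h2.symm).1

lemma sel_of_notMem {ρ : BiMat m n} (h : ρ ∉ regularStates m n) : sel ρ = 0 := by
  rw [sel, dif_neg]
  rintro ⟨lam, hl, u, v, rfl⟩
  exact h (mem_tube.mpr ⟨u, mem_univ _, v, mem_univ _, lam, hl, rfl⟩)

lemma exists_localConj_sel (hm : 1 ≤ m) (hn : 1 ≤ n) {ρ : BiMat m n} (h : ρ ∈ regularStates m n) :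
    sel ρ ∈ fundSimplex m n ∧ ∃ (u : U m) (v : U n), localConj u v (sel ρ) = ρ := by
  obtain ⟨u, -, v, -, lam, hl, rfl⟩ := mem_tube.mp h
  rw [sel_localConj hm hn hl]
  exact ⟨hl, u, v, rfl⟩

lemma measurable_sel (hm : 1 ≤ m) (hn : 1 ≤ n) : Measurable (sel : BiMat m n → Table m n) := by
  classical
  refine measurable_of_isClosed fun T hT => ?_
  -- The second set accounts for the default value 0 of `sel` off the regular states.
  have : (sel : BiMat m n → Table m n) ⁻¹' T = tube univ univ (fundSimplex m n ∩ T) ∪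
      ((regularStates m n)ᶜ ∩ {_ρ | (0 : Table m n) ∈ T}) := by
    ext ρ
    by_cases h : ρ ∈ regularStates m n
    · have h' := mem_tube.mp h
      obtain ⟨u, -, v, -, lam, hl, rfl⟩ := h'
      simp only [mem_preimage, mem_union, mem_inter_iff, mem_compl_iff, h, not_true, false_and,
        or_false, sel_localConj hm hn hl]
      refine ⟨fun hT' => mem_tube.mpr ⟨u, mem_univ _, v, mem_univ _, lam, ⟨hl, hT'⟩, rfl⟩,
        fun ht => ?_⟩
      obtain ⟨u', -, v', -, lam', hl', he⟩ := mem_tube.mp ht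
      rw [← sel_localConj hm hn hl u v, ← he, sel_localConj hm hn hl'.1]
      exact hl'.2
    · have h2 : ρ ∉ tube univ univ (fundSimplex m n ∩ T) := fun h' =>
        h (tube_mono subset_rfl subset_rfl inter_subset_left h')
      simp only [mem_preimage, mem_union, mem_inter_iff, mem_compl_iff, h, not_false_iff, true_and,
        h2, false_or, sel_of_notMem h, mem_ofPred_eq]
  rw [this]
  exact (measurableSet_tube_univ (isLocallyClosed_fundSimplex.inter hT.isLocallyClosed)).union
    (measurableSet_regularStates.compl.inter (MeasurableSet.const _))

/-- The distribution of the eigenvalue table in the fundamental domain. -/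
noncomputable def selMeasure (m n : ℕ) : Measure (Table m n) := (volLU m n).map sel

lemma isFiniteMeasure_selMeasure (hm : 1 ≤ m) (hn : 1 ≤ n) : IsFiniteMeasure (selMeasure m n) := by
  have := isFiniteMeasure_volLU hm hn
  unfold selMeasure
  infer_instance

lemma ae_selMeasure_mem (hm : 1 ≤ m) (hn : 1 ≤ n) :
    ∀ᵐ lam ∂selMeasure m n, lam ∈ fundSimplex m n := by
  refine (ae_map_iff (p := (· ∈ fundSimplex m n)) (measurable_sel hm hn).aemeasurable
    measurableSet_fundSimplex).mpr ?_
  filter_upwards [ae_mem_regularStates hm hn] with ρ hρ using (exists_localConj_sel hm hn hρ).1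

/-! ### Invariance and averaging -/

lemma measurable_conjBy (u : U m) (v : U n) : Measurable (conjBy u v) :=
  (continuous_conjBy u v).measurable

lemma conjBy_inv_conjBy (u : U m) (v : U n) (ρ : BiMat m n) : conjBy u v (conjBy u⁻¹ v⁻¹ ρ) = ρ := by
  have h : conjBy u v (conjBy u⁻¹ v⁻¹ ρ) = conjBy (u * u⁻¹) (v * v⁻¹) ρ := by
    simp only [conjBy, Submonoid.coe_mul, Matrix.mul_kronecker_mul, Matrix.conjTranspose_mul,
      Matrix.mul_assoc]
  rw [h, mul_inv_cancel, mul_inv_cancel]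
  simp [conjBy]

lemma volLU_preimage_conjBy (u : U m) (v : U n) (S : Set (BiMat m n)) :
    volLU m n (conjBy u v ⁻¹' S) = volLU m n S := by
  rw [volLU_apply, volLU_apply, ← hsVol_conjBy u v]
  congr 1
  ext ρ
  constructor
  · rintro ⟨ρ', ⟨h1, h2⟩, rfl⟩
    exact ⟨h1, conjBy_mem_DLU h2 u v⟩
  · rintro ⟨h1, h2⟩
    refine ⟨conjBy u⁻¹ v⁻¹ ρ, ⟨?_, conjBy_mem_DLU h2 _ _⟩, conjBy_inv_conjBy u v ρ⟩
    rwa [mem_preimage, conjBy_inv_conjBy]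

lemma lintegral_rotate {X Y Z : Type*} [MeasurableSpace X] [MeasurableSpace Y] [MeasurableSpace Z]
    {μ : Measure X} {ν : Measure Y} {τ : Measure Z} [SFinite μ] [SFinite ν] [SFinite τ]
    {f : X → Y → Z → ℝ≥0∞} (hf : Measurable fun x : X × Y × Z => f x.1 x.2.1 x.2.2) :
    ∫⁻ x, ∫⁻ y, ∫⁻ z, f x y z ∂τ ∂ν ∂μ = ∫⁻ z, ∫⁻ x, ∫⁻ y, f x y z ∂ν ∂μ ∂τ := by
  have h1 : ∀ x, ∫⁻ y, ∫⁻ z, f x y z ∂τ ∂ν = ∫⁻ z, ∫⁻ y, f x y z ∂ν ∂τ := fun x =>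
    lintegral_lintegral_swap (Measurable.aemeasurable (hf.comp measurable_prodMk_left))
  simp only [h1]
  refine lintegral_lintegral_swap (Measurable.aemeasurable ?_)
  have : Measurable fun p : (X × Z) × Y => f p.1.1 p.2 p.1.2 :=
    hf.comp (by fun_prop : Measurable fun p : (X × Z) × Y => (p.1.1, p.2, p.1.2))
  exact this.lintegral_prod_right'

lemma measurable_localConj :
    Measurable fun x : U m × U n × Table m n => localConj x.1 x.2.1 x.2.2 :=
  continuous_localConj.measurable

lemma measurable_rotate : Measurable fun x : (Table m n × U m) × U n =>
    ((x.1.2, x.2, x.1.1) : U m × U n × Table m n) := by fun_prop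

lemma measurable_localConj_rotate :
    Measurable fun x : (Table m n × U m) × U n => localConj x.1.2 x.2 x.1.1 := by
  have h : Measurable ((fun x : U m × U n × Table m n => localConj x.1 x.2.1 x.2.2) ∘
    fun x : (Table m n × U m) × U n => ((x.1.2, x.2, x.1.1) : U m × U n × Table m n)) :=
    measurable_localConj.comp measurable_rotate
  exact h

lemma map_localConj_apply (ν : Measure (Table m n)) [SFinite ν] {S : Set (BiMat m n)}
    (hS : MeasurableSet S) :
    Measure.map (fun x : U m × U n × Table m n => localConj x.1 x.2.1 x.2.2)
      ((haarU m).prod ((haarU n).prod ν)) S =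
    ∫⁻ lam, ∫⁻ u, ∫⁻ v, S.indicator 1 (localConj u v lam) ∂haarU n ∂haarU m ∂ν := by
  have hc := continuous_localConj (m := m) (n := n)
  have hf : Measurable fun x : U m × U n × Table m n =>
      S.indicator (1 : BiMat m n → ℝ≥0∞) (localConj x.1 x.2.1 x.2.2) :=
    (measurable_one.indicator hS).comp hc.measurable
  rw [Measure.map_apply hc.measurable hS, ← lintegral_rotate hf,
    ← lintegral_indicator_one (hc.measurable hS), lintegral_prod _
      (measurable_one.indicator (hc.measurable hS)).aemeasurable]
  refine lintegral_congr fun u => ?_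
  rw [lintegral_prod]
  · rfl
  · exact (Measurable.aemeasurable (hf.comp measurable_prodMk_left))

lemma lintegral_localConj_mul (u₀ : U m) (v₀ : U n) (lam : Table m n) (f : BiMat m n → ℝ≥0∞) :
    ∫⁻ u, ∫⁻ v, f (localConj (u * u₀) (v * v₀) lam) ∂haarU n ∂haarU m =
      ∫⁻ u, ∫⁻ v, f (localConj u v lam) ∂haarU n ∂haarU m := by
  have h1 : ∀ u, ∫⁻ v, f (localConj u (v * v₀) lam) ∂haarU n = ∫⁻ v, f (localConj u v lam) ∂haarU n :=
    fun u => lintegral_mul_right_eq_self (fun v => f (localConj u v lam)) v₀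
  simp only [h1]
  exact lintegral_mul_right_eq_self (fun u => ∫⁻ v, f (localConj u v lam) ∂haarU n) u₀

lemma continuous_conjBy_prod :
    Continuous fun x : U m × U n × BiMat m n => conjBy x.1 x.2.1 x.2.2 := by
  have hk : Continuous fun x : U m × U n × BiMat m n => x.1.1 ⊗ₖ x.2.1.1 :=
    continuous_matrix fun p q => ((continuous_entry p.1 q.1).comp (Y := U m) continuous_fst).mul
      ((continuous_entry p.2 q.2).comp (Y := U n)
        ((continuous_fst (X := U n)).comp (continuous_snd (X := U m))))
  exact (hk.matrix_mul ((continuous_snd (X := U n)).comp (continuous_snd (X := U m)))).matrix_mul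
    hk.matrix_conjTranspose

/-- The volume is invariant under local unitaries, so it equals its average over them. By Tonelli
this averages the orbit of each state ρ, and right invariance of Haar measure replaces ρ by the
diagonal matrix of `sel ρ`. -/
lemma volLU_eq_map (hm : 1 ≤ m) (hn : 1 ≤ n) :
    volLU m n = Measure.map (fun x : U m × U n × Table m n => localConj x.1 x.2.1 x.2.2)
      ((haarU m).prod ((haarU n).prod (selMeasure m n))) := by
  have := isFiniteMeasure_selMeasure hm hn
  have := isFiniteMeasure_volLU hm hn
  refine Measure.ext fun S hS => ?_
  have hmeas : Measurable fun x : U m × U n × BiMat m n =>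
      S.indicator (1 : BiMat m n → ℝ≥0∞) (conjBy x.1 x.2.1 x.2.2) :=
    (measurable_one.indicator hS).comp continuous_conjBy_prod.measurable
  have hmeas' : Measurable fun lam : Table m n => ∫⁻ u, ∫⁻ v,
      S.indicator (1 : BiMat m n → ℝ≥0∞) (localConj u v lam) ∂haarU n ∂haarU m := by
    have h : Measurable fun x : (Table m n × U m) × U n =>
        S.indicator (1 : BiMat m n → ℝ≥0∞) (localConj x.1.2 x.2 x.1.1) :=
      Measurable.comp (g := S.indicator (1 : BiMat m n → ℝ≥0∞)) 
        (measurable_one.indicator hS) measurable_localConj_rotate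
    exact h.lintegral_prod_right'.lintegral_prod_right'
  rw [map_localConj_apply _ hS, selMeasure, lintegral_map hmeas' (measurable_sel hm hn)]
  have h1 : ∀ᵐ ρ ∂volLU m n, ∫⁻ u, ∫⁻ v,
      S.indicator (1 : BiMat m n → ℝ≥0∞) (localConj u v (sel ρ)) ∂haarU n ∂haarU m =
      ∫⁻ u, ∫⁻ v, S.indicator (1 : BiMat m n → ℝ≥0∞) (conjBy u v ρ) ∂haarU n ∂haarU m := by
    filter_upwards [ae_mem_regularStates hm hn] with ρ hρ
    obtain ⟨-, u₀, v₀, he⟩ := exists_localConj_sel hm hn hρ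
    rw [← lintegral_localConj_mul u₀ v₀]
    simp only [← conjBy_localConj, he]
  rw [lintegral_congr_ae h1, ← lintegral_rotate hmeas]
  have h2 : ∀ (u : U m) (v : U n),
      ∫⁻ ρ, S.indicator (1 : BiMat m n → ℝ≥0∞) (conjBy u v ρ) ∂volLU m n = volLU m n S := fun u v => by
    rw [← volLU_preimage_conjBy u v S, ← lintegral_indicator_one (measurable_conjBy u v hS)]
    rfl
  simp only [h2, lintegral_const, measure_univ, mul_one]

end LocDiag

namespace LocDiag

open scoped NNReal Topology
open Set Module

variable {m n : ℕ}

/-! ### The density of the selected eigenvalue table -/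

lemma isCompact_cell (k : ℕ) (r : ℝ) : IsCompact (cell k r) := isCompact_cellU r

lemma mem_cell_of_inv_mul_mem {k : ℕ} {r : ℝ} {u u' : U k} (hu : u ∈ cell k r)
    (h : u⁻¹ * u' ∈ diagU k) : u' ∈ cell k r := by
  obtain ⟨x, hx, t, ht, rfl⟩ := mem_cellU.mp hu
  refine mem_cellU.mpr ⟨x, hx, t * ((uexp k x * t)⁻¹ * u'), mul_mem ht h, ?_⟩
  rw [← mul_assoc, mul_inv_cancel_left]

/-- Over the fundamental domain a state fixes its table, and the unitaries up to tori, under which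
cells are stable. Hence the preimage of the tube is almost everywhere a product; compactness of `B`
makes the tube measurable. -/
lemma volLU_tube_cell (hm : 1 ≤ m) (hn : 1 ≤ n) {B : Set (Table m n)} (hB : IsCompact B)
    (hBF : B ⊆ fundSimplex m n) (r : ℝ) : volLU m n (tube (cell m r) (cell n r) B) =
      haarU m (cell m r) * (haarU n (cell n r) * selMeasure m n B) := by
  have := isFiniteMeasure_selMeasure hm hn
  have hae : ∀ᵐ x ∂(haarU m).prod ((haarU n).prod (selMeasure m n)), x.2.2 ∈ fundSimplex m n :=
    Measure.quasiMeasurePreserving_snd.ae (Measure.quasiMeasurePreserving_snd.ae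
      (ae_selMeasure_mem hm hn))
  conv_lhs => rw [volLU_eq_map hm hn]
  rw [Measure.map_apply measurable_localConj
    (isCompact_tube (isCompact_cell m r) (isCompact_cell n r) hB).isClosed.measurableSet,
    ← Measure.prod_prod, ← Measure.prod_prod]
  refine measure_congr ?_
  filter_upwards [hae] with x hx
  refine propext ⟨fun h => ?_, fun h => ⟨x, h, rfl⟩⟩
  obtain ⟨u, hu, v, hv, lam, hl, he⟩ := mem_tube.mp h
  obtain ⟨h1, h2, h3⟩ := localConj_eq_iff_of_mem_fundDomain hm hn (hBF hl).1 hx.1 he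
  exact ⟨mem_cell_of_inv_mul_mem hu h2, mem_cell_of_inv_mul_mem hv h3, h1 ▸ hl⟩

lemma Near.of_mul_left {K : ℝ≥0} {a b c : ℝ≥0∞} (h : Near K (c * a) (c * b)) (h0 : c ≠ 0)
    (ht : c ≠ ∞) : Near K a b := by
  refine ⟨(ENNReal.mul_le_mul_iff_right h0 ht).mp (h.1.trans (le_of_eq ?_)),
    (ENNReal.mul_le_mul_iff_right h0 ht).mp (h.2.trans (le_of_eq ?_))⟩ <;> ring

lemma Near.of_isCompact {X : Type*} [TopologicalSpace X] [PolishSpace X] [MeasurableSpace X]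
    [BorelSpace X] {μ ν : Measure X} [IsFiniteMeasure μ] [IsFiniteMeasure ν] {K : ℝ≥0} {B : Set X}
    (h : ∀ A ⊆ B, IsCompact A → Near K (μ A) (ν A)) (hB : MeasurableSet B) : Near K (μ B) (ν B) := by
  constructor
  · rw [hB.measure_eq_iSup_isCompact_of_ne_top (measure_ne_top _ _)]
    refine iSup₂_le fun A hA => iSup_le fun hAc => (h A hA hAc).1.trans ?_
    gcongr
  · rw [hB.measure_eq_iSup_isCompact_of_ne_top (measure_ne_top _ _)]
    refine iSup₂_le fun A hA => iSup_le fun hAc => (h A hA hAc).2.trans ?_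
    gcongr

/-- The tube over small cells and `B` is measured by Haar measure and by the area formula.
Expressing the Haar measure of a cell through ball, torus and group volumes leaves the same ball
volumes on both sides. -/
lemma exists_selMeasure_near (hm : 1 ≤ m) (hn : 1 ≤ n) {lam₀ : Table m n}
    (h₀ : lam₀ ∈ fundSimplex m n) {K : ℝ≥0} (hK : 1 < K) :
    ∃ N ∈ 𝓝 lam₀, ∀ B ⊆ N ∩ fundSimplex m n, IsCompact B →
      Near K (uVol m m (diagU m) * uVol n n (diagU n) * selMeasure m n B)
        (uVol m (m ^ 2) univ * uVol n (n ^ 2) univ * densityMeasure m n B) := by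
  obtain ⟨L, hL, hLK⟩ := exists_one_lt_pow_le hK 4
  obtain ⟨r₁, hr₁, N₁, hN₁, h₁⟩ := exists_tube_near hm hn (simplex_subset_hyperplane h₀.2) h₀.1.1 hL
  obtain ⟨r₂, hr₂, h₂⟩ := exists_cellU_near (k := m) hL
  obtain ⟨r₃, hr₃, h₃⟩ := exists_cellU_near (k := n) hL
  obtain ⟨N₂, hN₂, h₄⟩ := exists_densityMeasure_near hm hn h₀.1.1 hL
  set r := min r₁ (min r₂ r₃)
  have hr : 0 < r := lt_min hr₁ (lt_min hr₂ hr₃)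
  refine ⟨N₁ ∩ N₂, Filter.inter_mem hN₁ hN₂, fun B hB hBc => ?_⟩
  have hBF : B ⊆ fundSimplex m n := hB.trans inter_subset_right
  have hBS : B ⊆ simplex m n := hBF.trans inter_subset_right
  have e1 := h₁ r (min_le_left _ _) B fun x hx => ⟨(hB hx).1.1, simplex_subset_hyperplane (hBS hx)⟩
  have e2 := h₂ r ((min_le_right _ _).trans (min_le_left _ _))
  have e3 := h₃ r ((min_le_right _ _).trans (min_le_right _ _))
  have e4 := h₄ B (fun x hx => ⟨(hB hx).1.2, hBS hx⟩) hBc.measurableSet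
  rw [← volLU_tube _ _ hBS, volLU_tube_cell hm hn hBc hBF] at e1
  rw [uVol_eq_smul_haarU, Measure.smul_apply, smul_eq_mul] at e2 e3
  set b := volume (Metric.closedBall (0 : EuclideanSpace ℝ (Off m)) r) with hb
  set b' := volume (Metric.closedBall (0 : EuclideanSpace ℝ (Off n)) r) with hb'
  have hb0 : b ≠ 0 := (Metric.measure_closedBall_pos _ _ hr).ne'
  have hb0' : b' ≠ 0 := (Metric.measure_closedBall_pos _ _ hr).ne'
  have hbt : b ≠ ∞ := measure_closedBall_lt_top.ne
  have hbt' : b' ≠ ∞ := measure_closedBall_lt_top.ne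
  -- Restoring the ball volumes reduces the claim to a chain of four comparisons: two cells, the
  -- tube and the density. Each costs a factor L.
  refine Near.of_mul_left (c := b * b') ?_ (mul_ne_zero hb0 hb0') (ENNReal.mul_ne_top hbt hbt')
  have s1 := ((e2.mul e3).mul_right (selMeasure m n B)).symm
  have s2 := e1.mul_left (uVol m (m ^ 2) univ * uVol n (n ^ 2) univ)
  have s3 := (e4.mul_left (uVol m (m ^ 2) univ * uVol n (n ^ 2) univ * (b * b'))).symm
  have hc : cellU (Metric.closedBall 0 r) (diagU m : Set (U m)) = cell m r := rfl
  have hc' : cellU (Metric.closedBall 0 r) (diagU n : Set (U n)) = cell n r := rfl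
  rw [hc, hc'] at s1
  have s4 := s1.trans ((by convert s2 using 1; ring : Near L _ _).trans
    (by convert s3 using 1; ring : Near L _ _))
  convert s4.mono ((le_of_eq (by ring)).trans hLK) using 1 <;> ring

/-- The local comparison on compact sets extends to Borel sets by inner regularity and to all of `B`
by countable additivity; letting K tend to 1 gives equality. -/
lemma selMeasure_eq_of_subset (hm : 1 ≤ m) (hn : 1 ≤ n) {B : Set (Table m n)} (hB : MeasurableSet B)
    (hBF : B ⊆ fundSimplex m n) :
    uVol m m (diagU m) * uVol n n (diagU n) * selMeasure m n B =
      uVol m (m ^ 2) univ * uVol n (n ^ 2) univ * densityMeasure m n B := by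
  have := isFiniteMeasure_selMeasure hm hn
  have := isFiniteMeasure_densityMeasure hm hn
  have h1 : IsFiniteMeasure ((uVol m m (diagU m) * uVol n n (diagU n)) • selMeasure m n) :=
    Measure.smul_finite _ (ENNReal.mul_ne_top (uVol_diagU_ne_top m) (uVol_diagU_ne_top n))
  have h2 : IsFiniteMeasure
      ((uVol m (m ^ 2) univ * uVol n (n ^ 2) univ) • densityMeasure m n) :=
    Measure.smul_finite _ (ENNReal.mul_ne_top (measure_ne_top _ _) (measure_ne_top _ _))
  refine Near.eq_of_forall fun K hK => Near.of_local
    (μ := (uVol m m (diagU m) * uVol n n (diagU n)) • selMeasure m n)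
    (ν := (uVol m (m ^ 2) univ * uVol n (n ^ 2) univ) • densityMeasure m n)
    measurableSet_fundSimplex (fun lam hl => ?_) hB hBF
  obtain ⟨N, hN, h⟩ := exists_selMeasure_near hm hn hl hK
  exact ⟨N, hN, fun B hB hBm => Near.of_isCompact (fun A hA hAc => h A (hA.trans hB) hAc) hBm⟩

/-! ### The constant -/

/-- The power of two cancels the Hilbert–Schmidt volume of the unit cube of u(k). -/
lemma C_eq (m n : ℕ) : C m n =
    (uVol m (m ^ 2) univ / uVol m m (diagU m)) * (uVol n (n ^ 2) univ / uVol n n (diagU n)) := by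
  have h : ∀ k : ℕ, (2 : ℝ≥0∞) ^ k.choose 2 * (volU k / volT k) =
      uVol k (k ^ 2) univ / uVol k k (diagU k) := fun k => by
    rw [volU, volT, hsVol_unitCellU, hsVol_unitCellT, div_one, uVol_apply, uVol_apply,
      coe_image_univ, coe_image_diagU, ← mul_div_assoc,
      ENNReal.mul_div_cancel (by positivity) (by finiteness)]
  rw [C, pow_add, ← h, ← h]
  ring

lemma C_ne_zero (m n : ℕ) : C m n ≠ 0 := by
  rw [C_eq]
  exact mul_ne_zero (ENNReal.div_ne_zero.mpr ⟨uVol_univ_ne_zero m, uVol_diagU_ne_top m⟩)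
    (ENNReal.div_ne_zero.mpr ⟨uVol_univ_ne_zero n, uVol_diagU_ne_top n⟩)

lemma C_ne_top (m n : ℕ) : C m n ≠ ∞ := by
  rw [C_eq]
  exact ENNReal.mul_ne_top (ENNReal.div_ne_top (measure_ne_top _ _) (uVol_diagU_ne_zero m))
    (ENNReal.div_ne_top (measure_ne_top _ _) (uVol_diagU_ne_zero n))

lemma selMeasure_eq (hm : 1 ≤ m) (hn : 1 ≤ n) :
    selMeasure m n = C m n • (densityMeasure m n).restrict (fundSimplex m n) := by
  refine Measure.ext fun B hB => ?_
  have hBF := hB.inter (measurableSet_fundSimplex (m := m) (n := n))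
  have h1 : selMeasure m n B = selMeasure m n (B ∩ fundSimplex m n) := by
    refine measure_congr ?_
    filter_upwards [ae_selMeasure_mem hm hn] with lam hl
    exact propext ⟨fun h => ⟨h, hl⟩, fun h => h.1⟩
  have h2 := selMeasure_eq_of_subset hm hn hBF inter_subset_right
  have ht0 := uVol_diagU_ne_zero m
  have ht0' := uVol_diagU_ne_zero n
  have ht := uVol_diagU_ne_top m
  have ht' := uVol_diagU_ne_top n
  rw [Measure.smul_apply, Measure.restrict_apply hB, smul_eq_mul, h1, C_eq,
    ← ENNReal.mul_div_mul_comm (Or.inl ht0) (Or.inl ht), ← ENNReal.mul_div_right_comm, ← h2,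
    ENNReal.mul_div_right_comm, ENNReal.div_self (mul_ne_zero ht0 ht0') (ENNReal.mul_ne_top ht ht'),
    one_mul]

/-! ### Counting eigenvalue tables -/

lemma relabel_injective {lam : Table m n} (h : lam ∈ fundDomain m n) :
    Function.Injective fun g : Relabelling m n => relabel g lam := fun g k hgk => by
  have : relabel (g * k⁻¹) lam = lam := by
    have h1 : relabel k⁻¹ (relabel g lam) = relabel k⁻¹ (relabel k lam) := congrArg _ hgk
    rwa [relabel_relabel, relabel_relabel, mul_inv_cancel, relabel_one] at h1
  exact mul_inv_eq_one.mp (eq_one_of_relabel_mem_fundDomain h (by rwa [this]))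

lemma ncard_range_inter {ι X : Type*} [Fintype ι] {f : ι → X} (hf : Function.Injective f)
    (A : Set X) : ((range f ∩ A).ncard : ℝ≥0∞) = ∑ i, A.indicator 1 (f i) := by
  classical
  have : range f ∩ A = f '' {i | f i ∈ A} := by
    ext x
    constructor
    · rintro ⟨⟨i, rfl⟩, h⟩
      exact ⟨i, h, rfl⟩
    · rintro ⟨i, h, rfl⟩
      exact ⟨⟨i, rfl⟩, h⟩
  rw [this, ncard_image_of_injective _ hf, ncard_eq_toFinset_card']
  simp [indicator_apply]

lemma eigTables_of_mem_regularStates (hm : 1 ≤ m) (hn : 1 ≤ n) {ρ : BiMat m n}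
    (h : ρ ∈ regularStates m n) : eigTables ρ = range fun g => relabel g (sel ρ) := by
  obtain ⟨hl, u, v, he⟩ := exists_localConj_sel hm hn h
  conv_lhs => rw [← he]
  exact eigTables_localConj hm hn hl.1.1 u v

lemma ncard_eigTables (hm : 1 ≤ m) (hn : 1 ≤ n) {ρ : BiMat m n} (h : ρ ∈ regularStates m n) :
    (eigTables ρ).ncard = m.factorial * n.factorial := by
  rw [eigTables_of_mem_regularStates hm hn h, ← image_univ,
    ncard_image_of_injective _ (relabel_injective (exists_localConj_sel hm hn h).1.1), ncard_univ,
    Nat.card_eq_fintype_card, Fintype.card_prod, Fintype.card_perm, Fintype.card_perm,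
    Fintype.card_fin, Fintype.card_fin]

/-- The tables of a regular state form a free orbit of `sel ρ`, so counting those in `A` is a sum of
indicators over relabellings. Integration against the law of `sel` reassembles the density from its
relabelled copies. -/
lemma lintegral_ncard (hm : 1 ≤ m) (hn : 1 ≤ n) {A : Set (Table m n)} (hA : MeasurableSet A) :
    ∫⁻ ρ, ((eigTables ρ ∩ A).ncard : ℝ≥0∞) ∂volLU m n = C m n * densityMeasure m n A := by
  have h1 : ∀ᵐ ρ ∂volLU m n, ((eigTables ρ ∩ A).ncard : ℝ≥0∞) =
      ∑ g : Relabelling m n, A.indicator 1 (relabel g (sel ρ)) := by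
    filter_upwards [ae_mem_regularStates hm hn] with ρ hρ
    rw [eigTables_of_mem_regularStates hm hn hρ,
      ncard_range_inter (relabel_injective (exists_localConj_sel hm hn hρ).1.1)]
  have hmeas : ∀ g : Relabelling m n, Measurable (relabel g : Table m n → Table m n) := fun g =>
    (relabel g).continuous.measurable
  have hind : ∀ g : Relabelling m n, Measurable fun lam : Table m n =>
      A.indicator (1 : Table m n → ℝ≥0∞) (relabel g lam) := fun g =>
    (measurable_one.indicator hA).comp (hmeas g)
  rw [lintegral_congr_ae h1, ← lintegral_map (f := fun lam : Table m n =>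
    ∑ g : Relabelling m n, A.indicator (1 : Table m n → ℝ≥0∞) (relabel g lam))
    (Finset.measurable_fun_sum _ fun g _ => hind g) (measurable_sel hm hn)]
  show ∫⁻ lam, _ ∂selMeasure m n = _
  rw [lintegral_finsetSum _ fun g _ => hind g, selMeasure_eq hm hn]
  conv_rhs => rw [densityMeasure_eq_sum hm hn]
  rw [Measure.finsetSum_apply, Finset.mul_sum]
  refine Finset.sum_congr rfl fun g _ => ?_
  rw [lintegral_smul_measure, Measure.map_apply (hmeas g) hA, ← lintegral_indicator_one (hmeas g hA)]
  rfl

lemma factorial_mul_volLU (hm : 1 ≤ m) (hn : 1 ≤ n) :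
    ((m.factorial : ℝ≥0∞) * n.factorial) * volLU m n univ = C m n * densityMeasure m n univ := by
  rw [← lintegral_ncard hm hn MeasurableSet.univ, ← lintegral_const]
  refine lintegral_congr_ae ?_
  filter_upwards [ae_mem_regularStates hm hn] with ρ hρ
  rw [inter_univ, ncard_eigTables hm hn hρ, Nat.cast_mul]

lemma volLU_univ_ne_zero (hm : 1 ≤ m) (hn : 1 ≤ n) : volLU m n univ ≠ 0 := fun h => by
  have := factorial_mul_volLU hm hn
  rw [h, mul_zero, eq_comm, mul_eq_zero] at this
  exact this.elim (C_ne_zero m n) (densityMeasure_univ_ne_zero hm hn)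

lemma factorial_ne_zero (m n : ℕ) : (m.factorial : ℝ≥0∞) * n.factorial ≠ 0 := by
  rw [← Nat.cast_mul, Nat.cast_ne_zero]
  exact mul_ne_zero m.factorial_ne_zero n.factorial_ne_zero

lemma factorial_ne_top (m n : ℕ) : (m.factorial : ℝ≥0∞) * n.factorial ≠ ∞ :=
  ENNReal.mul_ne_top (ENNReal.natCast_ne_top _) (ENNReal.natCast_ne_top _)

/-! ### The joint law and the volume element -/

lemma eigenvalueProb_eq (hm : 1 ≤ m) (hn : 1 ≤ n) {A : Set (Table m n)} (hA : MeasurableSet A) :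
    eigenvalueProb m n A = densityMeasure m n A / densityMeasure m n univ := by
  have hf0 := factorial_ne_zero m n
  have hft := factorial_ne_top m n
  have h1 : ∫⁻ ρ, ((eigTables ρ ∩ A).ncard : ℝ≥0∞) / ((eigTables ρ).ncard : ℝ≥0∞) ∂volLU m n =
      C m n * densityMeasure m n A / ((m.factorial : ℝ≥0∞) * n.factorial) := by
    rw [← lintegral_ncard hm hn hA, div_eq_mul_inv,
      ← lintegral_mul_const' _ _ (ENNReal.inv_ne_top.mpr hf0)]
    refine lintegral_congr_ae ?_
    filter_upwards [ae_mem_regularStates hm hn] with ρ hρ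
    rw [ncard_eigTables hm hn hρ, Nat.cast_mul, div_eq_mul_inv]
  rw [eigenvalueProb, h1, div_eq_mul_inv, div_eq_mul_inv, mul_assoc,
    ← ENNReal.mul_inv (Or.inl hf0) (Or.inl hft), ← div_eq_mul_inv,
    factorial_mul_volLU hm hn, ENNReal.mul_div_mul_left _ _ (C_ne_zero m n) (C_ne_top m n)]

lemma volLU_eq_smul_map (hm : 1 ≤ m) (hn : 1 ≤ n) :
    volLU m n = (C m n / ((m.factorial : ℝ≥0∞) * (n.factorial : ℝ≥0∞))) •
      Measure.map (fun x : U m × U n × Table m n => localConj x.1 x.2.1 x.2.2)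
        ((haarU m).prod ((haarU n).prod (densityMeasure m n))) := by
  have := isFiniteMeasure_selMeasure hm hn
  have := isFiniteMeasure_densityMeasure hm hn
  have hf0 := factorial_ne_zero m n
  have hft := factorial_ne_top m n
  refine Measure.ext fun S hS => ?_
  set H : Table m n → ℝ≥0∞ := fun lam => ∫⁻ u, ∫⁻ v,
    S.indicator (1 : BiMat m n → ℝ≥0∞) (localConj u v lam) ∂haarU n ∂haarU m with hH
  have hHm : Measurable H := by
    have h : Measurable fun x : (Table m n × U m) × U n =>
        S.indicator (1 : BiMat m n → ℝ≥0∞) (localConj x.1.2 x.2 x.1.1) :=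
      Measurable.comp (g := S.indicator (1 : BiMat m n → ℝ≥0∞))
        (measurable_one.indicator hS) measurable_localConj_rotate
    exact h.lintegral_prod_right'.lintegral_prod_right'
  have hHg : ∀ (g : Relabelling m n) lam, H (relabel g lam) = H lam := fun g lam => by
    simp only [hH]
    rw [← lintegral_localConj_mul (permU g.1) (permU g.2)]
    simp only [localConj_relabel]
  -- The Haar average `H` is invariant under relabelling, so all m! n! copies of the fundamental
  -- domain contribute equally.
  have h1 : ∫⁻ lam, H lam ∂densityMeasure m n = ((m.factorial : ℝ≥0∞) * n.factorial) *
      ∫⁻ lam in fundSimplex m n, H lam ∂densityMeasure m n := by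
    conv_lhs => rw [densityMeasure_eq_sum hm hn]
    rw [lintegral_finsetSum_measure]
    simp only [lintegral_map hHm (relabel _).continuous.measurable, hHg]
    rw [Finset.sum_const, Finset.card_univ, Fintype.card_prod, Fintype.card_perm, Fintype.card_perm,
      Fintype.card_fin, Fintype.card_fin, nsmul_eq_mul, Nat.cast_mul]
  conv_lhs => rw [volLU_eq_map hm hn]
  rw [Measure.smul_apply, smul_eq_mul, map_localConj_apply _ hS, map_localConj_apply _ hS, h1,
    selMeasure_eq hm hn, lintegral_smul_measure, smul_eq_mul, ← mul_assoc,
    ENNReal.div_mul_cancel hf0 hft]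

end LocDiag

theorem mainTheorem5 (m n : ℕ) (hm : 1 ≤ m) (hn : 1 ≤ n) :
    -- the volumes and the normalisation are positive and finite
    (LocDiag.volLU m n Set.univ ≠ 0 ∧ LocDiag.volLU m n Set.univ ≠ ∞) ∧
    (LocDiag.densityMeasure m n Set.univ ≠ 0 ∧ LocDiag.densityMeasure m n Set.univ ≠ ∞) ∧
    (LocDiag.C m n ≠ 0 ∧ LocDiag.C m n ≠ ∞) ∧
    -- the joint probability density of the eigenvalues is proportional to `J`
    (∀ A : Set (LocDiag.Table m n), MeasurableSet A →
      LocDiag.eigenvalueProb m n A =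
        LocDiag.densityMeasure m n A / LocDiag.densityMeasure m n Set.univ) ∧
    -- the unnormalised eigenvalue density, all labelled eigenvalue tables counted, is `C_{m,n} J`
    (∀ A : Set (LocDiag.Table m n), MeasurableSet A →
      ∫⁻ ρ, ((LocDiag.eigTables ρ ∩ A).ncard : ℝ≥0∞) ∂(LocDiag.volLU m n) =
        LocDiag.C m n * LocDiag.densityMeasure m n A) ∧
    -- the volume element is `C_{m,n} J(λ) [dλ] dHaar(u) dHaar(v)`; each generic state
    -- is parametrised by exactly `m! n!` eigenvalue tables
    LocDiag.volLU m n =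
      (LocDiag.C m n / ((m.factorial : ℝ≥0∞) * (n.factorial : ℝ≥0∞))) •
        Measure.map
          (fun x : LocDiag.U m × LocDiag.U n × LocDiag.Table m n =>
            LocDiag.localConj x.1 x.2.1 x.2.2)
          ((LocDiag.haarU m).prod ((LocDiag.haarU n).prod (LocDiag.densityMeasure m n))) ∧
    -- the same constant in terms of the Riemannian volumes of the Hilbert–Schmidt metric
    LocDiag.C m n =
      (LocDiag.hsVol (Fin m) (m ^ 2) (LocDiag.unitarySet m) /
        LocDiag.hsVol (Fin m) m (LocDiag.torusSet m)) *
      (LocDiag.hsVol (Fin n) (n ^ 2) (LocDiag.unitarySet n) /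
        LocDiag.hsVol (Fin n) n (LocDiag.torusSet n)) := by
  have h1 := LocDiag.isFiniteMeasure_volLU hm hn
  have h2 := LocDiag.isFiniteMeasure_densityMeasure hm hn
  refine ⟨⟨LocDiag.volLU_univ_ne_zero hm hn, measure_ne_top _ _⟩,
    ⟨LocDiag.densityMeasure_univ_ne_zero hm hn, measure_ne_top _ _⟩,
    ⟨LocDiag.C_ne_zero m n, LocDiag.C_ne_top m n⟩,
    fun A hA => LocDiag.eigenvalueProb_eq hm hn hA,
    fun A hA => LocDiag.lintegral_ncard hm hn hA,
    LocDiag.volLU_eq_smul_map hm hn, ?_⟩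
  rw [LocDiag.C_eq]
  simp only [LocDiag.uVol_apply, LocDiag.coe_image_univ, LocDiag.coe_image_diagU]
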